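/- Let $k$ be a number field and let $\mathcal C\colon y^2=f(x)=f_8x^8+\dots+f_0$ with $f\in k[x]$ squarefree of degree $7$ or $8$; let $F(x,z)$ be the binary octic form belonging to $f$, $\mathcal J$ the Jacobian of $\mathcal C$ and $\mathcal K\subset\mathbb P^7$ its Kummer variety, with the following coordinates $\xi_1,\dots,\xi_8$. A point of $\mathcal J$ outside the theta divisor is given by quartic forms $A=\sum a_ix^iz^{4-i}$, $B=\sum b_ix^iz^{4-i}$, $C=\sum c_ix^iz^{4-i}$ with $B^2-AC=F$; with $\eta_{ij}=2b_ib_j-a_ic_j-a_jc_i$ its image is $$(1:\eta_{24}:\eta_{14}:\eta_{04}:\eta_{04}+\eta_{13}:\eta_{03}:\eta_{02}:\eta_{02}\eta_{24}-\eta_{03}\eta_{14}+\eta_{04}^2+\eta_{04}\eta_{13}),$$ and $\mathcal K$ is the Zariski closure of the set of these images. Let $v$ be an archimedean place of $k$, $|\cdot|_v$ the usual absolute value on $\mathbb C$, and regard $\mathcal C$, $\mathcal J$, $\mathcal K$ over $\mathbb C$ through $v$. The nontrivial even $2$-torsion points $T$ are the $35$ partitions of the roots of $F$ into two sets of four, i.e.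 factorizations $F=GH$ into quartic forms up to scaling and order. Let $r(T)=\operatorname{Res}(G,H)$, let $(\tau_1(T):\dots:\tau_8(T))$ with $\tau_1(T)=1$ be the image of $T$ on $\mathcal K$, let $M_T$ be the $8\times8$ matrix with upper right entry $1$ that induces translation by $T$ on $\mathcal K$, and let $y_T$ be the quadratic form with matrix $SM_T$, where $S$ is the matrix of $2(\xi_1\xi_8-\xi_2\xi_7+\xi_3\xi_6-\xi_4\xi_5)$. Put $\upsilon_j(T)=[\xi_{9-j}^2]y_T/(8r(T))$, so that $\xi_j^2=\sum_T\upsilon_j(T)\,y_T$. Let $\underline\delta=(\delta_1,\dots,\delta_8)$ be the quartic forms giving the duplication map on $\mathcal K$: they are invariant under $\mathcal J[2]$, $\delta_j=4\xi_j\xi_8^3+(\text{terms of degree}\le2\text{ in }\xi_8)$ for $j\le7$ and $\delta_8=\xi_8^4+(\text{terms of degree}\le2\text{ in }\xi_8)$; such forms exist. For $P\in\mathcal K(\mathbb C)$ (in particular for the image of a point of $\mathcal J(\mathbb C)$) with coordinate vector $\xi$ put $$\varepsilon_v(P)=\max_j\log|\delta_j(\xi)|_v-4\max_j\log|\xi_j|_v,\qquad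 \mu_v(P)=\sum_{n\ge0}4^{-(n+1)}\varepsilon_v(2^nP)=\lim_{n\to\infty}4^{-n}\max_j\log|\underline\delta^{\circ n}(\xi)_j|_v-\max_j\log|\xi_j|_v ,$$ where $2^nP$ is the point with coordinates $\underline\delta^{\circ n}(\xi)$; this is a nonzero vector and a point of $\mathcal K$, the series converges, and the limit exists and equals its sum. Define $f_v\colon\mathbb R_{\ge0}^8\to\mathbb R_{\ge0}^8$ by $$f_v(d)_j=\sqrt{\sum_T|\upsilon_j(T)|_v\sqrt{\textstyle\sum_{i=1}^8|\tau_i(T)d_{9-i}|_v}} ,$$ and the sequence $b_0=(1,\dots,1)$, $b_{n+1}=f_v(b_n)$. Let $\|\cdot\|_\infty$ be the maximum norm. Then: 1. $-\varepsilon_v(P)\le\log\max_j\Bigl(\sum_T|\upsilon_j(T)|_v\sqrt{\sum_{i=1}^8|\tau_i(T)|_v}\Bigr)^2$ for all $P\in\mathcal K(\mathbb C)$. 2. The sequence $(b_n)$ converges to a limit $b=b^{(v)}$, and $$-\mu_v(P)\le\frac{4^N}{4^N-1}\log\|b_N\|_\infty$$ for all $N\ge1$ and all $P\in\mathcal K(\mathbb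 C)$, hence for all $P\in\mathcal J(\mathbb C)$. In particular $\sup_P(-\mu_v(P))\le\log\|b\|_\infty$. 3. Consequently, with $n_v=[k_v:\mathbb R]$, the archimedean contribution $-\sum_{v\mid\infty}n_v\mu_v(P)$ to the difference $h(P)-\hat h(P)$ of naive and canonical height satisfies, for all $P\in\mathcal K(k)$ and all $N\ge1$, $$-\sum_{v\mid\infty}n_v\mu_v(P)\le\sum_{v\mid\infty}n_v\frac{4^N}{4^N-1}\log\|b^{(v)}_N\|_\infty\quad\text{and}\quad-\sum_{v\mid\infty}n_v\mu_v(P)\le\sum_{v\mid\infty}n_v\log\|b^{(v)}\|_\infty .$$ -/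

import Mathlib

open Polynomial Filter Topology

namespace Kum3

noncomputable section

/-! ### The Kummer variety in `ℙ⁷`

The genus 3 curve is `y² = f(x)` with `f` squarefree of degree 7 or 8. A binary form of degree `d`
is represented by its dehomogenisation, a polynomial of degree at most `d`. The eight coordinates
`ξ₁, …, ξ₈` are indexed by `Fin 8`, so `ξ_j` is `ξ (j - 1)` and `j ↦ 9 - j` is `Fin.rev`. -/

/-- For `i ≠ j`, the coefficient of `x_i x_j` in `B_l² - A_l C_l`, where `A_l = ∑ a_i x_i`, and
likewise for `B` and `C`. -/
def eta (A B C : ℂ[X]) (i j : ℕ) : ℂ :=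
  2 * B.coeff i * B.coeff j - A.coeff i * C.coeff j - A.coeff j * C.coeff i

/-- The coordinates `(1 : η₂₄ : η₁₄ : η₀₄ : η₀₄ + η₁₃ : η₀₃ : η₀₂ : η)` of the image on the Kummer
variety of the class of the divisor `A = 0, y = B` of degree 4, where `B² - A C = f`. -/
def kappa (A B C : ℂ[X]) : Fin 8 → ℂ :=
  let e := eta A B C
  ![1, e 2 4, e 1 4, e 0 4, e 0 4 + e 1 3, e 0 3, e 0 2,
    e 0 2 * e 2 4 - e 0 3 * e 1 4 + e 0 4 ^ 2 + e 0 4 * e 1 3]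

/-- The affine cone over the Kummer variety `𝒦 ⊆ ℙ⁷` of the Jacobian of `y² = f(x)`. The classes
outside the theta divisor are those given by triples `(A, B, C)` of quartic forms with
`B² - A C = f`; they are dense in the Jacobian, so that `𝒦` is the Zariski closure of the set of
their images. -/
def kummerCone (f : ℂ[X]) : Set (Fin 8 → ℂ) :=
  {ξ | ∀ (n : ℕ) (q : MvPolynomial (Fin 8) ℂ), q.IsHomogeneous n →
    (∀ A B C : ℂ[X], A.natDegree ≤ 4 → B.natDegree ≤ 4 → C.natDegree ≤ 4 → B ^ 2 - A * C = f →
      MvPolynomial.eval (kappa A B C) q = 0) →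
    MvPolynomial.eval ξ q = 0}

/-! ### Nontrivial even 2-torsion points

Given a factorisation `f = ∏ ℓ_i` into eight linear forms, the nontrivial even 2-torsion points are
the partitions of the eight roots into two sets of four, equivalently the sets `T` of four indices
that contain `0`. The corresponding factorisation is `f = G H` with `G = ∏_{i ∈ T} ℓ_i` and
`H = ∏_{i ∉ T} ℓ_i`. -/

/-- The 35 nontrivial even 2-torsion points. -/
def evenPts : Finset (Finset (Fin 8)) :=
  (Finset.powersetCard 4 Finset.univ).filter (fun T => 0 ∈ T)

/-- The coordinates `(1 : τ₂ : … : τ₈)` of the image on `𝒦` of the 2-torsion point belonging to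
`f = G H`, where `g` and `h` are the coefficients of `G` and `H`. -/
def tauForm (g h : Fin 5 → ℂ) : Fin 8 → ℂ :=
  let s : Fin 5 → Fin 5 → ℂ := fun i j => g i * h j + g j * h i
  ![1, s 2 4, s 1 4, s 0 4, s 0 4 + s 1 3, s 0 3, s 0 2,
    s 0 4 ^ 2 + s 0 2 * s 2 4 + (g 1 * h 0 - g 0 * h 1) * (g 4 * h 3 - g 3 * h 4)]

/-- The signs on the antidiagonal of `S`. -/
def sgn : Fin 8 → ℂ := ![1, -1, 1, -1, -1, 1, -1, 1]

/-- The symmetric matrix of the quadratic form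
`2 (ξ₁ ξ₈ - ξ₂ ξ₇ + ξ₃ ξ₆ - ξ₄ ξ₅)`, which vanishes on `𝒦`. -/
def matS : Matrix (Fin 8) (Fin 8) ℂ :=
  Matrix.of fun i j => if j = i.rev then sgn i else 0

/-- An auxiliary symmetric matrix in the minors `p_{ij} = g_i h_j - g_j h_i`. -/
def coreMat (g h : Fin 5 → ℂ) : Matrix (Fin 8) (Fin 8) ℂ :=
  let p : Fin 5 → Fin 5 → ℂ := fun i j => g i * h j - g j * h i
  let n22 := p 0 1 * p 0 3 + p 0 1 * p 1 2 - p 0 2 ^ 2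
  let n23 := p 0 2 * p 0 3 - p 0 1 * p 0 4 - p 0 1 * p 1 3
  let n24 := p 0 1 * p 2 3 + p 0 2 * p 0 4 - p 0 3 ^ 2
  let n25 := p 0 1 * p 1 4 - p 0 2 * p 0 4
  let n26 := p 0 3 * p 0 4 - p 0 1 * p 2 4
  let n27 := p 0 1 * p 3 4 - p 0 4 ^ 2
  let n33 := p 0 1 * p 1 4 + p 0 1 * p 2 3 - p 0 3 ^ 2
  let n34 := p 0 3 * p 0 4 + p 0 3 * p 1 3 - p 0 2 * p 1 4 - p 0 2 * p 2 3
  let n35 := p 0 3 * p 0 4 - p 0 1 * p 2 4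
  let n36 := p 0 2 * p 2 4 - p 0 4 ^ 2 - p 0 4 * p 1 3
  let n37 := p 0 4 * p 1 4 - p 0 2 * p 3 4
  let n44 := p 0 1 * p 3 4 - p 0 4 * p 1 3 + p 0 3 * p 2 3 + p 1 2 * p 1 4 + p 1 2 * p 2 3
    - p 0 4 ^ 2 - p 1 3 ^ 2
  let n45 := p 0 2 * p 2 4 - p 0 3 * p 1 4
  let n46 := p 0 4 * p 1 4 + p 1 3 * p 1 4 - p 0 3 * p 2 4 - p 1 2 * p 2 4
  let n47 := p 0 4 * p 2 4 + p 1 2 * p 3 4 - p 1 4 ^ 2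
  let n55 := p 0 1 * p 3 4 - p 0 4 ^ 2
  let n56 := p 0 4 * p 1 4 - p 0 2 * p 3 4
  let n57 := p 0 3 * p 3 4 - p 0 4 * p 2 4
  let n66 := p 0 3 * p 3 4 + p 1 2 * p 3 4 - p 1 4 ^ 2
  let n67 := p 1 4 * p 2 4 - p 0 4 * p 3 4 - p 1 3 * p 3 4
  let n77 := p 1 4 * p 3 4 + p 2 3 * p 3 4 - p 2 4 ^ 2
  !![0, 0, 0, 0, 0, 0, 0, 0;
     0, n22, n23, n24, n25, n26, n27, 0;
     0, n23, n33, n34, n35, n36, n37, 0;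
     0, n24, n34, n44, n45, n46, n47, 0;
     0, n25, n35, n45, n55, n56, n57, 0;
     0, n26, n36, n46, n56, n66, n67, 0;
     0, n27, n37, n47, n57, n67, n77, 0;
     0, 0, 0, 0, 0, 0, 0, 0]

/-- The symmetric matrix `S M_T` of the quadratic form `y_T`, where `r = Res(G, H)`: with
`N = coreMat g h`, the form is
`y_T(ξ) = ⟨τ, ξ⟩_S² + r ξ₁² + N(ξ - ξ₁ τ)`. Its entries are polynomials with integral coefficients
in the coefficients of `G` and `H`, and its lower right entry is `1`. -/
def yMatForm (g h : Fin 5 → ℂ) (r : ℂ) : Matrix (Fin 8) (Fin 8) ℂ :=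
  let τ := tauForm g h
  let v := Matrix.mulVec matS τ
  let Q := 1 - Matrix.vecMulVec τ (Pi.single 0 1)
  Matrix.vecMulVec v v + Matrix.single 0 0 r + Q.transpose * coreMat g h * Q

section Torsion

variable (ℓ : Fin 8 → ℂ[X]) (T : Finset (Fin 8))

/-- The quartic form `G = ∏_{i ∈ T} ℓ_i`; then `H` is `factor ℓ Tᶜ`. -/
def factor : ℂ[X] := ∏ i ∈ T, ℓ i

/-- The coefficients of `factor ℓ T`. -/
def factorCoeff : Fin 5 → ℂ := fun i => (factor ℓ T).coeff i

/-- `r(T) = Res(G, H)`, the resultant of two binary quartic forms. -/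
def resT : ℂ := resultant (factor ℓ T) (factor ℓ Tᶜ) 4 4

/-- The image `(1 : τ₂(T) : … : τ₈(T))` of `T` on `𝒦`. -/
def tau : Fin 8 → ℂ := tauForm (factorCoeff ℓ T) (factorCoeff ℓ Tᶜ)

/-- The symmetric matrix `S M_T` of the quadratic form `y_T`. -/
def yMat : Matrix (Fin 8) (Fin 8) ℂ :=
  yMatForm (factorCoeff ℓ T) (factorCoeff ℓ Tᶜ) (resT ℓ T)

/-- The matrix `M_T` by which translation by `T` acts on `ℙ⁷`, normalised by the entry `1` in its
upper right corner. Its last column is `τ(T)`, it satisfies `M_T² = r(T) I`, and up to scaling it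
is the only matrix that maps the image on `𝒦` of each 2-torsion point `T'` to a multiple of the
image of `T + T'`. -/
def torsMat : Matrix (Fin 8) (Fin 8) ℂ := matS * yMat ℓ T

/-- The coefficient `υ_j(T) = [ξ_{9-j}²] y_T / (8 r(T))` in `ξ_j² = ∑_T υ_j(T) y_T`. -/
def upsilon (j : Fin 8) : ℂ := yMat ℓ T j.rev j.rev / (8 * resT ℓ T)

end Torsion

/-! ### The duplication map and the local height functions -/

/-- `δ = (δ₁, …, δ₈)` is the tuple of quartic forms `(4 q₁, …, 4 q₇, q₈)` giving the duplication
map on `𝒦`: the forms are invariant under the action of the 2-torsion subgroup (generated by the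
even points, and with `T` acting through `M_T` divided by a square root of `r(T)`), and
`q_j = ξ_j ξ₈³ + (terms of degree at most 2 in ξ₈)`. This determines `δ` up to adding forms that
vanish on `𝒦`. -/
structure IsDuplication (ℓ : Fin 8 → ℂ[X]) (δ : Fin 8 → MvPolynomial (Fin 8) ℂ) : Prop where
  homogeneous : ∀ j, (δ j).IsHomogeneous 4
  invariant : ∀ T ∈ evenPts, ∀ j ξ,
    MvPolynomial.eval (Matrix.mulVec (torsMat ℓ T) ξ) (δ j) =
      resT ℓ T ^ 2 * MvPolynomial.eval ξ (δ j)
  leading : ∀ j, j ≠ 7 →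
    (δ j - MvPolynomial.C 4 * MvPolynomial.X j * MvPolynomial.X 7 ^ 3).degreeOf 7 ≤ 2
  leading_last : (δ 7 - MvPolynomial.X 7 ^ 4).degreeOf 7 ≤ 2

/-- The map on coordinate vectors given by `δ`. -/
def dupMap (δ : Fin 8 → MvPolynomial (Fin 8) ℂ) (ξ : Fin 8 → ℂ) : Fin 8 → ℂ :=
  fun j => MvPolynomial.eval ξ (δ j)

/-- `ε_v(P) = max_j log |δ_j(ξ)| - 4 max_j log |ξ_j|`; the norm on `Fin 8 → ℂ` is the maximum
norm. -/
def localEps (δ : Fin 8 → MvPolynomial (Fin 8) ℂ) (ξ : Fin 8 → ℂ) : ℝ :=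
  Real.log ‖dupMap δ ξ‖ - 4 * Real.log ‖ξ‖

/-- The terms of the series `μ_v(P) = ∑_{n ≥ 0} 4^{-(n+1)} ε_v(2ⁿ P)`. -/
def muTerm (δ : Fin 8 → MvPolynomial (Fin 8) ℂ) (ξ : Fin 8 → ℂ) (n : ℕ) : ℝ :=
  localEps δ ((dupMap δ)^[n] ξ) / 4 ^ (n + 1)

/-- The local height correction `μ_v(P)`. -/
def localMu (δ : Fin 8 → MvPolynomial (Fin 8) ℂ) (ξ : Fin 8 → ℂ) : ℝ :=
  ∑' n, muTerm δ ξ n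

/-! ### The archimedean bounds -/

/-- The vector with entries `∑_T |υ_j(T)| √(∑_i |τ_i(T)|)`. -/
def archVec (ℓ : Fin 8 → ℂ[X]) : Fin 8 → ℝ :=
  fun j => ∑ T ∈ evenPts, ‖upsilon ℓ T j‖ * √(∑ i, ‖tau ℓ T i‖)

/-- The function `f` of the iteration:
`d ↦ (√(∑_T |υ_j(T)| √(∑_i |τ_i(T) d_{9-i}|)))_j`. -/
def archFun (ℓ : Fin 8 → ℂ[X]) (d : Fin 8 → ℝ) : Fin 8 → ℝ :=
  fun j => √(∑ T ∈ evenPts, ‖upsilon ℓ T j‖ * √(∑ i, ‖tau ℓ T i‖ * |d i.rev|))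

/-- The sequence `b₀ = (1, …, 1)`, `b_{n+1} = f(b_n)`. -/
def archSeq (ℓ : Fin 8 → ℂ[X]) (n : ℕ) : Fin 8 → ℝ :=
  (archFun ℓ)^[n] 1

end

end Kum3

namespace Kum3

noncomputable section

/-! ### The half-spin representations

A vector `ξ` of the first half-spin representation is a triple `(s, X, t)` with scalars `s = ξ₁`,
`t = ξ₈` and an alternating `4 × 4` matrix `X` with entries `X₀₁ = ξ₇`, `X₀₂ = ξ₆`, `X₀₃ = ξ₄`,
`X₁₂ = ξ₅`, `X₁₃ = ξ₃`, `X₂₃ = ξ₂`. A vector of the second one is a pair `(a, c)` of vectors of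
length four. -/

/-! Two identities carry the bounds. Everywhere, ξ_j² = ∑_T υ_j(T) y_T (`Split.sq_eq_sum`); on 𝒦,
y_T² = ⟨τ(T), δ⟩_S (`IsDuplication.evVal_sq_eq`). By the triangle inequality they turn |δ_i(ξ)| ≤
d_i into |ξ_j| ≤ f_v(d)_j (`IsDuplication.norm_apply_le`), and N iterations give log‖ξ‖ ≤ 4^{-N}
log‖δ^N(ξ)‖ + log‖b_N‖. As the series for μ telescopes, -μ(P) ≤ log‖b_N‖ + 4^{-N}(-μ(2^N P)); the
supremum of -μ over 𝒦 is finite, and taking suprema yields the factor 4^N/(4^N - 1). The sequence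
b_n converges because f_v is monotone and homogeneous of degree 1/4, hence contracts logarithmic
coordinates by 1/4.

The identity for ξ_j² is linear algebra. The 35 matrices M_T commute up to the signs of the Weil
pairing, which separates the 36 even points, so that tr(M_A M_B) = 0 for A ≠ B and the 36 forms y_A
are a basis of the 36-dimensional space of quadratic forms. The commutation rule comes from Clifford
theory: ℂ⁸ is a half-spin representation, each root of F gives a vector of the quadratic space,
these eight vectors are orthogonal, and M_T extends to an operator on the spin representation that
anticommutes with the root vectors in T and commutes with the others. By Schur's lemma the product
of the root vectors in T' is inverse to the extension of M_{T'} up to a scalar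
(`Split.torsEnd_mul_torsEnd`).

For the identity on 𝒦, averaging over translations shows that an invariant quartic form is a
combination of the squares y_A², and the normalisation in ξ_8 forces δ_j = ∑_T c_T y_T² + c_∅ y_∅²
with ∑_T c_T ⟨τ(T), ·⟩_S = ξ_j (`IsDuplication.exists_eq_sum`). So if y_T(ξ)² = c⟨τ(T), ξ'⟩_S for
all T at a point ξ of 𝒦, then δ(ξ) = cξ'. Such a ξ' is explicit when (A, B, C) is the cross product
of two triples of quadratic forms: it is the point of their Gram matrix
(`Split.exists_evVal_sq_eq`). Up to a Vandermonde factor y_T is a determinant with one row for each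
root of G; at a root the Gram matrix is degenerate, the row becomes a pure tensor up to a fixed
linear map, and the Plücker relations identify the squared determinant with the Pfaffian of ξ' -
τ(T), which is ⟨τ(T), ξ'⟩_S.

A triple without linear syzygies is such a cross product (`exists_cross_eq`). Every triple has the
same image on 𝒦 as one given by four points of the curve with distinct abscissae, polynomial
functions on the fourth power of the curve form a domain, and the determinant detecting linear
syzygies does not vanish identically. Hence homogeneous relations that hold generically hold on 𝒦
(`eval_eq_zero_of_generic`); this also shows that δ maps 𝒦 to itself. -/

/-- Clifford multiplication by the vector `(w, e)` from the first to the second half-spin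
representation. -/
def gam (w e : Fin 4 → ℂ) (x : Fin 8 → ℂ) : Fin 8 → ℂ :=
  ![x 0 * w 0 + x 6 * e 1 + x 5 * e 2 + x 3 * e 3,
    x 0 * w 1 - x 6 * e 0 + x 4 * e 2 + x 2 * e 3,
    x 0 * w 2 - x 5 * e 0 - x 4 * e 1 + x 1 * e 3,
    x 0 * w 3 - x 3 * e 0 - x 2 * e 1 - x 1 * e 2,
    x 1 * w 1 - x 2 * w 2 + x 4 * w 3 - x 7 * e 0,
    -x 1 * w 0 + x 3 * w 2 - x 5 * w 3 - x 7 * e 1,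
    x 2 * w 0 - x 3 * w 1 + x 6 * w 3 - x 7 * e 2,
    -x 4 * w 0 + x 5 * w 1 - x 6 * w 2 - x 7 * e 3]

/-- Clifford multiplication by the vector `(w, e)` from the second to the first half-spin
representation. -/
def gam' (w e : Fin 4 → ℂ) (y : Fin 8 → ℂ) : Fin 8 → ℂ :=
  ![e 0 * y 0 + e 1 * y 1 + e 2 * y 2 + e 3 * y 3,
    y 2 * w 3 - w 2 * y 3 - (e 0 * y 5 - y 4 * e 1),
    y 1 * w 3 - w 1 * y 3 + (e 0 * y 6 - y 4 * e 2),
    y 0 * w 3 - w 0 * y 3 - (e 1 * y 6 - y 5 * e 2),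
    y 1 * w 2 - w 1 * y 2 - (e 0 * y 7 - y 4 * e 3),
    y 0 * w 2 - w 0 * y 2 + (e 1 * y 7 - y 5 * e 3),
    y 0 * w 1 - w 0 * y 1 - (e 2 * y 7 - y 6 * e 3),
    -(w 0 * y 4 + w 1 * y 5 + w 2 * y 6 + w 3 * y 7)]

/-- The bilinear form on the vector representation. -/
def dot4 (w e w' e' : Fin 4 → ℂ) : ℂ := ∑ i, (w i * e' i + w' i * e i)

lemma gam'_gam_add (w e w' e' : Fin 4 → ℂ) (x : Fin 8 → ℂ) :
    gam' w e (gam w' e' x) + gam' w' e' (gam w e x) = dot4 w e w' e' • x := by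
  ext i
  fin_cases i <;> simp [gam, gam', dot4, Fin.sum_univ_four] <;> ring

lemma gam_gam'_add (w e w' e' : Fin 4 → ℂ) (x : Fin 8 → ℂ) :
    gam w e (gam' w' e' x) + gam w' e' (gam' w e x) = dot4 w e w' e' • x := by
  ext i
  fin_cases i <;> simp [gam, gam', dot4, Fin.sum_univ_four] <;> ring

/-- The alternating matrix `X` of `ξ`, applied to a vector. -/
def altMul (t : Fin 8 → ℂ) (e : Fin 4 → ℂ) : Fin 4 → ℂ :=
  ![t 6 * e 1 + t 5 * e 2 + t 3 * e 3,
    -t 6 * e 0 + t 4 * e 2 + t 2 * e 3,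
    -t 5 * e 0 - t 4 * e 1 + t 1 * e 3,
    -t 3 * e 0 - t 2 * e 1 - t 1 * e 2]

/-- The Pfaffian of the alternating matrix of `ξ`. -/
def pf (x : Fin 8 → ℂ) : ℂ := x 1 * x 6 - x 2 * x 5 + x 3 * x 4

/-- The polarisation of the Pfaffian. -/
def pfB (x y : Fin 8 → ℂ) : ℂ :=
  x 1 * y 6 + y 1 * x 6 - x 2 * y 5 - y 2 * x 5 + x 3 * y 4 + y 3 * x 4

/-- The unipotent transformation of the first half-spin representation that adds `s B` to `X`,
where `B` is the alternating matrix of `u`. -/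
def shiftP (u x : Fin 8 → ℂ) : Fin 8 → ℂ :=
  ![x 0, x 1 + x 0 * u 1, x 2 + x 0 * u 2, x 3 + x 0 * u 3, x 4 + x 0 * u 4, x 5 + x 0 * u 5,
    x 6 + x 0 * u 6, x 7 + pfB u x + x 0 * pf u]

/-- The unipotent transformation of the second half-spin representation belonging to `u`. -/
def shiftM (u y : Fin 8 → ℂ) : Fin 8 → ℂ :=
  ![y 0, y 1, y 2, y 3,
    y 4 + (u 1 * y 1 - u 2 * y 2 + u 4 * y 3),
    y 5 + (-u 1 * y 0 + u 3 * y 2 - u 5 * y 3),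
    y 6 + (u 2 * y 0 - u 3 * y 1 + u 6 * y 3),
    y 7 + (-u 4 * y 0 + u 5 * y 1 - u 6 * y 2)]

/-- The pair of shifts is the element of the spin group over the isometry `(w, e) ↦ (w - altMul u e,
e)`, which is unipotent because `altMul u` is alternating. -/
lemma shiftM_gam (u : Fin 8 → ℂ) (w e : Fin 4 → ℂ) (x : Fin 8 → ℂ) :
    shiftM u (gam w e x) = gam (w - altMul u e) e (shiftP u x) := by
  ext i
  fin_cases i <;> simp [gam, shiftM, shiftP, altMul, pf, pfB] <;> ring

lemma shiftP_gam' (u : Fin 8 → ℂ) (w e : Fin 4 → ℂ) (y : Fin 8 → ℂ) :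
    shiftP u (gam' w e y) = gam' (w - altMul u e) e (shiftM u y) := by
  ext i
  fin_cases i <;> simp [gam', shiftM, shiftP, altMul, pf, pfB] <;> ring

lemma shiftP_neg_shiftP (u x : Fin 8 → ℂ) : shiftP (-u) (shiftP u x) = x := by
  ext i
  fin_cases i <;> simp [shiftP, pf, pfB]
  ring

/-- The `2 × 2` minors of a `4 × 4` matrix. -/
def minor2 (q : Matrix (Fin 4) (Fin 4) ℂ) (i j k l : Fin 4) : ℂ := q i k * q j l - q i l * q j k

/-- Laplace expansion along the first two rows, in the form in which the `2 × 2` minors enter the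
star operator. -/
lemma det_fin_four (q : Matrix (Fin 4) (Fin 4) ℂ) :
    q.det = minor2 q 0 1 0 1 * minor2 q 2 3 2 3 - minor2 q 0 1 0 2 * minor2 q 2 3 1 3
      + minor2 q 0 1 0 3 * minor2 q 2 3 1 2 + minor2 q 0 1 1 2 * minor2 q 2 3 0 3
      - minor2 q 0 1 1 3 * minor2 q 2 3 0 2 + minor2 q 0 1 2 3 * minor2 q 2 3 0 1 := by
  have h : q = !![q 0 0, q 0 1, q 0 2, q 0 3; q 1 0, q 1 1, q 1 2, q 1 3;
      q 2 0, q 2 1, q 2 2, q 2 3; q 3 0, q 3 1, q 3 2, q 3 3] := by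
    ext i j
    fin_cases i <;> fin_cases j <;> rfl
  rw [h]
  simp [Matrix.det_succ_row_zero, Fin.sum_univ_succ, minor2, Fin.succAbove]
  ring

/-- The matrix of `2 × 2` minors of `q`, applied to the dual of an alternating matrix. -/
def starMid (q : Matrix (Fin 4) (Fin 4) ℂ) (i j : Fin 4) (x : Fin 8 → ℂ) : ℂ :=
  -(x 1 * minor2 q i j 0 1 - x 2 * minor2 q i j 0 2 + x 4 * minor2 q i j 0 3
    + x 3 * minor2 q i j 1 2 - x 5 * minor2 q i j 1 3 + x 6 * minor2 q i j 2 3)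

/-- The Hodge star operator of the symmetric matrix `q` on the first half-spin representation. -/
def starP (q : Matrix (Fin 4) (Fin 4) ℂ) (x : Fin 8 → ℂ) : Fin 8 → ℂ :=
  ![x 7, starMid q 2 3 x, starMid q 1 3 x, starMid q 0 3 x, starMid q 1 2 x, starMid q 0 2 x,
    starMid q 0 1 x, q.det * x 0]

/-- The `3 × 3` minors of a `4 × 4` matrix. -/
def minor3 (q : Matrix (Fin 4) (Fin 4) ℂ) (i j k a b c : Fin 4) : ℂ :=
  q i a * minor2 q j k b c - q i b * minor2 q j k a c + q i c * minor2 q j k a b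

/-- The adjugate of a symmetric `4 × 4` matrix, applied to a vector. -/
def adjMul (q : Matrix (Fin 4) (Fin 4) ℂ) (y : Fin 4 → ℂ) : Fin 4 → ℂ :=
  ![minor3 q 1 2 3 1 2 3 * y 0 - minor3 q 1 2 3 0 2 3 * y 1 + minor3 q 1 2 3 0 1 3 * y 2
      - minor3 q 1 2 3 0 1 2 * y 3,
    -minor3 q 0 2 3 1 2 3 * y 0 + minor3 q 0 2 3 0 2 3 * y 1 - minor3 q 0 2 3 0 1 3 * y 2
      + minor3 q 0 2 3 0 1 2 * y 3,
    minor3 q 0 1 3 1 2 3 * y 0 - minor3 q 0 1 3 0 2 3 * y 1 + minor3 q 0 1 3 0 1 3 * y 2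
      - minor3 q 0 1 3 0 1 2 * y 3,
    -minor3 q 0 1 2 1 2 3 * y 0 + minor3 q 0 1 2 0 2 3 * y 1 - minor3 q 0 1 2 0 1 3 * y 2
      + minor3 q 0 1 2 0 1 2 * y 3]

/-- The Hodge star operator of the symmetric matrix `q` on the second half-spin representation. -/
def starM (q : Matrix (Fin 4) (Fin 4) ℂ) (y : Fin 8 → ℂ) : Fin 8 → ℂ :=
  ![-(q.mulVec ![y 4, y 5, y 6, y 7]) 0, -(q.mulVec ![y 4, y 5, y 6, y 7]) 1,
    -(q.mulVec ![y 4, y 5, y 6, y 7]) 2, -(q.mulVec ![y 4, y 5, y 6, y 7]) 3,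
    -adjMul q ![y 0, y 1, y 2, y 3] 0, -adjMul q ![y 0, y 1, y 2, y 3] 1,
    -adjMul q ![y 0, y 1, y 2, y 3] 2, -adjMul q ![y 0, y 1, y 2, y 3] 3]


/-- For invertible `q` the star operator lies over the isometry `(w, e) ↦ (q e, q⁻¹ w)`, which fixes
the vectors `(q e, e)` and negates the vectors `(-q e, e)`. Restricting to these two families avoids
the inverse. The next three lemmas are the remaining cases. -/
lemma starM_gam {q : Matrix (Fin 4) (Fin 4) ℂ} (hq : q.IsSymm) (e : Fin 4 → ℂ) (x : Fin 8 → ℂ) :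
    starM q (gam (q.mulVec e) e x) = gam (q.mulVec e) e (starP q x) := by
  have h10 := hq.apply 0 1
  have h20 := hq.apply 0 2
  have h30 := hq.apply 0 3
  have h21 := hq.apply 1 2
  have h31 := hq.apply 1 3
  have h32 := hq.apply 2 3
  ext i
  fin_cases i <;>
  simp [gam, starM, starP, starMid, adjMul, minor3, minor2, det_fin_four, Matrix.mulVec,
    dotProduct, Fin.sum_univ_four, h10, h20, h30, h21, h31, h32] <;> ring

lemma starM_gam_neg {q : Matrix (Fin 4) (Fin 4) ℂ} (hq : q.IsSymm) (e : Fin 4 → ℂ)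
    (x : Fin 8 → ℂ) :
    starM q (gam (-q.mulVec e) e x) = -gam (-q.mulVec e) e (starP q x) := by
  have h10 := hq.apply 0 1
  have h20 := hq.apply 0 2
  have h30 := hq.apply 0 3
  have h21 := hq.apply 1 2
  have h31 := hq.apply 1 3
  have h32 := hq.apply 2 3
  ext i
  fin_cases i <;>
  simp [gam, starM, starP, starMid, adjMul, minor3, minor2, det_fin_four, Matrix.mulVec,
    dotProduct, Fin.sum_univ_four, h10, h20, h30, h21, h31, h32] <;> ring

lemma starP_gam' {q : Matrix (Fin 4) (Fin 4) ℂ} (hq : q.IsSymm) (e : Fin 4 → ℂ)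
    (y : Fin 8 → ℂ) :
    starP q (gam' (q.mulVec e) e y) = gam' (q.mulVec e) e (starM q y) := by
  have h10 := hq.apply 0 1
  have h20 := hq.apply 0 2
  have h30 := hq.apply 0 3
  have h21 := hq.apply 1 2
  have h31 := hq.apply 1 3
  have h32 := hq.apply 2 3
  ext i
  fin_cases i <;>
  simp [gam', starM, starP, starMid, adjMul, minor3, minor2, det_fin_four, Matrix.mulVec,
    dotProduct, Fin.sum_univ_four, h10, h20, h30, h21, h31, h32] <;> ring

lemma starP_gam'_neg {q : Matrix (Fin 4) (Fin 4) ℂ} (hq : q.IsSymm) (e : Fin 4 → ℂ)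
    (y : Fin 8 → ℂ) :
    starP q (gam' (-q.mulVec e) e y) = -gam' (-q.mulVec e) e (starM q y) := by
  have h10 := hq.apply 0 1
  have h20 := hq.apply 0 2
  have h30 := hq.apply 0 3
  have h21 := hq.apply 1 2
  have h31 := hq.apply 1 3
  have h32 := hq.apply 2 3
  ext i
  fin_cases i <;>
  simp [gam', starM, starP, starMid, adjMul, minor3, minor2, det_fin_four, Matrix.mulVec,
    dotProduct, Fin.sum_univ_four, h10, h20, h30, h21, h31, h32] <;> ring

lemma starP_starP {q : Matrix (Fin 4) (Fin 4) ℂ} (hq : q.IsSymm) (x : Fin 8 → ℂ) :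
    starP q (starP q x) = q.det • x := by
  have h10 := hq.apply 0 1
  have h20 := hq.apply 0 2
  have h30 := hq.apply 0 3
  have h21 := hq.apply 1 2
  have h31 := hq.apply 1 3
  have h32 := hq.apply 2 3
  ext i
  fin_cases i <;>
  simp [starP, starMid, minor2, det_fin_four, h10, h20, h30, h21, h31, h32] <;> ring

/-- The matrix of the symmetric biform `(G(x) H(u) - G(u) H(x)) / (x - u)`. -/
def bez (g h : Fin 5 → ℂ) : Matrix (Fin 4) (Fin 4) ℂ :=
  let p : Fin 5 → Fin 5 → ℂ := fun i j => g i * h j - g j * h i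
  !![-p 0 1, -p 0 2, -p 0 3, -p 0 4;
     -p 0 2, -p 0 3 - p 1 2, -p 0 4 - p 1 3, -p 1 4;
     -p 0 3, -p 0 4 - p 1 3, -p 1 4 - p 2 3, -p 2 4;
     -p 0 4, -p 1 4, -p 2 4, -p 3 4]

lemma bez_isSymm (g h : Fin 5 → ℂ) : (bez g h).IsSymm := by
  ext i j
  fin_cases i <;> fin_cases j <;> simp [bez]

/-- The entries of `coreMat` are, up to order and sign, `2 × 2` minors of the Bezout matrix; this is
what connects the explicit form `y_T` to a star operator. -/
lemma coreMat_mulVec (g h : Fin 5 → ℂ) (d : Fin 8 → ℂ) :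
    (coreMat g h).mulVec d = ![0, -starMid (bez g h) 0 1 d, starMid (bez g h) 0 2 d,
      -starMid (bez g h) 1 2 d, -starMid (bez g h) 0 3 d, starMid (bez g h) 1 3 d,
      -starMid (bez g h) 2 3 d, 0] := by
  ext i
  fin_cases i <;>
  simp [coreMat, starMid, minor2, bez, Matrix.mulVec, dotProduct, Fin.sum_univ_eight] <;> ring

lemma matS_mulVec (y : Fin 8 → ℂ) :
    matS.mulVec y = ![y 7, -y 6, y 5, -y 4, -y 3, y 2, -y 1, y 0] := by
  ext i
  simp only [matS, Matrix.mulVec, dotProduct, Matrix.of_apply, ite_mul, zero_mul]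
  rw [Finset.sum_ite_eq' Finset.univ]
  fin_cases i <;> simp [sgn]

lemma tauForm_pf (g h : Fin 5 → ℂ) : tauForm g h 7 = pf (tauForm g h) := by
  simp [tauForm, pf]
  ring

lemma tauForm_zero (g h : Fin 5 → ℂ) : tauForm g h 0 = 1 := rfl

lemma yMatForm_mulVec (g h : Fin 5 → ℂ) (r : ℂ) (x : Fin 8 → ℂ) :
    (yMatForm g h r).mulVec x =
      (matS.mulVec (tauForm g h) ⬝ᵥ x) • matS.mulVec (tauForm g h) + Pi.single 0 (r * x 0) +
      ((coreMat g h).mulVec (x - x 0 • tauForm g h)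
        - Pi.single 0 (tauForm g h ⬝ᵥ (coreMat g h).mulVec (x - x 0 • tauForm g h))) := by
  have h1 : (1 - Matrix.vecMulVec (tauForm g h) (Pi.single 0 1)).mulVec x =
      x - x 0 • tauForm g h := by
    ext i
    simp [Matrix.sub_mulVec, Matrix.vecMulVec_mulVec, mul_comm]
  have h2 (y : Fin 8 → ℂ) : (1 - Matrix.vecMulVec (tauForm g h) (Pi.single 0 1)).transpose.mulVec y
      = y - Pi.single 0 (tauForm g h ⬝ᵥ y) := by
    ext i
    simp [Matrix.sub_mulVec, Matrix.vecMulVec_mulVec, Matrix.transpose_vecMulVec, Pi.single_apply]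
  have h3 : (Matrix.single 0 0 r : Matrix (Fin 8) (Fin 8) ℂ).mulVec x = Pi.single 0 (r * x 0) := by
    ext i
    simp [Matrix.single_mulVec, Pi.single_apply, Function.update_apply]
  rw [yMatForm]
  simp only [Matrix.add_mulVec, ← Matrix.mulVec_mulVec, h1, h2, h3, Matrix.vecMulVec_mulVec]
  congr 2
  ext i
  simp [mul_comm]

lemma single_zero_eq (c : ℂ) : (Pi.single 0 c : Fin 8 → ℂ) = ![c, 0, 0, 0, 0, 0, 0, 0] := by
  ext i
  fin_cases i <;> simp

/-- The shift by `-τ(T)` moves `τ(T)` to the first basis vector. In these coordinates translation by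
`T` is the star operator of the Bezout matrix of `G` and `H`. -/
lemma matS_mul_yMatForm_mulVec (g h : Fin 5 → ℂ) (x : Fin 8 → ℂ) :
    (matS * yMatForm g h (bez g h).det).mulVec x =
      shiftP (tauForm g h) (starP (bez g h) (shiftP (-tauForm g h) x)) := by
  have h7 := tauForm_pf g h
  have h0 := tauForm_zero g h
  have hm (i j : Fin 4) : starMid (bez g h) i j (shiftP (-tauForm g h) x) =
      starMid (bez g h) i j (x - x 0 • tauForm g h) := by
    simp [starMid, shiftP, sub_eq_add_neg]
  rw [← Matrix.mulVec_mulVec, yMatForm_mulVec, coreMat_mulVec, matS_mulVec, matS_mulVec,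
    single_zero_eq, single_zero_eq]
  rw [starP]
  simp only [hm]
  generalize tauForm g h = t at *
  ext i
  fin_cases i <;>
  simp [shiftP, dotProduct, Fin.sum_univ_eight, h0, h7, pf, pfB, -mul_eq_mul_right_iff] <;> ring

/-! ### Resultants -/

lemma det_bez_zero {g h : Fin 5 → ℂ} (hg : g 0 = 0) (hh : h 0 = 0) : (bez g h).det = 0 := by
  refine Matrix.det_eq_zero_of_row_eq_zero 0 fun j => ?_
  fin_cases j <;> simp [bez, hg, hh]

lemma det_bez_swap (g h : Fin 5 → ℂ) : (bez h g).det = (bez g h).det := by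
  have : bez h g = -bez g h := by
    ext i j
    fin_cases i <;> fin_cases j <;> simp [bez] <;> ring
  rw [this, Matrix.det_neg]
  norm_num

/-- The upper half of one half of the columns of the Sylvester matrix of two quartic forms. -/
def sylLow (g : ℕ → ℂ) : Matrix (Fin 4) (Fin 4) ℂ :=
  !![g 0, 0, 0, 0; g 1, g 0, 0, 0; g 2, g 1, g 0, 0; g 3, g 2, g 1, g 0]

/-- The lower half of one half of the columns of the Sylvester matrix of two quartic forms. -/
def sylUp (g : ℕ → ℂ) : Matrix (Fin 4) (Fin 4) ℂ :=
  !![g 4, g 3, g 2, g 1; 0, g 4, g 3, g 2; 0, 0, g 4, g 3; 0, 0, 0, g 4]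

lemma sylvester_four_four (G H : ℂ[X]) :
    (sylvester G H 4 4).submatrix finSumFinEquiv finSumFinEquiv =
      Matrix.fromBlocks (sylLow H.coeff) (sylLow G.coeff) (sylUp H.coeff) (sylUp G.coeff) := by
  ext i j
  rcases i with i | i <;> rcases j with j | j <;>
    simp only [Matrix.submatrix_apply, finSumFinEquiv_apply_left, finSumFinEquiv_apply_right,
      sylvester, Matrix.of_apply, Fin.addCases_left, Fin.addCases_right, Fin.val_castAdd,
      Fin.val_natAdd, Set.mem_Icc, Matrix.fromBlocks_apply₁₁, Matrix.fromBlocks_apply₁₂,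
      Matrix.fromBlocks_apply₂₁, Matrix.fromBlocks_apply₂₂] <;>
    fin_cases i <;> fin_cases j <;> simp [sylLow, sylUp]

lemma sylUp_mul_sylLow_sub (g h : ℕ → ℂ) :
    (sylUp g * sylLow h - sylUp h * sylLow g) =
      (bez (fun i => g i) (fun i => h i)).submatrix id Fin.rev := by
  ext i j
  fin_cases i <;> fin_cases j <;>
    simp [sylUp, sylLow, bez, Fin.rev] <;> ring

/-- Block column operations on the Sylvester matrix leave the Bezout matrix, with its columns
reversed, as lower right block. They multiply the determinant by `H(0)⁴`, which is why the constant
coefficient must not vanish. -/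
lemma resultant_eq_det_bez_of_ne (G H : ℂ[X]) (h0 : H.coeff 0 ≠ 0) :
    resultant G H 4 4 =
      (bez (fun i => G.coeff i) (fun i => H.coeff i)).det := by
  have h2 : Matrix.fromBlocks (sylLow H.coeff) (sylLow G.coeff) (sylUp H.coeff) (sylUp G.coeff) *
      Matrix.fromBlocks 1 (-sylLow G.coeff) 0 (sylLow H.coeff) =
      Matrix.fromBlocks (sylLow H.coeff) 0 (sylUp H.coeff)
        (sylUp G.coeff * sylLow H.coeff - sylUp H.coeff * sylLow G.coeff) := by
    rw [Matrix.fromBlocks_multiply]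
    congr 1
    · simp
    -- The two lower triangular Toeplitz blocks commute.
    · ext i j
      fin_cases i <;> fin_cases j <;>
        simp [sylLow] <;> ring
    · simp
    · simp [sub_eq_neg_add]
  have h3 : (sylLow H.coeff).det = H.coeff 0 ^ 4 := by
    rw [det_fin_four]
    simp [sylLow, minor2]
    ring
  have h4 : ((bez (fun i => G.coeff i) (fun i => H.coeff i)).submatrix id Fin.rev).det =
      (bez (fun i => G.coeff i) (fun i => H.coeff i)).det := by
    have := Matrix.det_permute' (Fin.revPerm : Equiv.Perm (Fin 4))
      (bez (fun i => G.coeff i) (fun i => H.coeff i))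
    rw [show (Fin.rev : Fin 4 → Fin 4) = (Fin.revPerm : Equiv.Perm (Fin 4)) from rfl, this,
      show Equiv.Perm.sign (Fin.revPerm : Equiv.Perm (Fin 4)) = 1 by decide]
    simp
  rw [resultant, ← Matrix.det_submatrix_equiv_self finSumFinEquiv, sylvester_four_four]
  have h5 := congrArg Matrix.det h2
  rw [Matrix.det_mul, Matrix.det_fromBlocks_zero₂₁, Matrix.det_fromBlocks_zero₁₂,
    sylUp_mul_sylLow_sub, h3, h4, Matrix.det_one, one_mul, mul_comm] at h5
  exact mul_left_cancel₀ (pow_ne_zero 4 h0) h5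

/-- The resultant of two binary quartic forms as a Bezout determinant. -/
lemma resultant_eq_det_bez (G H : ℂ[X]) :
    resultant G H 4 4 = (bez (fun i => G.coeff i) (fun i => H.coeff i)).det := by
  by_cases hH : H.coeff 0 = 0
  · by_cases hG : G.coeff 0 = 0
    · rw [det_bez_zero (by simpa using hG) (by simpa using hH)]
      refine Matrix.det_eq_zero_of_row_eq_zero 0 fun j => ?_
      fin_cases j <;> simp [sylvester, Fin.addCases, hG, hH]
    · rw [resultant_comm, resultant_eq_det_bez_of_ne H G hG, det_bez_swap]
      norm_num
  · exact resultant_eq_det_bez_of_ne G H hH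

lemma resT_eq (ℓ : Fin 8 → ℂ[X]) (T : Finset (Fin 8)) :
    resT ℓ T = (bez (factorCoeff ℓ T) (factorCoeff ℓ Tᶜ)).det :=
  resultant_eq_det_bez _ _

/-! ### The roots -/

/-- The first homogeneous coordinate of the root of `ℓ_i`. -/
def rtX (ℓ : Fin 8 → ℂ[X]) (i : Fin 8) : ℂ := -(ℓ i).coeff 0

/-- The second homogeneous coordinate of the root of `ℓ_i`. -/
def rtZ (ℓ : Fin 8 → ℂ[X]) (i : Fin 8) : ℂ := (ℓ i).coeff 1

/-- The determinant of the coordinates of two roots. -/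
def brk (ℓ : Fin 8 → ℂ[X]) (i j : Fin 8) : ℂ := rtX ℓ i * rtZ ℓ j - rtX ℓ j * rtZ ℓ i

/-- Eight linear forms that are pairwise not proportional. -/
structure Split (ℓ : Fin 8 → ℂ[X]) : Prop where
  deg : ∀ i, (ℓ i).natDegree ≤ 1
  brk_ne : ∀ i j, i ≠ j → brk ℓ i j ≠ 0

lemma Split.eq_linear {ℓ : Fin 8 → ℂ[X]} (hs : Split ℓ) (i : Fin 8) :
    ℓ i = C (rtZ ℓ i) * X - C (rtX ℓ i) := by
  conv_lhs => rw [eq_X_add_C_of_natDegree_le_one (hs.deg i)]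
  simp [rtZ, rtX]

lemma Split.coprime {ℓ : Fin 8 → ℂ[X]} (hs : Split ℓ) {i j : Fin 8} (hij : i ≠ j) :
    IsCoprime (ℓ i) (ℓ j) := by
  have h := hs.brk_ne i j hij
  refine ⟨C (-(rtZ ℓ j) / brk ℓ i j), C (rtZ ℓ i / brk ℓ i j), ?_⟩
  rw [hs.eq_linear i, hs.eq_linear j]
  have h1 : C (-(rtZ ℓ j) / brk ℓ i j) * (C (rtZ ℓ i) * X - C (rtX ℓ i)) +
      C (rtZ ℓ i / brk ℓ i j) * (C (rtZ ℓ j) * X - C (rtX ℓ j)) =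
      C ((-(rtZ ℓ j) / brk ℓ i j) * rtZ ℓ i + rtZ ℓ i / brk ℓ i j * rtZ ℓ j) * X +
      C (-(-(rtZ ℓ j) / brk ℓ i j * rtX ℓ i) - rtZ ℓ i / brk ℓ i j * rtX ℓ j) := by
    simp only [map_add, map_mul, map_sub, map_neg]
    ring
  have h2 : (-(rtZ ℓ j) / brk ℓ i j) * rtZ ℓ i + rtZ ℓ i / brk ℓ i j * rtZ ℓ j = 0 := by ring
  have h3 : -(-(rtZ ℓ j) / brk ℓ i j * rtX ℓ i) - rtZ ℓ i / brk ℓ i j * rtX ℓ j = 1 := by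
    field_simp
    rw [brk]
    ring
  rw [h1, h2, h3]
  simp

lemma Split.factor_coprime {ℓ : Fin 8 → ℂ[X]} (hs : Split ℓ) (T : Finset (Fin 8)) :
    IsCoprime (factor ℓ T) (factor ℓ Tᶜ) := by
  refine IsCoprime.prod_left fun i hi => IsCoprime.prod_right fun j hj => hs.coprime ?_
  rintro rfl
  exact (Finset.mem_compl.1 hj) hi

lemma Split.ne_zero {ℓ : Fin 8 → ℂ[X]} (hs : Split ℓ) (i : Fin 8) : ℓ i ≠ 0 := by
  intro h
  have : ∃ j, i ≠ j := ⟨i + 1, (by decide : ∀ i : Fin 8, i ≠ i + 1) i⟩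
  obtain ⟨j, hj⟩ := this
  apply hs.brk_ne i j hj
  simp [brk, rtX, rtZ, h]

lemma factor_natDegree_le {ℓ : Fin 8 → ℂ[X]} (hℓ : ∀ i, (ℓ i).natDegree ≤ 1)
    (T : Finset (Fin 8)) : (factor ℓ T).natDegree ≤ T.card := by
  refine (natDegree_prod_le _ _).trans ?_
  simpa using Finset.sum_le_sum fun i (_ : i ∈ T) => hℓ i

lemma factor_mul_compl (ℓ : Fin 8 → ℂ[X]) (T : Finset (Fin 8)) :
    factor ℓ T * factor ℓ Tᶜ = ∏ i, ℓ i :=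
  Finset.prod_mul_prod_compl T ℓ

/-- Two constant forms would both have their root at infinity, so at most one of the eight forms
drops its degree. -/
lemma Split.natDegree_factor_ge {ℓ : Fin 8 → ℂ[X]} (hs : Split ℓ) (T : Finset (Fin 8)) :
    7 ≤ (factor ℓ T).natDegree + (factor ℓ Tᶜ).natDegree := by
  have h0 (S : Finset (Fin 8)) : factor ℓ S ≠ 0 := Finset.prod_ne_zero_iff.2 fun i _ => hs.ne_zero i
  rw [← natDegree_mul (h0 _) (h0 _), factor_mul_compl,
    natDegree_prod _ _ fun i _ => hs.ne_zero i]
  have hdeg (i j : Fin 8) (hij : i ≠ j) (hi : (ℓ i).natDegree = 0) : (ℓ j).natDegree = 1 := by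
    have h1 := hs.deg j
    by_contra h
    have h2 : (ℓ j).natDegree = 0 := by omega
    apply hs.brk_ne i j hij
    simp [brk, rtZ, coeff_eq_zero_of_natDegree_lt (show (ℓ j).natDegree < 1 by omega),
      coeff_eq_zero_of_natDegree_lt (show (ℓ i).natDegree < 1 by omega)]
  by_cases h : ∃ i, (ℓ i).natDegree = 0
  · obtain ⟨i, hi⟩ := h
    rw [← Finset.add_sum_erase _ _ (Finset.mem_univ i), hi,
      Finset.sum_congr rfl fun j hj => hdeg i j (Finset.ne_of_mem_erase hj).symm hi]
    simp
  · push Not at h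
    have : ∀ i, (ℓ i).natDegree = 1 := fun i => by have := h i; have := hs.deg i; omega
    simp [this]

/-- Coprimality settles the resultant in the actual degrees. If one factor has its root at infinity
and degree 3, passing to formal degree 4 only contributes the leading coefficient of the other
factor, up to sign. -/
lemma Split.resT_ne_zero {ℓ : Fin 8 → ℂ[X]} (hs : Split ℓ) {T : Finset (Fin 8)}
    (hT : T.card = 4) : resT ℓ T ≠ 0 := by
  have hT' : Tᶜ.card = 4 := by simp [Finset.card_compl, hT]
  have h1 := factor_natDegree_le hs.deg T
  have h2 := factor_natDegree_le hs.deg Tᶜ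
  have h3 := hs.natDegree_factor_ge T
  have h4 := resultant_ne_zero _ _ (hs.factor_coprime T)
  rw [hT] at h1
  rw [hT'] at h2
  rw [resT]
  rcases h1.lt_or_eq with h5 | h5
  · have h6 : (factor ℓ T).natDegree = 3 := by omega
    have h7 : (factor ℓ Tᶜ).natDegree = 4 := by omega
    rw [h6, h7] at h4
    have := resultant_add_left_deg (factor ℓ T) (factor ℓ Tᶜ) 3 4 1 h6.le
    rw [this]
    refine mul_ne_zero (mul_ne_zero (by norm_num) (pow_ne_zero _ ?_)) h4
    rw [← h7]
    exact leadingCoeff_ne_zero.2 fun h => by simp [h] at h7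
  · rcases h2.lt_or_eq with h6 | h6
    · have h7 : (factor ℓ Tᶜ).natDegree = 3 := by omega
      rw [h5, h7] at h4
      have := resultant_add_right_deg (factor ℓ T) (factor ℓ Tᶜ) 4 3 1 h7.le
      rw [this]
      refine mul_ne_zero (pow_ne_zero _ ?_) h4
      rw [← h5]
      exact leadingCoeff_ne_zero.2 fun h => by simp [h] at h5
    · rwa [h5, h6] at h4

/-! ### The spin representation as an algebra -/

/-- The spin representation. -/
abbrev Spin : Type := (Fin 8 → ℂ) × (Fin 8 → ℂ)

/-- Clifford multiplication by `(w, e)` on the spin representation. -/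
def cliff (w e : Fin 4 → ℂ) : Module.End ℂ Spin where
  toFun p := (gam' w e p.2, gam w e p.1)
  map_add' p p' := by
    ext i <;> fin_cases i <;> simp [gam, gam'] <;> ring
  map_smul' c p := by
    ext i <;> fin_cases i <;> simp [gam, gam'] <;> ring

lemma cliff_apply (w e : Fin 4 → ℂ) (p : Spin) : cliff w e p = (gam' w e p.2, gam w e p.1) := rfl

lemma cliff_add (w e w' e' : Fin 4 → ℂ) : cliff (w + w') (e + e') = cliff w e + cliff w' e' := by
  refine LinearMap.ext fun p => ?_
  ext i <;> fin_cases i <;> simp [cliff_apply, gam, gam'] <;> ring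

lemma cliff_smul (c : ℂ) (w e : Fin 4 → ℂ) : cliff (c • w) (c • e) = c • cliff w e := by
  refine LinearMap.ext fun p => ?_
  ext i <;> fin_cases i <;> simp [cliff_apply, gam, gam'] <;> ring

lemma cliff_mul_add (w e w' e' : Fin 4 → ℂ) :
    cliff w e * cliff w' e' + cliff w' e' * cliff w e = dot4 w e w' e' • 1 := by
  refine LinearMap.ext fun p => Prod.ext ?_ ?_
  · exact gam'_gam_add w e w' e' p.1
  · exact gam_gam'_add w e w' e' p.2

/-- Under the vectors `(w, 0)` the spin representation is the exterior algebra on four generators,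
and the first basis vector is its unit; repeated multiplication reaches every basis vector up to
sign. -/
lemma spin_submodule_eq_top (K : Submodule ℂ Spin)
    (h0 : ((Pi.single 0 1, 0) : Spin) ∈ K) (hK : ∀ w e, ∀ p ∈ K, cliff w e p ∈ K) : K = ⊤ := by
  have ha (i : Fin 4) : ((0, Pi.single (Fin.castAdd 4 i) 1) : Spin) ∈ K := by
    convert hK (Pi.single i 1) 0 _ h0 using 1
    ext j <;> fin_cases i <;> fin_cases j <;> simp [cliff_apply, gam, gam']
  have h6 : ((Pi.single 6 1, 0) : Spin) ∈ K := by
    convert hK (Pi.single 1 1) 0 _ (ha 0) using 1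
    ext j <;> fin_cases j <;> simp [cliff_apply, gam, gam']
  have h5 : ((Pi.single 5 1, 0) : Spin) ∈ K := by
    convert hK (Pi.single 2 1) 0 _ (ha 0) using 1
    ext j <;> fin_cases j <;> simp [cliff_apply, gam, gam']
  have h3 : ((Pi.single 3 1, 0) : Spin) ∈ K := by
    convert hK (Pi.single 3 1) 0 _ (ha 0) using 1
    ext j <;> fin_cases j <;> simp [cliff_apply, gam, gam']
  have h4 : ((Pi.single 4 1, 0) : Spin) ∈ K := by
    convert hK (Pi.single 2 1) 0 _ (ha 1) using 1
    ext j <;> fin_cases j <;> simp [cliff_apply, gam, gam']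
  have h2 : ((Pi.single 2 1, 0) : Spin) ∈ K := by
    convert hK (Pi.single 3 1) 0 _ (ha 1) using 1
    ext j <;> fin_cases j <;> simp [cliff_apply, gam, gam']
  have h1 : ((Pi.single 1 1, 0) : Spin) ∈ K := by
    convert hK (Pi.single 3 1) 0 _ (ha 2) using 1
    ext j <;> fin_cases j <;> simp [cliff_apply, gam, gam']
  have c0 : ((0, Pi.single 4 1) : Spin) ∈ K := by
    convert hK (Pi.single 1 1) 0 _ h1 using 1
    ext j <;> fin_cases j <;> simp [cliff_apply, gam, gam']
  have c1 : ((0, Pi.single 5 1) : Spin) ∈ K := by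
    convert hK (Pi.single 2 1) 0 _ h3 using 1
    ext j <;> fin_cases j <;> simp [cliff_apply, gam, gam']
  have c2 : ((0, Pi.single 6 1) : Spin) ∈ K := by
    convert hK (Pi.single 3 1) 0 _ h6 using 1
    ext j <;> fin_cases j <;> simp [cliff_apply, gam, gam']
  have c3 : ((0, Pi.single 7 1) : Spin) ∈ K := by
    convert hK (Pi.single 1 1) 0 _ h5 using 1
    ext j <;> fin_cases j <;> simp [cliff_apply, gam, gam']
  have h7 : ((Pi.single 7 1, 0) : Spin) ∈ K := by
    convert K.neg_mem (hK (Pi.single 0 1) 0 _ c0) using 1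
    ext j <;> fin_cases j <;> simp [cliff_apply, gam, gam']
  have hP (i : Fin 8) : ((Pi.single i 1, 0) : Spin) ∈ K := by
    fin_cases i
    exacts [h0, h1, h2, h3, h4, h5, h6, h7]
  have hM (i : Fin 8) : ((0, Pi.single i 1) : Spin) ∈ K := by
    fin_cases i
    exacts [ha 0, ha 1, ha 2, ha 3, c0, c1, c2, c3]
  refine eq_top_iff.2 fun p _ => ?_
  have hp : p = ∑ i, p.1 i • ((Pi.single i 1, 0) : Spin) +
      ∑ i, p.2 i • ((0, Pi.single i 1) : Spin) := by
    refine Prod.ext ?_ ?_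
    · ext j
      simp [Prod.fst_sum, Finset.sum_apply, Pi.single_apply]
    · ext j
      simp [Prod.snd_sum, Finset.sum_apply, Pi.single_apply]
  rw [hp]
  exact K.add_mem (K.sum_mem fun i _ => K.smul_mem _ (hP i))
    (K.sum_mem fun i _ => K.smul_mem _ (hM i))

/-- Schur's lemma for the spin representation. -/
lemma eq_smul_one_of_commute (Z : Module.End ℂ Spin) (hZ : ∀ w e, Commute Z (cliff w e)) :
    ∃ c : ℂ, Z = c • 1 := by
  have h (e : Fin 4 → ℂ) : cliff 0 e (Z (Pi.single 0 1, 0)) = 0 := by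
    have := congrArg (fun F : Module.End ℂ Spin => F (Pi.single 0 1, 0)) (hZ 0 e).eq
    simp only [Module.End.mul_apply] at this
    rw [← this]
    have h0 : cliff 0 e (Pi.single 0 1, 0) = 0 := by
      ext j <;> fin_cases j <;> simp [cliff_apply, gam, gam']
    rw [h0, map_zero]
  -- Only multiples of the first basis vector are annihilated by all vectors `(0, e)`.
  have hc : Z (Pi.single 0 1, 0) = (Z (Pi.single 0 1, 0)).1 0 • ((Pi.single 0 1, 0) : Spin) := by
    generalize Z (Pi.single 0 1, 0) = p at h
    have e0 := h (Pi.single 0 1)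
    have e1 := h (Pi.single 1 1)
    have e2 := h (Pi.single 2 1)
    have e3 := h (Pi.single 3 1)
    simp only [cliff_apply, gam, gam', Prod.ext_iff, funext_iff, Fin.forall_fin_succ] at e0 e1 e2 e3
    simp at e0 e1 e2 e3
    ext j <;> fin_cases j <;> simp <;> grind
  refine ⟨(Z (Pi.single 0 1, 0)).1 0, LinearMap.ext fun p => ?_⟩
  -- The locus where `Z` agrees with the scalar is stable under Clifford multiplication and contains
  -- a generator.
  have := spin_submodule_eq_top
    (LinearMap.eqLocus Z ((Z (Pi.single 0 1, 0)).1 0 • (1 : Module.End ℂ Spin))) hc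
    (fun w e p hp => by
      rw [LinearMap.mem_eqLocus] at hp ⊢
      have := congrArg (fun F : Module.End ℂ Spin => F p) (hZ w e).eq
      simp only [Module.End.mul_apply] at this
      rw [this, hp]
      simp)
  have hp : p ∈ (⊤ : Submodule ℂ Spin) := trivial
  rw [← this] at hp
  exact hp

/-! ### The vectors belonging to the roots -/

/-- The vector of cubic monomials at a point of `ℙ¹`. -/
def mon3 (x z : ℂ) : Fin 4 → ℂ := ![z ^ 3, x * z ^ 2, x ^ 2 * z, x ^ 3]

/-- The value of a quartic form at a point of `ℙ¹`. -/
def ev4 (g : Fin 5 → ℂ) (x z : ℂ) : ℂ :=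
  g 0 * z ^ 4 + g 1 * (x * z ^ 3) + g 2 * (x ^ 2 * z ^ 2) + g 3 * (x ^ 3 * z) + g 4 * x ^ 4

/-- The product of `x - z u` and a cubic form in `u`. -/
def mulLin (x z : ℂ) (w : Fin 4 → ℂ) : Fin 5 → ℂ :=
  ![x * w 0, x * w 1 - z * w 0, x * w 2 - z * w 1, x * w 3 - z * w 2, -(z * w 3)]

/-- The contraction with a point of a symmetric `5 × 5` matrix representing a form of degree
eight. -/
def etaStd (f : ℕ → ℂ) (x z : ℂ) : Fin 5 → ℂ :=
  ![2 * f 0 * z ^ 4 + f 1 * (x * z ^ 3),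
    f 1 * z ^ 4 + 2 * f 2 * (x * z ^ 3) + f 3 * (x ^ 2 * z ^ 2),
    f 3 * (x * z ^ 3) + 2 * f 4 * (x ^ 2 * z ^ 2) + f 5 * (x ^ 3 * z),
    f 5 * (x ^ 2 * z ^ 2) + 2 * f 6 * (x ^ 3 * z) + f 7 * x ^ 4,
    f 7 * (x ^ 3 * z) + 2 * f 8 * x ^ 4]

lemma mulLin_injective {x z : ℂ} (h : x ≠ 0 ∨ z ≠ 0) {w w' : Fin 4 → ℂ}
    (hw : mulLin x z w = mulLin x z w') : w = w' := by
  simp only [mulLin, funext_iff, Fin.forall_fin_succ] at hw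
  simp at hw
  obtain ⟨h0, h1, h2, h3, h4⟩ := hw
  have key (i : Fin 4) : w i - w' i = 0 := by
    rcases h with h | h
    · have e0 : w 0 - w' 0 = 0 := by
        apply mul_left_cancel₀ h; grind
      have e1 : w 1 - w' 1 = 0 := by
        apply mul_left_cancel₀ h; linear_combination h1 + z * e0
      have e2 : w 2 - w' 2 = 0 := by
        apply mul_left_cancel₀ h; linear_combination h2 + z * e1
      have e3 : w 3 - w' 3 = 0 := by
        apply mul_left_cancel₀ h; linear_combination h3 + z * e2
      fin_cases i <;> assumption
    · have e3 : w 3 - w' 3 = 0 := by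
        apply mul_left_cancel₀ h; grind
      have e2 : w 2 - w' 2 = 0 := by
        apply mul_left_cancel₀ h; linear_combination -h3 + x * e3
      have e1 : w 1 - w' 1 = 0 := by
        apply mul_left_cancel₀ h; linear_combination -h2 + x * e2
      have e0 : w 0 - w' 0 = 0 := by
        apply mul_left_cancel₀ h; linear_combination -h1 + x * e1
      fin_cases i <;> assumption
  ext i
  exact sub_eq_zero.1 (key i)

lemma mulLin_bez (g h : Fin 5 → ℂ) (x z : ℂ) :
    mulLin x z ((bez g h).mulVec (mon3 x z)) = ev4 g x z • h - ev4 h x z • g := by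
  ext i
  fin_cases i <;> simp [mulLin, bez, mon3, ev4, Matrix.mulVec, dotProduct, Fin.sum_univ_four] <;>
    ring

/-- `f` is the product of the quartic forms `g` and `h`. -/
def IsProd (f : ℕ → ℂ) (g h : Fin 5 → ℂ) : Prop :=
  f 0 = g 0 * h 0 ∧ f 1 = g 0 * h 1 + g 1 * h 0 ∧ f 2 = g 0 * h 2 + g 1 * h 1 + g 2 * h 0 ∧
  f 3 = g 0 * h 3 + g 1 * h 2 + g 2 * h 1 + g 3 * h 0 ∧
  f 4 = g 0 * h 4 + g 1 * h 3 + g 2 * h 2 + g 3 * h 1 + g 4 * h 0 ∧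
  f 5 = g 1 * h 4 + g 2 * h 3 + g 3 * h 2 + g 4 * h 1 ∧
  f 6 = g 2 * h 4 + g 3 * h 3 + g 4 * h 2 ∧ f 7 = g 3 * h 4 + g 4 * h 3 ∧ f 8 = g 4 * h 4

/-- The symmetric biforms `g ⊗ h + h ⊗ g` and `etaStd f` both restrict to `2 f` on the diagonal.
Their difference is therefore divisible by the equation of the diagonal, and the quotient is the
alternating biform with the matrix of `τ`. -/
lemma mulLin_altMul_tauForm {f : ℕ → ℂ} {g h : Fin 5 → ℂ} (hf : IsProd f g h) (x z : ℂ) :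
    mulLin x z (altMul (tauForm g h) (mon3 x z)) =
      ev4 g x z • h + ev4 h x z • g - etaStd f x z := by
  obtain ⟨h0, h1, h2, h3, h4, h5, h6, h7, h8⟩ := hf
  ext i
  fin_cases i <;> simp [mulLin, mon3, ev4, altMul, tauForm, etaStd, *] <;> ring

lemma mulLin_add (x z : ℂ) (w w' : Fin 4 → ℂ) : mulLin x z (w + w') = mulLin x z w + mulLin x z w' := by
  ext i
  fin_cases i <;> simp [mulLin] <;> ring

lemma mulLin_smul (x z c : ℂ) (w : Fin 4 → ℂ) : mulLin x z (c • w) = c • mulLin x z w := by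
  ext i
  fin_cases i <;> simp [mulLin] <;> ring

lemma mulLin_neg (x z : ℂ) (w : Fin 4 → ℂ) : mulLin x z (-w) = -mulLin x z w := by
  ext i
  fin_cases i <;> simp [mulLin] <;> ring

lemma mulLin_sub (x z : ℂ) (w w' : Fin 4 → ℂ) : mulLin x z (w - w') = mulLin x z w - mulLin x z w' := by
  rw [sub_eq_add_neg, mulLin_add, mulLin_neg, sub_eq_add_neg]

lemma ev4_mulLin (x z x' z' : ℂ) (w : Fin 4 → ℂ) :
    ev4 (mulLin x z w) x' z' = (x * z' - x' * z) * (w ⬝ᵥ mon3 x' z') := by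
  simp [ev4, mulLin, mon3, dotProduct, Fin.sum_univ_four]
  ring

lemma ev4_etaStd_comm (f : ℕ → ℂ) (x z x' z' : ℂ) :
    ev4 (etaStd f x z) x' z' = ev4 (etaStd f x' z') x z := by
  simp [ev4, etaStd]
  ring

/-- The coefficients of a product of polynomials of degree at most four. -/
lemma isProd_coeff {G H F : ℂ[X]} (hG : G.natDegree ≤ 4) (hH : H.natDegree ≤ 4) (hF : G * H = F) :
    IsProd F.coeff (fun i => G.coeff i) (fun i => H.coeff i) := by
  have hG' (n : ℕ) (hn : 4 < n) : G.coeff n = 0 := coeff_eq_zero_of_natDegree_lt (by omega)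
  have hH' (n : ℕ) (hn : 4 < n) : H.coeff n = 0 := coeff_eq_zero_of_natDegree_lt (by omega)
  subst hF
  refine ⟨?_, ?_, ?_, ?_, ?_, ?_, ?_, ?_, ?_⟩ <;>
    simp [coeff_mul, Finset.Nat.antidiagonal_succ, hG', hH'] <;> ring

/-- The value of a form of degree `n` at a point of `ℙ¹`. -/
def hev (n : ℕ) (p : ℂ[X]) (x z : ℂ) : ℂ := ∑ k ∈ Finset.range (n + 1), p.coeff k * x ^ k * z ^ (n - k)

lemma hev_of_ne (n : ℕ) (p : ℂ[X]) (hp : p.natDegree ≤ n) (x : ℂ) {z : ℂ} (hz : z ≠ 0) :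
    hev n p x z = z ^ n * p.eval (x / z) := by
  rw [eval_eq_sum_range' (Nat.lt_succ_of_le hp), hev, Finset.mul_sum]
  refine Finset.sum_congr rfl fun k hk => ?_
  have : n = k + (n - k) := by have := Finset.mem_range.1 hk; omega
  conv_rhs => rw [this, pow_add]
  rw [div_pow]
  field_simp

lemma hev_zero (n : ℕ) (p : ℂ[X]) (x : ℂ) : hev n p x 0 = p.coeff n * x ^ n := by
  rw [hev, Finset.sum_range_succ, Finset.sum_eq_zero]
  · simp
  · intro k hk
    have := Finset.mem_range.1 hk
    rw [zero_pow (by omega)]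
    simp

lemma hev_mul {m n : ℕ} {p q : ℂ[X]} (hp : p.natDegree ≤ m) (hq : q.natDegree ≤ n) (x z : ℂ) :
    hev (m + n) (p * q) x z = hev m p x z * hev n q x z := by
  by_cases hz : z = 0
  · subst hz
    rw [hev_zero, hev_zero, hev_zero, coeff_mul_add_eq_of_natDegree_le hp hq, pow_add]
    ring
  · rw [hev_of_ne _ _ (natDegree_mul_le_of_le hp hq) _ hz, hev_of_ne _ _ hp _ hz,
      hev_of_ne _ _ hq _ hz, eval_mul, pow_add]
    ring

lemma ev4_coeff (p : ℂ[X]) (x z : ℂ) : ev4 (fun i => p.coeff i) x z = hev 4 p x z := by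
  simp [ev4, hev, Finset.sum_range_succ]
  ring

lemma hev_factor {ℓ : Fin 8 → ℂ[X]} (hℓ : ∀ i, (ℓ i).natDegree ≤ 1) (T : Finset (Fin 8)) (x z : ℂ) :
    hev T.card (factor ℓ T) x z = ∏ j ∈ T, (x * rtZ ℓ j - rtX ℓ j * z) := by
  induction T using Finset.induction with
  | empty => simp [factor, hev]
  | insert a s has IH =>
    rw [Finset.card_insert_of_notMem has, factor, Finset.prod_insert has, add_comm, ← factor,
      hev_mul (hℓ a) (factor_natDegree_le hℓ s), IH, Finset.prod_insert has]
    congr 1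
    simp [hev, Finset.sum_range_succ, rtX, rtZ]
    ring

lemma ev4_factorCoeff {ℓ : Fin 8 → ℂ[X]} (hℓ : ∀ i, (ℓ i).natDegree ≤ 1) {T : Finset (Fin 8)}
    (hT : T.card = 4) (x z : ℂ) :
    ev4 (factorCoeff ℓ T) x z = ∏ j ∈ T, (x * rtZ ℓ j - rtX ℓ j * z) := by
  rw [← hev_factor hℓ, hT, ← ev4_coeff]
  rfl

lemma ev4_factorCoeff_of_mem {ℓ : Fin 8 → ℂ[X]} (hℓ : ∀ i, (ℓ i).natDegree ≤ 1)
    {T : Finset (Fin 8)} (hT : T.card = 4) {i : Fin 8} (hi : i ∈ T) :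
    ev4 (factorCoeff ℓ T) (rtX ℓ i) (rtZ ℓ i) = 0 := by
  rw [ev4_factorCoeff hℓ hT]
  exact Finset.prod_eq_zero hi (by ring)

lemma isProd_factorCoeff {ℓ : Fin 8 → ℂ[X]} (hℓ : ∀ i, (ℓ i).natDegree ≤ 1) {T : Finset (Fin 8)}
    (hT : T.card = 4) : IsProd (∏ i, ℓ i).coeff (factorCoeff ℓ T) (factorCoeff ℓ Tᶜ) := by
  have hT' : Tᶜ.card = 4 := by simp [Finset.card_compl, hT]
  exact isProd_coeff ((factor_natDegree_le hℓ T).trans hT.le)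
    ((factor_natDegree_le hℓ Tᶜ).trans hT'.le) (factor_mul_compl ℓ T)

/-- The sign by which translation by `T` acts on the vector of a root. -/
def sig (T : Finset (Fin 8)) (i : Fin 8) : ℂ := if i ∈ T then -1 else 1

/-- The second half of the vector of a root. -/
def rtE (ℓ : Fin 8 → ℂ[X]) (i : Fin 8) : Fin 4 → ℂ := mon3 (rtX ℓ i) (rtZ ℓ i)

/-- The first half of the vector of a root. -/
def rtW (ℓ : Fin 8 → ℂ[X]) (i : Fin 8) : Fin 4 → ℂ :=
  sig {0, 1, 2, 3} i • (bez (factorCoeff ℓ {0, 1, 2, 3}) (factorCoeff ℓ {0, 1, 2, 3}ᶜ)).mulVec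
    (rtE ℓ i) - altMul (tau ℓ {0, 1, 2, 3}) (rtE ℓ i)

lemma Split.rt_ne_zero {ℓ : Fin 8 → ℂ[X]} (hs : Split ℓ) (i : Fin 8) :
    rtX ℓ i ≠ 0 ∨ rtZ ℓ i ≠ 0 := by
  by_contra! h
  apply hs.ne_zero i
  rw [hs.eq_linear i, h.1, h.2]
  simp

/-- At a root one of `G`, `H` vanishes, so the contractions of the Bezout form and of `g ⊗ h + h ⊗
g` agree up to the sign `sig T i` and cancel. The remaining term depends only on `f`; hence the
vector of a root does not depend on the chosen partition. -/
lemma mulLin_center {ℓ : Fin 8 → ℂ[X]} (hℓ : ∀ i, (ℓ i).natDegree ≤ 1) {T : Finset (Fin 8)}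
    (hT : T.card = 4) (i : Fin 8) :
    mulLin (rtX ℓ i) (rtZ ℓ i) (sig T i • (bez (factorCoeff ℓ T) (factorCoeff ℓ Tᶜ)).mulVec
      (rtE ℓ i) - altMul (tau ℓ T) (rtE ℓ i)) =
      etaStd (∏ i, ℓ i).coeff (rtX ℓ i) (rtZ ℓ i) := by
  have hT' : Tᶜ.card = 4 := by simp [Finset.card_compl, hT]
  rw [mulLin_sub, mulLin_smul, rtE, mulLin_bez, tau,
    mulLin_altMul_tauForm (isProd_factorCoeff hℓ hT)]
  by_cases hi : i ∈ T
  · rw [ev4_factorCoeff_of_mem hℓ hT hi, sig, if_pos hi]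
    ext j
    simp
  · rw [ev4_factorCoeff_of_mem hℓ hT' (Finset.mem_compl.2 hi), sig, if_neg hi]
    ext j
    simp

lemma Split.rtW_eq {ℓ : Fin 8 → ℂ[X]} (hs : Split ℓ) {T : Finset (Fin 8)} (hT : T.card = 4)
    (i : Fin 8) : rtW ℓ i = sig T i • (bez (factorCoeff ℓ T) (factorCoeff ℓ Tᶜ)).mulVec
      (rtE ℓ i) - altMul (tau ℓ T) (rtE ℓ i) := by
  apply mulLin_injective (hs.rt_ne_zero i)
  rw [mulLin_center hs.deg hT, rtW, mulLin_center hs.deg (by decide)]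

lemma Split.mulLin_rtW {ℓ : Fin 8 → ℂ[X]} (hs : Split ℓ) (i : Fin 8) :
    mulLin (rtX ℓ i) (rtZ ℓ i) (rtW ℓ i) = etaStd (∏ i, ℓ i).coeff (rtX ℓ i) (rtZ ℓ i) := by
  rw [rtW, mulLin_center hs.deg (by decide)]

/-- Multiplied by the bracket of the two roots, each cross term becomes a value of the symmetric
form `etaStd`, while the bracket changes sign under exchange; the two terms cancel. -/
lemma Split.dot4_eq_zero {ℓ : Fin 8 → ℂ[X]} (hs : Split ℓ) {i j : Fin 8} (hij : i ≠ j) :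
    dot4 (rtW ℓ i) (rtE ℓ i) (rtW ℓ j) (rtE ℓ j) = 0 := by
  have h1 := ev4_mulLin (rtX ℓ i) (rtZ ℓ i) (rtX ℓ j) (rtZ ℓ j) (rtW ℓ i)
  have h2 := ev4_mulLin (rtX ℓ j) (rtZ ℓ j) (rtX ℓ i) (rtZ ℓ i) (rtW ℓ j)
  rw [hs.mulLin_rtW] at h1 h2
  rw [ev4_etaStd_comm] at h1
  have h3 : dot4 (rtW ℓ i) (rtE ℓ i) (rtW ℓ j) (rtE ℓ j) =
      rtW ℓ i ⬝ᵥ rtE ℓ j + rtW ℓ j ⬝ᵥ rtE ℓ i := by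
    rw [dot4, Finset.sum_add_distrib]
    rfl
  rw [h3]
  apply mul_left_cancel₀ (hs.brk_ne i j hij)
  rw [brk, mul_zero, rtE, rtE]
  linear_combination h2 - h1

lemma mon3_bez_mon3 (g h : Fin 5 → ℂ) (x z x' z' : ℂ) :
    (x * z' - x' * z) * ((bez g h).mulVec (mon3 x z) ⬝ᵥ mon3 x' z') =
      ev4 g x z * ev4 h x' z' - ev4 h x z * ev4 g x' z' := by
  rw [← ev4_mulLin, mulLin_bez]
  simp [ev4]
  ring

lemma det_mon3 (x z : Fin 4 → ℂ) :
    (Matrix.of fun i => mon3 (x i) (z i)).det =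
      (z 0 * x 1 - z 1 * x 0) * (z 0 * x 2 - z 2 * x 0) * (z 0 * x 3 - z 3 * x 0) *
      (z 1 * x 2 - z 2 * x 1) * (z 1 * x 3 - z 3 * x 1) * (z 2 * x 3 - z 3 * x 2) := by
  rw [det_fin_four]
  simp [mon3, minor2]
  ring

lemma Split.det_mon3_ne_zero {ℓ : Fin 8 → ℂ[X]} (hs : Split ℓ) {s : Fin 4 → Fin 8}
    (h : Function.Injective s) : (Matrix.of fun i => rtE ℓ (s i)).det ≠ 0 := by
  have h1 (i j : Fin 4) (hij : i ≠ j) :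
      rtZ ℓ (s i) * rtX ℓ (s j) - rtZ ℓ (s j) * rtX ℓ (s i) ≠ 0 := by
    have := hs.brk_ne _ _ (h.ne hij.symm)
    rw [brk] at this
    convert this using 1
    ring
  simp only [rtE]
  rw [det_mon3 (fun i => rtX ℓ (s i)) (fun i => rtZ ℓ (s i))]
  simp only [ne_eq, mul_eq_zero, not_or]
  exact ⟨⟨⟨⟨⟨h1 0 1 (by decide), h1 0 2 (by decide)⟩, h1 0 3 (by decide)⟩, h1 1 2 (by decide)⟩,
    h1 1 3 (by decide)⟩, h1 2 3 (by decide)⟩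

/-- The cubic monomial vectors at the four roots of one factor diagonalise the Bezout form. Its
determinant is the nonzero resultant and the Vandermonde determinant is nonzero, so no diagonal
entry can vanish. -/
lemma Split.bez_rtE_ne_zero {ℓ : Fin 8 → ℂ[X]} (hs : Split ℓ) {T : Finset (Fin 8)}
    (hT : T.card = 4) {s : Fin 4 → Fin 8} (h : Function.Injective s)
    (hsT : (∀ i, s i ∈ T) ∨ ∀ i, s i ∈ Tᶜ) (i : Fin 4) :
    (bez (factorCoeff ℓ T) (factorCoeff ℓ Tᶜ)).mulVec (rtE ℓ (s i)) ⬝ᵥ rtE ℓ (s i) ≠ 0 := by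
  have hT' : Tᶜ.card = 4 := by simp [Finset.card_compl, hT]
  set q := bez (factorCoeff ℓ T) (factorCoeff ℓ Tᶜ) with hq
  set V : Matrix (Fin 4) (Fin 4) ℂ := Matrix.of fun i => rtE ℓ (s i) with hV
  have h1 : V * q * V.transpose = Matrix.diagonal fun i => q.mulVec (rtE ℓ (s i)) ⬝ᵥ rtE ℓ (s i) := by
    ext a b
    have h2 : (V * q * V.transpose) a b = q.mulVec (rtE ℓ (s a)) ⬝ᵥ rtE ℓ (s b) := by
      have : (V * q) a = q.mulVec (rtE ℓ (s a)) := by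
        rw [← Matrix.vecMul_transpose, (bez_isSymm _ _).eq]
        rfl
      rw [← this]
      rfl
    rw [h2]
    by_cases hab : a = b
    · subst hab
      simp
    · rw [Matrix.diagonal_apply_ne _ hab]
      apply mul_left_cancel₀ (hs.brk_ne _ _ (h.ne hab))
      rw [brk, rtE, rtE, mon3_bez_mon3, mul_zero]
      rcases hsT with h3 | h3
      · rw [ev4_factorCoeff_of_mem hs.deg hT (h3 a), ev4_factorCoeff_of_mem hs.deg hT (h3 b)]
        ring
      · rw [ev4_factorCoeff_of_mem hs.deg hT' (h3 a), ev4_factorCoeff_of_mem hs.deg hT' (h3 b)]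
        ring
  have h3 := congrArg Matrix.det h1
  rw [Matrix.det_mul, Matrix.det_mul, Matrix.det_transpose, Matrix.det_diagonal, hq, ← resT_eq] at h3
  have h4 := hs.det_mon3_ne_zero h
  have h5 := hs.resT_ne_zero hT
  have h6 : ∏ i, q.mulVec (rtE ℓ (s i)) ⬝ᵥ rtE ℓ (s i) ≠ 0 := by
    rw [← h3]
    exact mul_ne_zero (mul_ne_zero h4 h5) h4
  exact Finset.prod_ne_zero_iff.1 h6 i (Finset.mem_univ i)

lemma altMul_dotProduct_self (t : Fin 8 → ℂ) (e : Fin 4 → ℂ) : altMul t e ⬝ᵥ e = 0 := by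
  simp [altMul, dotProduct, Fin.sum_univ_four]
  ring

/-- The alternating part of `rtW` does not contribute, which leaves `±2` times the Bezout form at
the root. -/
lemma Split.dot4_self_ne_zero {ℓ : Fin 8 → ℂ[X]} (hs : Split ℓ) (i : Fin 8) :
    dot4 (rtW ℓ i) (rtE ℓ i) (rtW ℓ i) (rtE ℓ i) ≠ 0 := by
  have h3 : dot4 (rtW ℓ i) (rtE ℓ i) (rtW ℓ i) (rtE ℓ i) = 2 * (rtW ℓ i ⬝ᵥ rtE ℓ i) := by
    rw [dot4, Finset.sum_add_distrib, two_mul]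
    rfl
  have h4 : (bez (factorCoeff ℓ {0, 1, 2, 3}) (factorCoeff ℓ {0, 1, 2, 3}ᶜ)).mulVec (rtE ℓ i) ⬝ᵥ
      rtE ℓ i ≠ 0 := by
    have key (s : Fin 4 → Fin 8) (hinj : Function.Injective s)
        (h : (∀ i, s i ∈ ({0, 1, 2, 3} : Finset (Fin 8))) ∨
          ∀ i, s i ∈ ({0, 1, 2, 3} : Finset (Fin 8))ᶜ) (k : Fin 4) (hk : s k = i) :
        (bez (factorCoeff ℓ {0, 1, 2, 3}) (factorCoeff ℓ {0, 1, 2, 3}ᶜ)).mulVec (rtE ℓ i) ⬝ᵥ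
          rtE ℓ i ≠ 0 := by
      rw [← hk]
      exact hs.bez_rtE_ne_zero (T := {0, 1, 2, 3}) (by decide) hinj h k
    have hcase : (∃ k, (![0, 1, 2, 3] : Fin 4 → Fin 8) k = i) ∨
        ∃ k, (![4, 5, 6, 7] : Fin 4 → Fin 8) k = i :=
      (by decide : ∀ i, (∃ k, (![0, 1, 2, 3] : Fin 4 → Fin 8) k = i) ∨
        ∃ k, (![4, 5, 6, 7] : Fin 4 → Fin 8) k = i) i
    rcases hcase with ⟨k, hk⟩ | ⟨k, hk⟩
    · exact key _ (by decide) (Or.inl (by decide)) k hk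
    · exact key _ (by decide) (Or.inr (by decide)) k hk
  rw [h3, rtW, sub_dotProduct, altMul_dotProduct_self, smul_dotProduct, sub_zero]
  refine mul_ne_zero two_ne_zero (smul_ne_zero ?_ h4)
  rw [sig]
  split_ifs <;> norm_num

/-! ### Translation by a 2-torsion point -/

lemma torsMat_mulVec (ℓ : Fin 8 → ℂ[X]) (T : Finset (Fin 8)) (x : Fin 8 → ℂ) :
    (torsMat ℓ T).mulVec x = shiftP (tau ℓ T)
      (starP (bez (factorCoeff ℓ T) (factorCoeff ℓ Tᶜ)) (shiftP (-tau ℓ T) x)) := by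
  rw [torsMat, yMat, resT_eq, tau, matS_mul_yMatForm_mulVec]

lemma shiftP_smul (u : Fin 8 → ℂ) (c : ℂ) (x : Fin 8 → ℂ) : shiftP u (c • x) = c • shiftP u x := by
  ext i
  fin_cases i <;> simp [shiftP, pfB] <;> ring

lemma torsMat_mul_self (ℓ : Fin 8 → ℂ[X]) (T : Finset (Fin 8)) :
    torsMat ℓ T * torsMat ℓ T = resT ℓ T • 1 := by
  refine Matrix.ext_iff_mulVec.2 fun x => ?_
  have h := shiftP_neg_shiftP (tau ℓ T)
  have h' := shiftP_neg_shiftP (-tau ℓ T)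
  rw [neg_neg] at h'
  rw [← Matrix.mulVec_mulVec, torsMat_mulVec, torsMat_mulVec, h, starP_starP (bez_isSymm _ _),
    shiftP_smul, h', resT_eq, Matrix.smul_mulVec, Matrix.one_mulVec]

lemma shiftM_add (u y y' : Fin 8 → ℂ) : shiftM u (y + y') = shiftM u y + shiftM u y' := by
  ext i
  fin_cases i <;> simp [shiftM] <;> ring

lemma shiftM_smul (u : Fin 8 → ℂ) (c : ℂ) (y : Fin 8 → ℂ) : shiftM u (c • y) = c • shiftM u y := by
  ext i
  fin_cases i <;> simp [shiftM] <;> ring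

lemma starM_add (q : Matrix (Fin 4) (Fin 4) ℂ) (y y' : Fin 8 → ℂ) :
    starM q (y + y') = starM q y + starM q y' := by
  ext i
  fin_cases i <;> simp [starM, adjMul, Matrix.mulVec, dotProduct, Fin.sum_univ_four] <;> ring

lemma starM_smul (q : Matrix (Fin 4) (Fin 4) ℂ) (c : ℂ) (y : Fin 8 → ℂ) :
    starM q (c • y) = c • starM q y := by
  ext i
  fin_cases i <;> simp [starM, adjMul, Matrix.mulVec, dotProduct, Fin.sum_univ_four] <;> ring

/-- Translation by a 2-torsion point on the second half-spin representation. -/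
def torsM (ℓ : Fin 8 → ℂ[X]) (T : Finset (Fin 8)) : (Fin 8 → ℂ) →ₗ[ℂ] (Fin 8 → ℂ) where
  toFun y := shiftM (tau ℓ T)
    (starM (bez (factorCoeff ℓ T) (factorCoeff ℓ Tᶜ)) (shiftM (-tau ℓ T) y))
  map_add' y y' := by rw [shiftM_add, starM_add, shiftM_add]
  map_smul' c y := by rw [shiftM_smul, starM_smul, shiftM_smul, RingHom.id_apply]

lemma altMul_neg (u : Fin 8 → ℂ) (e : Fin 4 → ℂ) : altMul (-u) e = -altMul u e := by
  ext i
  fin_cases i <;> simp [altMul] <;> ring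

/-- Translation by a 2-torsion point on the spin representation. -/
def torsEnd (ℓ : Fin 8 → ℂ[X]) (T : Finset (Fin 8)) : Module.End ℂ Spin :=
  LinearMap.prodMap (Matrix.toLin' (torsMat ℓ T)) (torsM ℓ T)

/-- Clifford multiplication by the vector of a root. -/
def rtCliff (ℓ : Fin 8 → ℂ[X]) (i : Fin 8) : Module.End ℂ Spin := cliff (rtW ℓ i) (rtE ℓ i)

/-- Shifting by `-τ(T)` turns the vector of the root into `(±q e, e)` with `q` the Bezout matrix and
the sign `sig T i`. The star operator fixes or negates this vector accordingly, and shifting back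
restores the root vector. -/
lemma Split.torsEnd_mul_rtCliff {ℓ : Fin 8 → ℂ[X]} (hs : Split ℓ) {T : Finset (Fin 8)}
    (hT : T.card = 4) (i : Fin 8) :
    torsEnd ℓ T * rtCliff ℓ i = sig T i • (rtCliff ℓ i * torsEnd ℓ T) := by
  have hW := hs.rtW_eq hT i
  set q := bez (factorCoeff ℓ T) (factorCoeff ℓ Tᶜ) with hq
  have hqs : q.IsSymm := bez_isSymm _ _
  have hc : rtW ℓ i - altMul (-tau ℓ T) (rtE ℓ i) = sig T i • q.mulVec (rtE ℓ i) := by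
    rw [hW, altMul_neg]
    abel
  have hc' : sig T i • q.mulVec (rtE ℓ i) - altMul (tau ℓ T) (rtE ℓ i) = rtW ℓ i := hW.symm
  have h1 (x : Fin 8 → ℂ) : torsM ℓ T (gam (rtW ℓ i) (rtE ℓ i) x) =
      sig T i • gam (rtW ℓ i) (rtE ℓ i) ((torsMat ℓ T).mulVec x) := by
    have e1 : torsM ℓ T (gam (rtW ℓ i) (rtE ℓ i) x) = shiftM (tau ℓ T) (starM q
        (gam (sig T i • q.mulVec (rtE ℓ i)) (rtE ℓ i) (shiftP (-tau ℓ T) x))) := by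
      rw [← hc, ← shiftM_gam]
      rfl
    rw [e1, torsMat_mulVec, ← hq]
    generalize shiftP (-tau ℓ T) x = x'
    rw [sig] at *
    split_ifs at * with hi
    · rw [neg_one_smul] at *
      rw [starM_gam_neg hqs, ← hc', ← shiftM_gam, neg_one_smul, ← neg_one_smul ℂ (gam _ _ _),
        shiftM_smul, neg_one_smul]
    · rw [one_smul] at *
      rw [starM_gam hqs, one_smul]
      rw [← hc', ← shiftM_gam]
  have h2 (y : Fin 8 → ℂ) : (torsMat ℓ T).mulVec (gam' (rtW ℓ i) (rtE ℓ i) y) =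
      sig T i • gam' (rtW ℓ i) (rtE ℓ i) (torsM ℓ T y) := by
    have e1 : torsM ℓ T y = shiftM (tau ℓ T) (starM q (shiftM (-tau ℓ T) y)) := rfl
    rw [torsMat_mulVec, e1, shiftP_gam', hc, ← hq]
    generalize shiftM (-tau ℓ T) y = y'
    rw [sig] at *
    split_ifs at * with hi
    · rw [neg_one_smul] at *
      rw [starP_gam'_neg hqs, ← hc', ← shiftP_gam', neg_one_smul, ← neg_one_smul ℂ (gam' _ _ _),
        shiftP_smul, neg_one_smul]
    · rw [one_smul] at *
      rw [starP_gam' hqs, one_smul]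
      rw [← hc', ← shiftP_gam']
  refine LinearMap.ext fun p => Prod.ext ?_ ?_
  · simpa [torsEnd, rtCliff, cliff_apply] using h2 p.2
  · simpa [torsEnd, rtCliff, cliff_apply] using h1 p.1

lemma Split.rtCliff_mul {ℓ : Fin 8 → ℂ[X]} (hs : Split ℓ) {i j : Fin 8} (hij : i ≠ j) :
    rtCliff ℓ i * rtCliff ℓ j = -(rtCliff ℓ j * rtCliff ℓ i) := by
  have := cliff_mul_add (rtW ℓ i) (rtE ℓ i) (rtW ℓ j) (rtE ℓ j)
  rw [hs.dot4_eq_zero hij, zero_smul] at this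
  exact eq_neg_of_add_eq_zero_left this

lemma Split.rtCliff_injective {ℓ : Fin 8 → ℂ[X]} (hs : Split ℓ) (i : Fin 8) :
    Function.Injective (rtCliff ℓ i) := by
  have h := cliff_mul_add (rtW ℓ i) (rtE ℓ i) (rtW ℓ i) (rtE ℓ i)
  refine (injective_iff_map_eq_zero _).2 fun p hp => ?_
  have := congrArg (fun F : Module.End ℂ Spin => F p) h
  simp only [LinearMap.add_apply, Module.End.mul_apply, LinearMap.smul_apply,
    Module.End.one_apply] at this
  rw [show cliff (rtW ℓ i) (rtE ℓ i) p = 0 from hp, map_zero, add_zero] at this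
  exact (smul_eq_zero.1 this.symm).resolve_left (hs.dot4_self_ne_zero i)

lemma Split.linearIndependent {ℓ : Fin 8 → ℂ[X]} (hs : Split ℓ) :
    LinearIndependent ℂ (fun i => (rtW ℓ i, rtE ℓ i)) := by
  rw [Fintype.linearIndependent_iff]
  intro g hg i
  have h1 : ∑ j, g j • rtW ℓ j = 0 := by
    have := congrArg Prod.fst hg
    rw [Prod.fst_sum] at this
    exact this
  have h2 : ∑ j, g j • rtE ℓ j = 0 := by
    have := congrArg Prod.snd hg
    rw [Prod.snd_sum] at this
    exact this
  have h3 : ∑ j, g j * dot4 (rtW ℓ j) (rtE ℓ j) (rtW ℓ i) (rtE ℓ i) = 0 := by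
    have e1 (j : Fin 8) : g j * dot4 (rtW ℓ j) (rtE ℓ j) (rtW ℓ i) (rtE ℓ i) =
        (g j • rtW ℓ j) ⬝ᵥ rtE ℓ i + rtW ℓ i ⬝ᵥ (g j • rtE ℓ j) := by
      simp only [dot4, dotProduct, Finset.sum_add_distrib, mul_add, Finset.mul_sum,
        Pi.smul_apply, smul_eq_mul]
      congr 1 <;> exact Finset.sum_congr rfl fun k _ => by ring
    rw [Finset.sum_congr rfl fun j _ => e1 j, Finset.sum_add_distrib, ← sum_dotProduct,
      ← dotProduct_sum, h1, h2, zero_dotProduct, dotProduct_zero, add_zero]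
  rw [Finset.sum_eq_single i (fun j _ hj => by rw [hs.dot4_eq_zero hj, mul_zero])
    (fun h => absurd (Finset.mem_univ i) h)] at h3
  exact (mul_eq_zero.1 h3).resolve_right (hs.dot4_self_ne_zero i)

lemma cliff_zero : cliff 0 0 = 0 := by simpa using cliff_smul 0 0 0

lemma Split.span_eq_top {ℓ : Fin 8 → ℂ[X]} (hs : Split ℓ) :
    Submodule.span ℂ (Set.range fun i => (rtW ℓ i, rtE ℓ i)) = ⊤ :=
  hs.linearIndependent.span_eq_top_of_card_eq_finrank
    (by rw [Module.finrank_prod, Module.finrank_fin_fun, Fintype.card_fin])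

lemma Split.commute_cliff {ℓ : Fin 8 → ℂ[X]} (hs : Split ℓ) {Z : Module.End ℂ Spin}
    (hZ : ∀ i, Commute Z (rtCliff ℓ i)) (w e : Fin 4 → ℂ) : Commute Z (cliff w e) := by
  have key (p : (Fin 4 → ℂ) × (Fin 4 → ℂ))
      (hp : p ∈ Submodule.span ℂ (Set.range fun i => (rtW ℓ i, rtE ℓ i))) :
      Z * cliff p.1 p.2 = cliff p.1 p.2 * Z := by
    induction hp using Submodule.span_induction with
    | mem p hp =>
      obtain ⟨i, rfl⟩ := hp
      exact (hZ i).eq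
    | zero => rw [Prod.fst_zero, Prod.snd_zero, cliff_zero, mul_zero, zero_mul]
    | add p p' _ _ h h' => rw [Prod.fst_add, Prod.snd_add, cliff_add, mul_add, add_mul, h, h']
    | smul c p _ h => rw [Prod.smul_fst, Prod.smul_snd, cliff_smul, mul_smul_comm, smul_mul_assoc, h]
  exact key (w, e) (by rw [hs.span_eq_top]; exact Submodule.mem_top)

/-- The product of the Clifford multiplications by the vectors of the roots in a list. -/
def listCliff (ℓ : Fin 8 → ℂ[X]) (L : List (Fin 8)) : Module.End ℂ Spin := (L.map (rtCliff ℓ)).prod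

lemma Split.listCliff_mul_rtCliff {ℓ : Fin 8 → ℂ[X]} (hs : Split ℓ) (L : List (Fin 8))
    (i : Fin 8) : listCliff ℓ L * rtCliff ℓ i =
      (L.map fun j => if j = i then (1 : ℂ) else -1).prod • (rtCliff ℓ i * listCliff ℓ L) := by
  induction L with
  | nil => simp [listCliff]
  | cons j L IH =>
    have e : listCliff ℓ (j :: L) = rtCliff ℓ j * listCliff ℓ L := by simp [listCliff]
    rw [e, mul_assoc, IH, List.map_cons, List.prod_cons]
    by_cases hj : j = i
    · subst hj
      simp
    · rw [if_neg hj, mul_smul_comm, ← mul_assoc, hs.rtCliff_mul hj,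
        neg_mul (rtCliff ℓ i * _), smul_neg, mul_assoc, neg_one_mul]
      exact (neg_smul _ _).symm

lemma Split.torsEnd_mul_listCliff {ℓ : Fin 8 → ℂ[X]} (hs : Split ℓ) {T : Finset (Fin 8)}
    (hT : T.card = 4) (L : List (Fin 8)) : torsEnd ℓ T * listCliff ℓ L =
      (L.map (sig T)).prod • (listCliff ℓ L * torsEnd ℓ T) := by
  induction L with
  | nil => simp [listCliff]
  | cons j L IH =>
    have e : listCliff ℓ (j :: L) = rtCliff ℓ j * listCliff ℓ L := by simp [listCliff]
    rw [e, ← mul_assoc, hs.torsEnd_mul_rtCliff hT, List.map_cons, List.prod_cons, smul_mul_assoc,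
      mul_assoc, IH, mul_smul_comm, smul_smul, mul_assoc]

lemma Split.listCliff_injective {ℓ : Fin 8 → ℂ[X]} (hs : Split ℓ) (L : List (Fin 8)) :
    Function.Injective (listCliff ℓ L) := by
  induction L with
  | nil => exact Function.injective_id
  | cons j L IH =>
    have e : listCliff ℓ (j :: L) = rtCliff ℓ j * listCliff ℓ L := by simp [listCliff]
    rw [e]
    exact (hs.rtCliff_injective j).comp IH

/-- The Weil pairing of two even 2-torsion points. -/
def weil (T T' : Finset (Fin 8)) : ℂ := ∏ i ∈ T', sig T i

lemma sig_mul_self (T : Finset (Fin 8)) (i : Fin 8) : sig T i * sig T i = 1 := by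
  rw [sig]
  split_ifs <;> norm_num

lemma weil_mul_self (T T' : Finset (Fin 8)) : weil T T' * weil T T' = 1 := by
  rw [weil, ← Finset.prod_mul_distrib]
  exact Finset.prod_eq_one fun i _ => sig_mul_self T i

/-- A root vector passes three other factors if its root lies in `T` and four if it does not; this
gives the same sign as translation by `T`. -/
lemma prod_ite_eq_sig {T : Finset (Fin 8)} (hT : T.card = 4) (i : Fin 8) :
    (T.toList.map fun j => if j = i then (1 : ℂ) else -1).prod = sig T i := by
  rw [Finset.prod_map_toList, sig]
  split_ifs with hi
  · rw [← Finset.mul_prod_erase _ _ hi, if_pos rfl, Finset.prod_congr rfl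
      fun j hj => if_neg (Finset.ne_of_mem_erase hj)]
    simp [Finset.card_erase_of_mem hi, hT]
    norm_num
  · rw [Finset.prod_congr rfl fun j hj => if_neg (by rintro rfl; exact hi hj)]
    simp [hT]
    norm_num

/-- The product `P` of the root vectors in `T'` has the same signs against root vectors as
translation by `T'`. Hence `P * torsEnd ℓ T'` commutes with all Clifford multiplications and is
scalar by Schur's lemma. Moving `torsEnd ℓ T` across `P` costs the Weil pairing, and `P` is
injective, so it can be cancelled. -/
lemma Split.torsEnd_mul_torsEnd {ℓ : Fin 8 → ℂ[X]} (hs : Split ℓ) {T T' : Finset (Fin 8)}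
    (hT : T.card = 4) (hT' : T'.card = 4) :
    torsEnd ℓ T * torsEnd ℓ T' = weil T T' • (torsEnd ℓ T' * torsEnd ℓ T) := by
  set P := listCliff ℓ T'.toList with hP
  have h1 (i : Fin 8) : P * rtCliff ℓ i = sig T' i • (rtCliff ℓ i * P) := by
    rw [hP, hs.listCliff_mul_rtCliff, prod_ite_eq_sig hT']
  have h2 : torsEnd ℓ T * P = weil T T' • (P * torsEnd ℓ T) := by
    rw [hP, hs.torsEnd_mul_listCliff hT, Finset.prod_map_toList, weil]
  obtain ⟨c, hc⟩ := eq_smul_one_of_commute (P * torsEnd ℓ T') (hs.commute_cliff fun i => by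
    rw [Commute, SemiconjBy, mul_assoc, hs.torsEnd_mul_rtCliff hT', mul_smul_comm, ← mul_assoc, h1,
      smul_mul_assoc, smul_smul, sig_mul_self, one_smul, mul_assoc])
  have h3 : P * (torsEnd ℓ T * torsEnd ℓ T') =
      P * (weil T T' • (torsEnd ℓ T' * torsEnd ℓ T)) := by
    have e1 : P * torsEnd ℓ T = weil T T' • (torsEnd ℓ T * P) := by
      rw [h2, smul_smul, weil_mul_self, one_smul]
    rw [← mul_assoc, e1, smul_mul_assoc, mul_assoc, hc, mul_smul_comm, mul_smul_comm, ← mul_assoc,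
      hc]
    simp
  refine LinearMap.ext fun p => hs.listCliff_injective T'.toList ?_
  exact congrArg (fun F : Module.End ℂ Spin => F p) h3

lemma Split.torsMat_mul_torsMat {ℓ : Fin 8 → ℂ[X]} (hs : Split ℓ) {T T' : Finset (Fin 8)}
    (hT : T.card = 4) (hT' : T'.card = 4) :
    torsMat ℓ T * torsMat ℓ T' = weil T T' • (torsMat ℓ T' * torsMat ℓ T) := by
  refine Matrix.ext_iff_mulVec.2 fun x => ?_
  have := congrArg (fun F : Module.End ℂ Spin => (F (x, 0)).1) (hs.torsEnd_mul_torsEnd hT hT')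
  simpa [torsEnd, Matrix.smul_mulVec] using this

/-! ### The quadratic forms of the even 2-torsion points -/

lemma card_of_mem_evenPts {T : Finset (Fin 8)} (h : T ∈ evenPts) : T.card = 4 :=
  (Finset.mem_powersetCard.1 (Finset.mem_filter.1 h).1).2

lemma empty_notMem_evenPts : ∅ ∉ evenPts := fun h => by simpa using card_of_mem_evenPts h

/-- All 36 even 2-torsion points; the trivial one is represented by the empty set. -/
def allPts : Finset (Finset (Fin 8)) := insert ∅ evenPts

lemma card_allPts : allPts.card = 36 := by
  rw [allPts, Finset.card_insert_of_notMem empty_notMem_evenPts]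
  decide +kernel

/-- The matrix of translation by an even 2-torsion point. -/
def evMat (ℓ : Fin 8 → ℂ[X]) (A : Finset (Fin 8)) : Matrix (Fin 8) (Fin 8) ℂ :=
  if A = ∅ then 1 else torsMat ℓ A

/-- The scalar by which the square of `evMat` acts. -/
def evRes (ℓ : Fin 8 → ℂ[X]) (A : Finset (Fin 8)) : ℂ := if A = ∅ then 1 else resT ℓ A

lemma ne_empty_of_mem_evenPts {T : Finset (Fin 8)} (h : T ∈ evenPts) : T ≠ ∅ := by
  rintro rfl
  exact empty_notMem_evenPts h

lemma evMat_of_mem {ℓ : Fin 8 → ℂ[X]} {T : Finset (Fin 8)} (h : T ∈ evenPts) :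
    evMat ℓ T = torsMat ℓ T := if_neg (ne_empty_of_mem_evenPts h)

lemma evMat_empty (ℓ : Fin 8 → ℂ[X]) : evMat ℓ ∅ = 1 := if_pos rfl

lemma weil_empty (T : Finset (Fin 8)) : weil ∅ T = 1 := by simp [weil, sig]

lemma Split.evMat_comm {ℓ : Fin 8 → ℂ[X]} (hs : Split ℓ) {A T : Finset (Fin 8)}
    (hA : A ∈ allPts) (hT : T ∈ evenPts) :
    evMat ℓ A * torsMat ℓ T = weil A T • (torsMat ℓ T * evMat ℓ A) := by
  rcases Finset.mem_insert.1 hA with rfl | hA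
  · rw [evMat_empty, weil_empty, one_mul, mul_one, one_smul]
  · rw [evMat_of_mem hA, hs.torsMat_mul_torsMat (card_of_mem_evenPts hA) (card_of_mem_evenPts hT)]

lemma evMat_mul_self {ℓ : Fin 8 → ℂ[X]} (A : Finset (Fin 8)) :
    evMat ℓ A * evMat ℓ A = evRes ℓ A • 1 := by
  rw [evMat, evRes]
  split_ifs
  · simp
  · exact torsMat_mul_self ℓ A

lemma Split.evRes_ne_zero {ℓ : Fin 8 → ℂ[X]} (hs : Split ℓ) {A : Finset (Fin 8)}
    (hA : A ∈ allPts) : evRes ℓ A ≠ 0 := by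
  rw [evRes]
  split_ifs with h
  · exact one_ne_zero
  · exact hs.resT_ne_zero (card_of_mem_evenPts ((Finset.mem_insert.1 hA).resolve_left h))

lemma exists_odd_inter (D : Finset (Fin 8)) (h0 : D ≠ ∅) (h1 : D ≠ Finset.univ)
    (h2 : Even D.card) : ∃ T ∈ evenPts, Odd (D ∩ T).card := by
  revert D
  decide +kernel

lemma weil_mul_weil (A B T : Finset (Fin 8)) :
    weil A T * weil B T = (-1) ^ (symmDiff A B ∩ T).card := by
  have h (i : Fin 8) : sig A i * sig B i = if i ∈ symmDiff A B then -1 else 1 := by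
    simp only [sig, Finset.mem_symmDiff]
    by_cases hA : i ∈ A <;> by_cases hB : i ∈ B <;> simp [hA, hB]
  rw [weil, weil, ← Finset.prod_mul_distrib, Finset.prod_congr rfl fun i _ => h i,
    ← Finset.prod_filter_mul_prod_filter_not T (· ∈ symmDiff A B)]
  rw [Finset.prod_congr rfl fun i hi => if_pos (Finset.mem_filter.1 hi).2,
    Finset.prod_congr rfl fun i hi => if_neg (Finset.mem_filter.1 hi).2,
    Finset.prod_const, Finset.prod_const_one, mul_one]
  congr 2
  ext i
  simp [and_comm]

/-- The symmetric difference of the two sets has even size and is nonempty. It is not everything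
either: both sets contain `0`, or one is empty and the other has four elements. Some four-element
set containing `0` then meets it in an odd number of points. -/
lemma exists_weil_eq_neg_one {A B : Finset (Fin 8)} (hA : A ∈ allPts) (hB : B ∈ allPts)
    (hAB : A ≠ B) : ∃ T ∈ evenPts, weil A T * weil B T = -1 := by
  have key : ∀ C ∈ allPts, C = ∅ ∨ (0 ∈ C ∧ C.card = 4) := fun C hC =>
    (Finset.mem_insert.1 hC).imp id fun (h : C ∈ evenPts) =>
      ⟨(Finset.mem_filter.1 h).2, card_of_mem_evenPts h⟩
  have h2 : Even (symmDiff A B).card := by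
    have e1 : (symmDiff A B).card + 2 * (A ∩ B).card = A.card + B.card := by
      rw [symmDiff_def, Finset.sup_eq_union, Finset.card_union_of_disjoint disjoint_sdiff_sdiff]
      have := Finset.card_sdiff_add_card_inter A B
      have h' := Finset.card_sdiff_add_card_inter B A
      rw [Finset.inter_comm] at h'
      omega
    have e2 : ∀ C ∈ allPts, C.card = 0 ∨ C.card = 4 := fun C hC =>
      (key C hC).imp (fun h => by simp [h]) And.right
    rcases e2 A hA with h | h <;> rcases e2 B hB with h' | h' <;>
      exact Nat.even_iff.2 (by omega)
  have h1 : symmDiff A B ≠ Finset.univ := by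
    intro h
    rcases key A hA with rfl | ⟨hA0, hA4⟩
    · rcases key B hB with rfl | ⟨-, hB4⟩
      · exact hAB rfl
      · rw [← Finset.bot_eq_empty, bot_symmDiff] at h
        rw [h] at hB4
        simp at hB4
    · rcases key B hB with rfl | ⟨hB0, -⟩
      · rw [← Finset.bot_eq_empty, symmDiff_bot] at h
        rw [h] at hA4
        simp at hA4
      · have : (0 : Fin 8) ∈ symmDiff A B := h ▸ Finset.mem_univ 0
        simp [Finset.mem_symmDiff, hA0, hB0] at this
  obtain ⟨T, hT, hodd⟩ := exists_odd_inter (symmDiff A B)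
    (fun h => hAB (symmDiff_eq_bot.1 h)) h1 h2
  exact ⟨T, hT, by rw [weil_mul_weil, hodd.neg_one_pow]⟩

/-- Some `M_T` anticommutes with the product of the two matrices. Conjugating by this invertible
matrix reverses the sign of the trace. -/
lemma Split.trace_evMat_mul {ℓ : Fin 8 → ℂ[X]} (hs : Split ℓ) {A B : Finset (Fin 8)}
    (hA : A ∈ allPts) (hB : B ∈ allPts) (hAB : A ≠ B) : (evMat ℓ A * evMat ℓ B).trace = 0 := by
  obtain ⟨T, hT, hw⟩ := exists_weil_eq_neg_one hA hB hAB
  have h1 : (evMat ℓ A * evMat ℓ B * torsMat ℓ T) = -(torsMat ℓ T * (evMat ℓ A * evMat ℓ B)) := by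
    rw [mul_assoc, hs.evMat_comm hB hT, mul_smul_comm, ← mul_assoc, hs.evMat_comm hA hT,
      smul_mul_assoc, smul_smul, mul_comm, hw, neg_one_smul, mul_assoc]
  have h2 : resT ℓ T * (evMat ℓ A * evMat ℓ B).trace = -(resT ℓ T * (evMat ℓ A * evMat ℓ B).trace) := by
    have e1 : (evMat ℓ A * evMat ℓ B * torsMat ℓ T * torsMat ℓ T).trace =
        resT ℓ T * (evMat ℓ A * evMat ℓ B).trace := by
      rw [mul_assoc, torsMat_mul_self]
      simp
    have e2 : (torsMat ℓ T * (evMat ℓ A * evMat ℓ B) * torsMat ℓ T).trace =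
        resT ℓ T * (evMat ℓ A * evMat ℓ B).trace := by
      rw [Matrix.trace_mul_comm, ← mul_assoc, torsMat_mul_self]
      simp
    have e3 := congrArg (fun X => (X * torsMat ℓ T).trace) h1
    simp only [neg_mul, Matrix.trace_neg, e1, e2] at e3
    exact e3
  exact (mul_eq_zero.1 (self_eq_neg.1 h2)).resolve_left
    (hs.resT_ne_zero (card_of_mem_evenPts hT))

lemma trace_evMat_mul_self (ℓ : Fin 8 → ℂ[X]) (A : Finset (Fin 8)) :
    (evMat ℓ A * evMat ℓ A).trace = 8 * evRes ℓ A := by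
  rw [evMat_mul_self]
  simp [mul_comm]

lemma matS_mul_matS : matS * matS = 1 := by
  refine Matrix.ext_iff_mulVec.2 fun x => ?_
  rw [← Matrix.mulVec_mulVec, matS_mulVec, matS_mulVec, Matrix.one_mulVec]
  ext i
  fin_cases i <;> simp

lemma matS_transpose : matS.transpose = matS := by
  ext i j
  simp only [matS, Matrix.transpose_apply, Matrix.of_apply]
  fin_cases i <;> fin_cases j <;> simp [sgn, Fin.rev]

lemma coreMat_transpose (g h : Fin 5 → ℂ) : (coreMat g h).transpose = coreMat g h := by
  ext i j
  fin_cases i <;> fin_cases j <;> rfl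

lemma yMatForm_transpose (g h : Fin 5 → ℂ) (r : ℂ) :
    (yMatForm g h r).transpose = yMatForm g h r := by
  simp only [yMatForm, Matrix.transpose_add, Matrix.transpose_mul, Matrix.transpose_transpose,
    coreMat_transpose, Matrix.transpose_vecMulVec, Matrix.transpose_single, Matrix.mul_assoc]

/-- The matrix of the quadratic form `y_A`. -/
def evForm (ℓ : Fin 8 → ℂ[X]) (A : Finset (Fin 8)) : Matrix (Fin 8) (Fin 8) ℂ := matS * evMat ℓ A

lemma evForm_of_mem {ℓ : Fin 8 → ℂ[X]} {T : Finset (Fin 8)} (h : T ∈ evenPts) :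
    evForm ℓ T = yMat ℓ T := by
  rw [evForm, evMat_of_mem h, torsMat, ← mul_assoc, matS_mul_matS, one_mul]

lemma evForm_empty (ℓ : Fin 8 → ℂ[X]) : evForm ℓ ∅ = matS := by
  rw [evForm, evMat_empty, mul_one]

lemma evForm_transpose {ℓ : Fin 8 → ℂ[X]} {A : Finset (Fin 8)} (hA : A ∈ allPts) :
    (evForm ℓ A).transpose = evForm ℓ A := by
  rcases Finset.mem_insert.1 hA with rfl | hA
  · rw [evForm_empty, matS_transpose]
  · rw [evForm_of_mem hA, yMat, yMatForm_transpose]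

lemma Split.trace_evForm {ℓ : Fin 8 → ℂ[X]} (hs : Split ℓ) {s : Finset (Fin 8) → ℂ}
    {B : Finset (Fin 8)} (hB : B ∈ allPts) :
    (matS * (∑ A ∈ allPts, s A • evForm ℓ A) * evMat ℓ B).trace = s B * (8 * evRes ℓ B) := by
  have h1 (A : Finset (Fin 8)) : (matS * (s A • evForm ℓ A) * evMat ℓ B).trace =
      s A * (evMat ℓ A * evMat ℓ B).trace := by
    rw [evForm, mul_smul_comm, ← mul_assoc, matS_mul_matS, one_mul, smul_mul_assoc,
      Matrix.trace_smul, smul_eq_mul]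
  rw [Finset.mul_sum, Finset.sum_mul, Matrix.trace_sum, Finset.sum_congr rfl fun A _ => h1 A,
    Finset.sum_eq_single B (fun A hA hAB => by rw [hs.trace_evMat_mul hA hB hAB, mul_zero])
      (fun h => absurd hB h), trace_evMat_mul_self]

/-- The symmetric matrix with the given entries. -/
def symLin : (Sym2 (Fin 8) → ℂ) →ₗ[ℂ] Matrix (Fin 8) (Fin 8) ℂ where
  toFun v := Matrix.of fun i j => v s(i, j)
  map_add' _ _ := rfl
  map_smul' _ _ := rfl

lemma exists_symLin {N : Matrix (Fin 8) (Fin 8) ℂ} (hN : N.transpose = N) : ∃ v, symLin v = N :=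
  ⟨Sym2.lift ⟨fun i j => N i j, fun i j => congrFun (congrFun hN j) i⟩, rfl⟩

/-- The quadratic forms of the even 2-torsion points span the space of all quadratic forms. -/
lemma Split.eq_sum_evForm {ℓ : Fin 8 → ℂ[X]} (hs : Split ℓ) {N : Matrix (Fin 8) (Fin 8) ℂ}
    (hN : N.transpose = N) :
    N = ∑ A ∈ allPts, ((matS * N * evMat ℓ A).trace / (8 * evRes ℓ A)) • evForm ℓ A := by
  have hb (A : allPts) : ∃ v, symLin v = evForm ℓ A := exists_symLin (evForm_transpose A.2)
  choose b hb using hb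
  have hli : LinearIndependent ℂ b := by
    rw [Fintype.linearIndependent_iff]
    intro g hg B
    set s : Finset (Fin 8) → ℂ := fun A => if h : A ∈ allPts then g ⟨A, h⟩ else 0 with hs'
    have h1 : ∑ A ∈ allPts, s A • evForm ℓ A = 0 := by
      rw [← Finset.sum_coe_sort allPts (fun A => s A • evForm ℓ A)]
      have := congrArg symLin hg
      rw [map_sum, map_zero] at this
      rw [← this]
      refine Finset.sum_congr rfl fun A _ => ?_
      rw [map_smul, hb, hs']
      simp
    have h2 := hs.trace_evForm (s := s) B.2
    rw [h1, mul_zero, zero_mul, Matrix.trace_zero] at h2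
    have h3 := (mul_eq_zero.1 h2.symm).resolve_right
      (mul_ne_zero (by norm_num) (hs.evRes_ne_zero B.2))
    simpa [hs'] using h3
  have : Nonempty allPts := ⟨⟨∅, Finset.mem_insert_self _ _⟩⟩
  -- Trace orthogonality made the 36 forms independent, and 36 is the number of unordered pairs of
  -- coordinates.
  have hspan := hli.span_eq_top_of_card_eq_finrank (by
    rw [Module.finrank_fintype_fun_eq_card, Fintype.card_coe, card_allPts]
    decide)
  obtain ⟨v, hv⟩ := exists_symLin hN
  have hmem : v ∈ Submodule.span ℂ (Set.range b) := by rw [hspan]; exact Submodule.mem_top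
  obtain ⟨c, hc⟩ := (Submodule.mem_span_range_iff_exists_fun ℂ).1 hmem
  set s : Finset (Fin 8) → ℂ := fun A => if h : A ∈ allPts then c ⟨A, h⟩ else 0 with hs'
  have h1 : N = ∑ A ∈ allPts, s A • evForm ℓ A := by
    rw [← Finset.sum_coe_sort allPts (fun A => s A • evForm ℓ A), ← hv, ← hc, map_sum]
    refine Finset.sum_congr rfl fun A _ => ?_
    rw [map_smul, hb, hs']
    simp
  conv_lhs => rw [h1]
  refine Finset.sum_congr rfl fun A hA => ?_
  have h2 := hs.trace_evForm (s := s) hA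
  rw [← h1] at h2
  rw [h2, mul_div_cancel_right₀ _ (mul_ne_zero (by norm_num) (hs.evRes_ne_zero hA))]

/-- The value of the quadratic form `y_A`. -/
def evVal (ℓ : Fin 8 → ℂ[X]) (A : Finset (Fin 8)) (x : Fin 8 → ℂ) : ℂ :=
  x ⬝ᵥ (evForm ℓ A).mulVec x

lemma Split.dotProduct_mulVec_eq_sum {ℓ : Fin 8 → ℂ[X]} (hs : Split ℓ)
    {N : Matrix (Fin 8) (Fin 8) ℂ} (hN : N.transpose = N) (x : Fin 8 → ℂ) :
    x ⬝ᵥ N.mulVec x =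
      ∑ A ∈ allPts, ((matS * N * evMat ℓ A).trace / (8 * evRes ℓ A)) * evVal ℓ A x := by
  conv_lhs => rw [hs.eq_sum_evForm hN]
  rw [Matrix.sum_mulVec, dotProduct_sum]
  refine Finset.sum_congr rfl fun A _ => ?_
  rw [Matrix.smul_mulVec, dotProduct_smul, smul_eq_mul, evVal]

lemma matS_diag (j : Fin 8) : matS j j = 0 := by
  fin_cases j <;> simp [matS, Fin.rev]

lemma matS_mul_mul_matS_diag (Y : Matrix (Fin 8) (Fin 8) ℂ) (j : Fin 8) :
    (matS * Y * matS) j j = Y j.rev j.rev := by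
  have h1 (i : Fin 8) : sgn i * sgn i.rev = 1 := by fin_cases i <;> simp [sgn, Fin.rev]
  simp only [Matrix.mul_apply, matS, Matrix.of_apply, ite_mul, zero_mul, mul_ite, mul_zero]
  rw [Finset.sum_eq_single j.rev (fun b _ hb => by
    rw [if_neg]; rintro rfl; exact hb (Fin.rev_rev b).symm) (by simp)]
  rw [if_pos (Fin.rev_rev j).symm, Finset.sum_eq_single j.rev (fun b _ hb => if_neg hb) (by simp),
    if_pos rfl, mul_right_comm, h1, one_mul]

/-- The square of a coordinate as a combination of the forms `y_T`. -/
lemma Split.sq_eq_sum {ℓ : Fin 8 → ℂ[X]} (hs : Split ℓ) (x : Fin 8 → ℂ) (j : Fin 8) :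
    x j ^ 2 = ∑ T ∈ evenPts, upsilon ℓ T j * evVal ℓ T x := by
  have h := hs.dotProduct_mulVec_eq_sum (N := Matrix.single j j 1)
    (by rw [Matrix.transpose_single]) x
  have h0 : x ⬝ᵥ (Matrix.single j j (1 : ℂ)).mulVec x = x j ^ 2 := by
    simp [Matrix.single_mulVec, dotProduct, Function.update_apply, pow_two]
  have htr (M : Matrix (Fin 8) (Fin 8) ℂ) : (matS * Matrix.single j j 1 * M).trace =
      (M * matS) j j := by
    rw [mul_assoc, Matrix.trace_mul_comm, mul_assoc, Matrix.trace_single_mul]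
    simp
  -- The form `y_∅` of the trivial point drops out because its coefficient is a multiple of the
  -- diagonal entry `S_jj = 0`.
  rw [← h0, h, allPts, Finset.sum_insert empty_notMem_evenPts, htr, evMat_empty, one_mul,
    matS_diag, zero_div, zero_mul, zero_add]
  refine Finset.sum_congr rfl fun T hT => ?_
  rw [htr, evMat_of_mem hT, torsMat, matS_mul_mul_matS_diag, upsilon, evRes,
    if_neg (ne_empty_of_mem_evenPts hT)]

/-! ### Invariant quartic forms -/

/-- Symmetry of `S M_T` means that the transpose of `M_T` passes through `S` as `M_T`. The
commutation rule and `M_T² = r(T)` do the rest, so each `y_A` is a semi-invariant and its sign is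
the Weil pairing. -/
lemma Split.evVal_torsMat_mulVec {ℓ : Fin 8 → ℂ[X]} (hs : Split ℓ) {A T : Finset (Fin 8)}
    (hA : A ∈ allPts) (hT : T ∈ evenPts) (x : Fin 8 → ℂ) :
    evVal ℓ A ((torsMat ℓ T).mulVec x) = weil A T * resT ℓ T * evVal ℓ A x := by
  have h1 : (torsMat ℓ T).transpose * matS = matS * torsMat ℓ T := by
    have h := evForm_transpose (ℓ := ℓ) (A := T) (Finset.mem_insert_of_mem hT)
    rwa [evForm, evMat_of_mem hT, Matrix.transpose_mul, matS_transpose] at h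
  have h2 : (torsMat ℓ T).transpose * (evForm ℓ A * torsMat ℓ T) =
      (weil A T * resT ℓ T) • evForm ℓ A := by
    rw [evForm, mul_assoc, ← mul_assoc, h1, hs.evMat_comm hA hT, mul_smul_comm, mul_assoc,
      ← mul_assoc (torsMat ℓ T), torsMat_mul_self, smul_mul_assoc, one_mul, mul_smul_comm,
      smul_smul]
  rw [evVal, Matrix.mulVec_mulVec, dotProduct_comm, Matrix.dotProduct_mulVec,
    ← Matrix.mulVec_transpose, Matrix.mulVec_mulVec, h2, Matrix.smul_mulVec, smul_dotProduct,
    dotProduct_comm, smul_eq_mul, evVal]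

lemma Split.mul_mem_span {ℓ : Fin 8 → ℂ[X]} (hs : Split ℓ) (i j : Fin 8) :
    (fun x : Fin 8 → ℂ => x i * x j) ∈ Submodule.span ℂ (Set.range fun A : allPts => evVal ℓ A) := by
  have h := hs.dotProduct_mulVec_eq_sum (N := Matrix.single i j (1 / 2) + Matrix.single j i (1 / 2))
    (by rw [Matrix.transpose_add, Matrix.transpose_single, Matrix.transpose_single, add_comm])
  refine (Submodule.mem_span_range_iff_exists_fun ℂ).2
    ⟨fun A => (matS * (Matrix.single i j (1 / 2) + Matrix.single j i (1 / 2)) *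
      evMat ℓ A).trace / (8 * evRes ℓ A), funext fun x => ?_⟩
  have h' := h x
  rw [← Finset.sum_coe_sort allPts] at h'
  rw [Finset.sum_apply]
  refine h'.symm.trans ?_
  rw [Matrix.add_mulVec, dotProduct_add]
  simp [Matrix.single_mulVec, dotProduct, Function.update_apply]
  ring

lemma exists_monomial_eq_X_mul {d : Fin 8 →₀ ℕ} {n : ℕ} (hd : d.degree = n + 1) :
    ∃ i, ∃ e : Fin 8 →₀ ℕ, e.degree = n ∧ ∀ x : Fin 8 → ℂ,
      MvPolynomial.eval x (MvPolynomial.monomial d 1) =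
        x i * MvPolynomial.eval x (MvPolynomial.monomial e 1) := by
  have h0 : d ≠ 0 := by
    rintro rfl
    simp at hd
  obtain ⟨i, hi⟩ := Finsupp.ne_iff.1 h0
  have h1 : d = Finsupp.single i 1 + (d - Finsupp.single i 1) :=
    (add_tsub_cancel_of_le (Finsupp.single_le_iff.2 (Nat.one_le_iff_ne_zero.2 hi))).symm
  refine ⟨i, d - Finsupp.single i 1, ?_, fun x => ?_⟩
  · rw [h1, map_add, Finsupp.degree_single] at hd
    omega
  · conv_lhs => rw [h1, ← one_mul (1 : ℂ), ← MvPolynomial.monomial_mul]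
    rw [map_mul]
    congr 1
    simp [MvPolynomial.eval_monomial]

/-- A quartic monomial is a product of two quadratic ones, each a combination of the forms `y_A`. -/
lemma Split.eval_mem_span {ℓ : Fin 8 → ℂ[X]} (hs : Split ℓ) {p : MvPolynomial (Fin 8) ℂ}
    (hp : p.IsHomogeneous 4) :
    (fun x => MvPolynomial.eval x p) ∈ Submodule.span ℂ
      (Set.range fun A : allPts × allPts => evVal ℓ A.1 * evVal ℓ A.2) := by
  set V := Submodule.span ℂ (Set.range fun A : allPts => evVal ℓ A) with hV
  have hVV : V * V = Submodule.span ℂ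
      (Set.range fun A : allPts × allPts => evVal ℓ A.1 * evVal ℓ A.2) := by
    rw [hV, Submodule.span_mul_span]
    congr 1
    ext φ
    simp [Set.mem_mul]
  rw [← hVV]
  have h1 : (fun x => MvPolynomial.eval x p) =
      ∑ d ∈ p.support, p.coeff d • fun x => MvPolynomial.eval x (MvPolynomial.monomial d 1) := by
    funext x
    conv_lhs => rw [p.as_sum]
    rw [map_sum, Finset.sum_apply]
    refine Finset.sum_congr rfl fun d _ => ?_
    simp [MvPolynomial.eval_monomial]
  rw [h1]
  refine Submodule.sum_mem _ fun d hd => Submodule.smul_mem _ _ ?_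
  have hd4 : d.degree = 3 + 1 := by
    rw [Finsupp.degree_eq_weight_one]
    exact hp (MvPolynomial.mem_support_iff.1 hd)
  obtain ⟨i, e, he, h2⟩ := exists_monomial_eq_X_mul hd4
  obtain ⟨j, e', he', h3⟩ := exists_monomial_eq_X_mul he
  obtain ⟨k, e'', he'', h4⟩ := exists_monomial_eq_X_mul he'
  obtain ⟨l, e''', he''', h5⟩ := exists_monomial_eq_X_mul he''
  have h6 : e''' = 0 := (Finsupp.degree_eq_zero_iff e''').1 he'''
  have h7 : (fun x : Fin 8 → ℂ => MvPolynomial.eval x (MvPolynomial.monomial d 1)) =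
      (fun x => x i * x j) * fun x => x k * x l := by
    funext x
    rw [Pi.mul_apply, h2, h3, h4, h5, h6]
    simp
    ring
  rw [h7]
  exact Submodule.mul_mem_mul (hs.mul_mem_span i j) (hs.mul_mem_span k l)

/-- A quartic form that is invariant under the even 2-torsion points is a combination of the
squares of the forms `y_A`. -/
lemma Split.exists_eq_sum_sq {ℓ : Fin 8 → ℂ[X]} (hs : Split ℓ) {p : MvPolynomial (Fin 8) ℂ}
    (hp : p.IsHomogeneous 4) (hinv : ∀ T ∈ evenPts, ∀ x,
      MvPolynomial.eval ((torsMat ℓ T).mulVec x) p = resT ℓ T ^ 2 * MvPolynomial.eval x p) :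
    ∃ c : Finset (Fin 8) → ℂ, ∀ x,
      MvPolynomial.eval x p = ∑ A ∈ allPts, c A * evVal ℓ A x ^ 2 := by
  obtain ⟨c, hc⟩ := (Submodule.mem_span_range_iff_exists_fun ℂ).1 (hs.eval_mem_span hp)
  -- Averaging over one more translation multiplies the coefficient of `y_A y_B` by `(1 + weil A T *
  -- weil B T) / 2`, which is 0 or 1. For `A ≠ B` some `T` makes it 0; for `A = B` it is always 1.
  have key : ∀ s ⊆ evenPts, ∀ x, MvPolynomial.eval x p =
      ∑ A : allPts × allPts, c A * (∏ T ∈ s, (1 + weil A.1 T * weil A.2 T) / 2) *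
        (evVal ℓ A.1 x * evVal ℓ A.2 x) := by
    intro s
    induction s using Finset.induction_on with
    | empty =>
      intro _ x
      have := congrFun hc x
      rw [← this]
      simp
    | insert T s hT ih =>
      intro hsub x
      have hTm := hsub (Finset.mem_insert_self T s)
      have ih' := ih ((Finset.subset_insert T s).trans hsub)
      have hr := hs.resT_ne_zero (card_of_mem_evenPts hTm)
      have h1 : MvPolynomial.eval x p = (MvPolynomial.eval x p +
          (resT ℓ T ^ 2)⁻¹ * MvPolynomial.eval ((torsMat ℓ T).mulVec x) p) / 2 := by
        rw [hinv T hTm]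
        field_simp
        norm_num
      rw [h1, ih' x, ih' ((torsMat ℓ T).mulVec x), Finset.mul_sum, ← Finset.sum_add_distrib,
        Finset.sum_div]
      refine Finset.sum_congr rfl fun A _ => ?_
      rw [hs.evVal_torsMat_mulVec A.1.2 hTm, hs.evVal_torsMat_mulVec A.2.2 hTm,
        Finset.prod_insert hT]
      field_simp
  refine ⟨fun A => if h : A ∈ allPts then c (⟨A, h⟩, ⟨A, h⟩) else 0, fun x => ?_⟩
  rw [key evenPts subset_rfl x, Fintype.sum_prod_type, ← Finset.sum_coe_sort allPts]
  refine Finset.sum_congr rfl fun A _ => ?_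
  rw [Finset.sum_eq_single A]
  · rw [Finset.prod_eq_one fun T _ => by rw [weil_mul_self]; norm_num]
    simp [pow_two]
  · intro B _ hB
    obtain ⟨T, hT, hw⟩ := exists_weil_eq_neg_one A.2 B.2 (fun h => hB (Subtype.ext h.symm))
    rw [Finset.prod_eq_zero hT (by rw [hw]; norm_num)]
    simp
  · simp

/-! ### Leading terms -/

/-- The last column of the matrix of `y_A`. -/
def lastCol (ℓ : Fin 8 → ℂ[X]) (A : Finset (Fin 8)) : Fin 8 → ℂ :=
  (evForm ℓ A).mulVec (Pi.single 7 1)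

lemma tau_zero (ℓ : Fin 8 → ℂ[X]) (T : Finset (Fin 8)) : tau ℓ T 0 = 1 := tauForm_zero _ _

lemma lastCol_of_mem {ℓ : Fin 8 → ℂ[X]} {T : Finset (Fin 8)} (hT : T ∈ evenPts) :
    lastCol ℓ T = matS.mulVec (tau ℓ T) := by
  rw [lastCol, evForm_of_mem hT, yMat, yMatForm_mulVec]
  rw [← tau.eq_def]
  have h1 : (Pi.single 7 1 - (Pi.single 7 1 : Fin 8 → ℂ) 0 • tau ℓ T) = Pi.single 7 1 := by simp
  have h2 : (coreMat (factorCoeff ℓ T) (factorCoeff ℓ Tᶜ)).mulVec (Pi.single 7 1) = 0 := by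
    ext i
    fin_cases i <;> simp [coreMat]
  have h3 : matS.mulVec (tau ℓ T) ⬝ᵥ Pi.single 7 1 = 1 := by
    rw [matS_mulVec]
    simp [tau_zero]
  rw [h1, h2, h3]
  simp

lemma lastCol_seven {ℓ : Fin 8 → ℂ[X]} {T : Finset (Fin 8)} (hT : T ∈ evenPts) :
    lastCol ℓ T 7 = 1 := by
  rw [lastCol_of_mem hT, matS_mulVec]
  simp [tau_zero]

lemma lastCol_empty_seven (ℓ : Fin 8 → ℂ[X]) : lastCol ℓ ∅ 7 = 0 := by
  rw [lastCol, evForm_empty, matS_mulVec]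
  simp

lemma evVal_add_smul {ℓ : Fin 8 → ℂ[X]} {A : Finset (Fin 8)} (hA : A ∈ allPts) (x : Fin 8 → ℂ)
    (t : ℂ) : evVal ℓ A (x + t • Pi.single 7 1) =
      evVal ℓ A x + 2 * t * (lastCol ℓ A ⬝ᵥ x) + t ^ 2 * lastCol ℓ A 7 := by
  have h1 : Pi.single 7 1 ⬝ᵥ (evForm ℓ A).mulVec x = lastCol ℓ A ⬝ᵥ x := by
    rw [Matrix.dotProduct_mulVec, ← Matrix.mulVec_transpose, evForm_transpose hA, lastCol]
  simp only [evVal, Matrix.mulVec_add, Matrix.mulVec_smul, dotProduct_add, add_dotProduct,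
    smul_dotProduct, dotProduct_smul, h1, smul_eq_mul]
  rw [← lastCol.eq_def, dotProduct_comm x (lastCol ℓ A), single_dotProduct]
  ring

/-- The restriction of a polynomial to the line through `x` in the direction of the last
coordinate. -/
def lineAt (x : Fin 8 → ℂ) : MvPolynomial (Fin 8) ℂ →ₐ[ℂ] ℂ[X] :=
  MvPolynomial.aeval fun i => C (x i) + if i = 7 then X else 0

lemma eval_lineAt (x : Fin 8 → ℂ) (t : ℂ) (p : MvPolynomial (Fin 8) ℂ) :
    (lineAt x p).eval t = MvPolynomial.eval (x + t • Pi.single 7 1) p := by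
  induction p using MvPolynomial.induction_on with
  | C a => simp [lineAt]
  | add p q hp hq => simp [hp, hq]
  | mul_X p i hp =>
    rw [map_mul, map_mul, eval_mul, hp]
    congr 1
    by_cases h : i = 7
    · subst h; simp [lineAt]
    · simp [lineAt, h]

lemma natDegree_lineAt_le (x : Fin 8 → ℂ) (p : MvPolynomial (Fin 8) ℂ) :
    (lineAt x p).natDegree ≤ p.degreeOf 7 := by
  conv_lhs => rw [p.as_sum, map_sum]
  refine natDegree_sum_le_of_forall_le _ _ fun d hd => ?_
  rw [lineAt, MvPolynomial.aeval_monomial, Finsupp.prod_fintype _ _ (by simp)]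
  refine natDegree_mul_le.trans ?_
  rw [algebraMap_eq, natDegree_C, zero_add]
  refine (natDegree_prod_le _ _).trans ?_
  refine le_trans (Finset.sum_le_sum fun i _ => natDegree_pow_le (n := d i)) ?_
  rw [Finset.sum_eq_single 7]
  · refine le_trans ?_ (MvPolynomial.monomial_le_degreeOf 7 hd)
    refine (Nat.mul_le_mul_left _ ?_).trans (Nat.mul_one _).le
    rw [if_pos rfl]
    exact (natDegree_C_add (a := x 7)).le.trans natDegree_X.le
  · intro i _ hi
    simp [hi]
  · simp

lemma coeff_three_sq (a b c : ℂ) : ((C a + C b * X + C c * X ^ 2) ^ 2).coeff 3 = 2 * b * c := by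
  have : (C a + C b * X + C c * X ^ 2) ^ 2 = C (a ^ 2) + C (2 * a * b) * X +
      C (b ^ 2 + 2 * a * c) * X ^ 2 + C (2 * b * c) * X ^ 3 + C (c ^ 2) * X ^ 4 := by
    simp only [map_add, map_mul, map_pow, map_ofNat]
    ring
  rw [this]
  simp only [coeff_add, coeff_C_mul, coeff_X_pow, coeff_X, coeff_C]
  norm_num

lemma coeff_three_lineAt {p : MvPolynomial (Fin 8) ℂ} (hp : p.degreeOf 7 ≤ 2) (x : Fin 8 → ℂ) :
    (lineAt x p).coeff 3 = 0 :=
  coeff_eq_zero_of_natDegree_lt (((natDegree_lineAt_le x p).trans hp).trans_lt (by norm_num))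

/-- For `j ≠ 7` the coefficient is that of `4 ξ_j ξ₈³`; for `j = 7` it is the binomial term `4 x₈
t³` of `(x₈ + t)⁴`. The two normalisations of `δ` thus amount to one condition. -/
lemma IsDuplication.coeff_three {ℓ : Fin 8 → ℂ[X]} {δ : Fin 8 → MvPolynomial (Fin 8) ℂ}
    (hδ : IsDuplication ℓ δ) (j : Fin 8) (x : Fin 8 → ℂ) :
    (lineAt x (δ j)).coeff 3 = 4 * x j := by
  by_cases hj : j = 7
  · subst hj
    have h := coeff_three_lineAt hδ.leading_last x
    rw [map_sub, coeff_sub, sub_eq_zero] at h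
    rw [h, map_pow, lineAt, MvPolynomial.aeval_X, if_pos rfl]
    have : (C (x 7) + X : ℂ[X]) ^ 4 = C (x 7 ^ 4) + C (4 * x 7 ^ 3) * X + C (6 * x 7 ^ 2) * X ^ 2 +
        C (4 * x 7) * X ^ 3 + X ^ 4 := by
      simp only [map_mul, map_pow, map_ofNat]
      ring
    rw [this]
    simp only [coeff_add, coeff_C_mul, coeff_X_pow, coeff_X, coeff_C]
    norm_num
  · have h := coeff_three_lineAt (hδ.leading j hj) x
    rw [map_sub, coeff_sub, sub_eq_zero] at h
    rw [h, map_mul, map_mul, map_pow, lineAt, MvPolynomial.aeval_X, MvPolynomial.aeval_X,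
      if_pos rfl, if_neg hj]
    have : (MvPolynomial.aeval fun i => C (x i) + if i = 7 then X else 0 : _ →ₐ[ℂ] ℂ[X])
        (MvPolynomial.C 4) * (C (x j) + 0) * (C (x 7) + X : ℂ[X]) ^ 3 =
        C (4 * x j) * X ^ 3 + C (12 * x j * x 7) * X ^ 2 + C (12 * x j * x 7 ^ 2) * X +
        C (4 * x j * x 7 ^ 3) := by
      rw [MvPolynomial.aeval_C, algebraMap_eq]
      simp only [map_mul, map_pow, map_ofNat]
      ring
    rw [this]
    simp only [coeff_add, coeff_C_mul, coeff_X_pow, coeff_X, coeff_C]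
    norm_num

/-- The duplication forms as combinations of the squares of the forms `y_A`. -/
lemma IsDuplication.exists_eq_sum {ℓ : Fin 8 → ℂ[X]} {δ : Fin 8 → MvPolynomial (Fin 8) ℂ}
    (hδ : IsDuplication ℓ δ) (hs : Split ℓ) (j : Fin 8) :
    ∃ c : Finset (Fin 8) → ℂ,
      (∀ x, dupMap δ x j = ∑ A ∈ allPts, c A * evVal ℓ A x ^ 2) ∧
      ∀ x, ∑ T ∈ evenPts, c T * (matS.mulVec (tau ℓ T) ⬝ᵥ x) = x j := by
  obtain ⟨c, hc⟩ := hs.exists_eq_sum_sq (hδ.homogeneous j) fun T hT x => hδ.invariant T hT j x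
  refine ⟨c, hc, fun x => ?_⟩
  -- Along the line each `y_A` is a quadratic polynomial in the parameter, so the cubic coefficient
  -- of its square is twice the product of its linear and leading coefficients.
  have h1 : lineAt x (δ j) = ∑ A ∈ allPts, C (c A) *
      (C (evVal ℓ A x) + C (2 * (lastCol ℓ A ⬝ᵥ x)) * X + C (lastCol ℓ A 7) * X ^ 2) ^ 2 := by
    refine Polynomial.funext fun t => ?_
    rw [eval_lineAt, hc, eval_finsetSum]
    refine Finset.sum_congr rfl fun A hA => ?_
    rw [evVal_add_smul hA]
    simp
    left
    ring
  have h2 := hδ.coeff_three j x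
  rw [h1, finsetSum_coeff] at h2
  simp only [coeff_C_mul, coeff_three_sq] at h2
  -- The form `y_∅` has no term in `ξ₈²`, so its square has no cubic coefficient and its constant
  -- stays undetermined.
  rw [allPts, Finset.sum_insert empty_notMem_evenPts, lastCol_empty_seven, mul_zero, mul_zero,
    zero_add] at h2
  have h3 : ∑ T ∈ evenPts, c T * (2 * (2 * (lastCol ℓ T ⬝ᵥ x)) * lastCol ℓ T 7) =
      4 * ∑ T ∈ evenPts, c T * (matS.mulVec (tau ℓ T) ⬝ᵥ x) := by
    rw [Finset.mul_sum]
    refine Finset.sum_congr rfl fun T hT => ?_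
    rw [lastCol_seven hT, lastCol_of_mem hT]
    ring
  rw [h3] at h2
  exact mul_left_cancel₀ (by norm_num : (4 : ℂ) ≠ 0) h2

/-! ### Existence of the duplication forms -/

lemma trace_matS_single (i j : Fin 8) :
    (matS * Matrix.single i j (1 : ℂ)).trace = matS j i := by
  rw [Matrix.trace_mul_single]
  simp

/-- A symmetric matrix with last column `e_j` is expanded in the basis of the `y_A`, and the last
column of this expansion is read off. -/
lemma Split.exists_sum_lastCol {ℓ : Fin 8 → ℂ[X]} (hs : Split ℓ) (j : Fin 8) :
    ∃ c : Finset (Fin 8) → ℂ, ∑ T ∈ evenPts, c T • lastCol ℓ T = Pi.single j 1 := by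
  have key (N : Matrix (Fin 8) (Fin 8) ℂ) (hN : N.transpose = N) (hN0 : (matS * N).trace = 0) :
      ∃ c : Finset (Fin 8) → ℂ, ∑ T ∈ evenPts, c T • lastCol ℓ T = N.mulVec (Pi.single 7 1) := by
    refine ⟨fun A => (matS * N * evMat ℓ A).trace / (8 * evRes ℓ A), ?_⟩
    conv_rhs => rw [hs.eq_sum_evForm hN, allPts, Finset.sum_insert empty_notMem_evenPts,
      evMat_empty, mul_one, hN0, zero_div, zero_smul, zero_add]
    rw [Matrix.sum_mulVec]
    simp only [Matrix.smul_mulVec, lastCol]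
  -- The last column of `K` is zero while `tr (S K) = -2`, so adding a multiple of `K` removes the
  -- coefficient of `S` without changing the last column.
  set K : Matrix (Fin 8) (Fin 8) ℂ := Matrix.single 1 6 1 + Matrix.single 6 1 1 with hK
  have hKt : K.transpose = K := by
    rw [hK, Matrix.transpose_add, Matrix.transpose_single, Matrix.transpose_single, add_comm]
  have hK7 : K.mulVec (Pi.single 7 1) = 0 := by
    rw [hK, Matrix.mulVec_single_one]
    ext i
    simp
  have hKtr : (matS * K).trace = -2 := by
    rw [hK, mul_add, Matrix.trace_add, trace_matS_single, trace_matS_single]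
    simp [matS, sgn, Fin.rev]
    norm_num
  have key2 (N : Matrix (Fin 8) (Fin 8) ℂ) (hN : N.transpose = N) :
      ∃ c : Finset (Fin 8) → ℂ, ∑ T ∈ evenPts, c T • lastCol ℓ T = N.mulVec (Pi.single 7 1) := by
    obtain ⟨c, hc⟩ := key (N + ((matS * N).trace / 2) • K)
      (by rw [Matrix.transpose_add, Matrix.transpose_smul, hN, hKt])
      (by rw [mul_add, mul_smul_comm, Matrix.trace_add, Matrix.trace_smul, hKtr, smul_eq_mul]; ring)
    exact ⟨c, by rw [hc, Matrix.add_mulVec, Matrix.smul_mulVec, hK7, smul_zero, add_zero]⟩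
  by_cases hj : j = 7
  · obtain ⟨c, hc⟩ := key2 (Matrix.single 7 7 1) (Matrix.transpose_single _ _ _)
    refine ⟨c, by 
      rw [hc, hj, Matrix.mulVec_single_one]
      ext i
      simp [Matrix.single_apply, Pi.single_apply, eq_comm]⟩
  · obtain ⟨c, hc⟩ := key2 (Matrix.single j 7 1 + Matrix.single 7 j 1)
      (by rw [Matrix.transpose_add, Matrix.transpose_single, Matrix.transpose_single, add_comm])
    refine ⟨c, ?_⟩
    rw [hc, Matrix.mulVec_single_one]
    ext i
    simp [Matrix.single_apply, Pi.single_apply, eq_comm, hj]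

/-- The linear form with the given coefficients. -/
def linPoly (v : Fin 8 → ℂ) : MvPolynomial (Fin 8) ℂ := ∑ i, MvPolynomial.C (v i) * MvPolynomial.X i

/-- The quadratic form `y_A`. -/
def evPoly (ℓ : Fin 8 → ℂ[X]) (A : Finset (Fin 8)) : MvPolynomial (Fin 8) ℂ :=
  ∑ i, MvPolynomial.X i * linPoly (evForm ℓ A i)

lemma isHomogeneous_linPoly (v : Fin 8 → ℂ) : (linPoly v).IsHomogeneous 1 :=
  MvPolynomial.IsHomogeneous.sum _ _ _ fun i _ =>
    (MvPolynomial.isHomogeneous_X ℂ i).C_mul _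

lemma isHomogeneous_evPoly (ℓ : Fin 8 → ℂ[X]) (A : Finset (Fin 8)) :
    (evPoly ℓ A).IsHomogeneous 2 :=
  MvPolynomial.IsHomogeneous.sum _ _ _ fun i _ =>
    (MvPolynomial.isHomogeneous_X ℂ i).mul (isHomogeneous_linPoly _)

lemma eval_linPoly (v x : Fin 8 → ℂ) : MvPolynomial.eval x (linPoly v) = v ⬝ᵥ x := by
  simp [linPoly, dotProduct]

lemma eval_evPoly (ℓ : Fin 8 → ℂ[X]) (A : Finset (Fin 8)) (x : Fin 8 → ℂ) :
    MvPolynomial.eval x (evPoly ℓ A) = evVal ℓ A x := by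
  simp only [evPoly, map_sum, map_mul, MvPolynomial.eval_X, eval_linPoly]
  rfl

lemma sum_C_mul_linPoly {s : Finset (Finset (Fin 8))} (c : Finset (Fin 8) → ℂ)
    (v : Finset (Fin 8) → Fin 8 → ℂ) :
    ∑ T ∈ s, MvPolynomial.C (c T) * linPoly (v T) = linPoly (∑ T ∈ s, c T • v T) := by
  simp only [linPoly, Finset.mul_sum, Finset.sum_apply, map_sum, Finset.sum_mul, Pi.smul_apply,
    smul_eq_mul, map_mul]
  rw [Finset.sum_comm]
  simp only [mul_assoc]

lemma linPoly_single (j : Fin 8) : linPoly (Pi.single j 1) = MvPolynomial.X j := by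
  rw [linPoly, Finset.sum_eq_single j]
  · simp
  · intro i _ hi
    simp [hi]
  · simp

lemma linPoly_eq_add (v : Fin 8 → ℂ) : linPoly v =
    linPoly (fun j => if j = 7 then 0 else v j) + MvPolynomial.C (v 7) * MvPolynomial.X 7 := by
  rw [linPoly, linPoly, ← Finset.add_sum_erase _ _ (Finset.mem_univ (7 : Fin 8)),
    ← Finset.add_sum_erase Finset.univ (fun i => MvPolynomial.C (if i = 7 then 0 else v i) *
      MvPolynomial.X i) (Finset.mem_univ (7 : Fin 8)), if_pos rfl, map_zero, zero_mul, zero_add,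
    add_comm]
  congr 1

lemma degreeOf_seven_linPoly {v : Fin 8 → ℂ} (hv : v 7 = 0) : (linPoly v).degreeOf 7 = 0 := by
  refine Nat.le_zero.1 ((MvPolynomial.degreeOf_sum_le _ _ _).trans (Finset.sup_le fun i _ => ?_))
  by_cases hi : i = 7
  · simp [hi, hv]
  · refine (MvPolynomial.degreeOf_C_mul_le _ _ _).trans ?_
    rw [MvPolynomial.degreeOf_X, if_neg (Ne.symm hi)]

/-- The linear form of the last column contains `ξ₈` with coefficient 1, so doubling its product
with `ξ₈` counts `ξ₈²` twice; this explains the subtracted square. -/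
lemma evPoly_eq {ℓ : Fin 8 → ℂ[X]} {T : Finset (Fin 8)} (hT : T ∈ evenPts) :
    ∃ R : MvPolynomial (Fin 8) ℂ, R.degreeOf 7 = 0 ∧ evPoly ℓ T =
      2 * MvPolynomial.X 7 * linPoly (lastCol ℓ T) - MvPolynomial.X 7 ^ 2 + R := by
  set B := evForm ℓ T with hB
  have hBt : B.transpose = B := evForm_transpose (Finset.mem_insert_of_mem hT)
  have hcol (i : Fin 8) : B i 7 = lastCol ℓ T i := by simp [lastCol, ← hB]
  have hrow (i : Fin 8) : B 7 i = lastCol ℓ T i := by rw [← hcol, ← hBt, Matrix.transpose_apply, hBt]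
  have h7 : B 7 = lastCol ℓ T := funext hrow
  refine ⟨∑ i : Fin 7, MvPolynomial.X i.castSucc *
    linPoly (fun j => if j = 7 then 0 else B i.castSucc j), ?_, ?_⟩
  · refine Nat.le_zero.1 ((MvPolynomial.degreeOf_sum_le _ _ _).trans (Finset.sup_le fun i _ => ?_))
    refine (MvPolynomial.degreeOf_mul_le _ _ _).trans ?_
    rw [degreeOf_seven_linPoly (if_pos rfl), MvPolynomial.degreeOf_X, if_neg]
    exact (Fin.castSucc_lt_last i).ne'
  · have hlin (i : Fin 7) : linPoly (B i.castSucc) =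
        linPoly (fun j => if j = 7 then 0 else B i.castSucc j) +
          MvPolynomial.C (lastCol ℓ T i.castSucc) * MvPolynomial.X 7 := by
      rw [← hcol, linPoly_eq_add]
    have hlast : linPoly (lastCol ℓ T) = ∑ i : Fin 7, MvPolynomial.C (lastCol ℓ T i.castSucc) *
        MvPolynomial.X i.castSucc + MvPolynomial.X 7 := by
      rw [linPoly, Fin.sum_univ_castSucc]
      simp only [Fin.reduceLast, lastCol_seven hT, map_one, one_mul]
    rw [evPoly, Fin.sum_univ_castSucc]
    simp only [Fin.reduceLast, ← hB, h7, hlin, mul_add, Finset.sum_add_distrib]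
    rw [hlast]
    have : ∑ i : Fin 7, MvPolynomial.X i.castSucc * (MvPolynomial.C (lastCol ℓ T i.castSucc) *
        MvPolynomial.X (7 : Fin 8)) = MvPolynomial.X 7 * ∑ i : Fin 7,
          MvPolynomial.C (lastCol ℓ T i.castSucc) * MvPolynomial.X i.castSucc := by
      rw [Finset.mul_sum]
      exact Finset.sum_congr rfl fun i _ => by ring
    rw [this]
    ring

lemma degreeOf_evPoly_sq {ℓ : Fin 8 → ℂ[X]} {T : Finset (Fin 8)} (hT : T ∈ evenPts) :
    (evPoly ℓ T ^ 2 - 4 * MvPolynomial.X 7 ^ 3 * linPoly (lastCol ℓ T) +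
      3 * MvPolynomial.X 7 ^ 4).degreeOf 7 ≤ 2 := by
  obtain ⟨R, hR, h⟩ := evPoly_eq (ℓ := ℓ) hT
  set L := linPoly (lastCol ℓ T - Pi.single 7 1) with hL
  have hL0 : L.degreeOf 7 = 0 := degreeOf_seven_linPoly (by simp [lastCol_seven hT])
  have h1 : linPoly (lastCol ℓ T) = L + MvPolynomial.X 7 := by
    rw [← linPoly_single, hL]
    simp only [linPoly, ← Finset.sum_add_distrib, ← add_mul, ← map_add]
    simp
  have h2 : evPoly ℓ T ^ 2 - 4 * MvPolynomial.X 7 ^ 3 * linPoly (lastCol ℓ T) +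
      3 * MvPolynomial.X 7 ^ 4 =
      (MvPolynomial.C 4 * L * L + MvPolynomial.C 2 * R) * MvPolynomial.X 7 ^ 2 +
        MvPolynomial.C 4 * (L * R) * MvPolynomial.X 7 + R * R := by
    rw [h, h1]
    simp only [map_ofNat]
    ring
  have h3 : (MvPolynomial.C 4 * L * L + MvPolynomial.C 2 * R).degreeOf 7 = 0 := by
    refine Nat.le_zero.1 ((MvPolynomial.degreeOf_add_le _ _ _).trans (max_le ?_ ?_))
    · rw [mul_assoc]
      refine (MvPolynomial.degreeOf_C_mul_le _ _ _).trans ((MvPolynomial.degreeOf_mul_le _ _ _).trans ?_)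
      rw [hL0]
    · exact (MvPolynomial.degreeOf_C_mul_le _ _ _).trans hR.le
  have h4 : (MvPolynomial.C 4 * (L * R)).degreeOf 7 = 0 := by
    refine Nat.le_zero.1 ((MvPolynomial.degreeOf_C_mul_le _ _ _).trans
      ((MvPolynomial.degreeOf_mul_le _ _ _).trans ?_))
    rw [hL0, hR]
  rw [h2]
  refine (MvPolynomial.degreeOf_add_le _ _ _).trans (max_le
    ((MvPolynomial.degreeOf_add_le _ _ _).trans (max_le ?_ ?_)) ?_)
  · refine (MvPolynomial.degreeOf_mul_le _ _ _).trans ?_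
    rw [h3, MvPolynomial.degreeOf_X_self_pow, zero_add]
  · refine (MvPolynomial.degreeOf_mul_le _ _ _).trans ?_
    rw [h4, MvPolynomial.degreeOf_X_self]
    norm_num
  · refine (MvPolynomial.degreeOf_mul_le _ _ _).trans ?_
    rw [hR]
    norm_num

/-- Take `δ_j = ∑ c_T y_T²` with `∑ c_T lastCol(T) = e_j`. Squares of semi-invariants are invariant.
Since `y_T²` begins with `4 ξ₈³ L_T - 3 ξ₈⁴`, where `L_T` is the form of the last column, the sum
begins with `4 ξ_j ξ₈³` for `j ≠ 7` and with `(4 - 3) ξ₈⁴` for `j = 7`. -/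
theorem Split.exists_isDuplication {ℓ : Fin 8 → ℂ[X]} (hs : Split ℓ) : ∃ δ, IsDuplication ℓ δ := by
  choose c hc using hs.exists_sum_lastCol
  have hc7 (j : Fin 8) : ∑ T ∈ evenPts, c j T = if j = 7 then 1 else 0 := by
    have := congrFun (hc j) 7
    rw [Finset.sum_apply, Finset.sum_congr rfl fun T hT => by
      rw [Pi.smul_apply, lastCol_seven hT, smul_eq_mul, mul_one]] at this
    rw [this, Pi.single_apply]
    simp [eq_comm]
  have hlead (j : Fin 8) : (∑ T ∈ evenPts, MvPolynomial.C (c j T) * evPoly ℓ T ^ 2 -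
      4 * MvPolynomial.X 7 ^ 3 * MvPolynomial.X j +
      3 * MvPolynomial.X 7 ^ 4 * MvPolynomial.C (if j = 7 then 1 else 0)).degreeOf 7 ≤ 2 := by
    have h1 : ∑ T ∈ evenPts, MvPolynomial.C (c j T) * evPoly ℓ T ^ 2 -
        4 * MvPolynomial.X 7 ^ 3 * MvPolynomial.X j +
        3 * MvPolynomial.X 7 ^ 4 * MvPolynomial.C (if j = 7 then 1 else 0) =
        ∑ T ∈ evenPts, MvPolynomial.C (c j T) * (evPoly ℓ T ^ 2 -
          4 * MvPolynomial.X 7 ^ 3 * linPoly (lastCol ℓ T) + 3 * MvPolynomial.X 7 ^ 4) := by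
      rw [← linPoly_single j, ← hc, ← hc7, ← sum_C_mul_linPoly, map_sum, Finset.mul_sum,
        Finset.mul_sum, ← Finset.sum_sub_distrib, ← Finset.sum_add_distrib]
      exact Finset.sum_congr rfl fun T _ => by ring
    rw [h1]
    exact (MvPolynomial.degreeOf_sum_le _ _ _).trans (Finset.sup_le fun T hT =>
      (MvPolynomial.degreeOf_C_mul_le _ _ _).trans (degreeOf_evPoly_sq hT))
  refine ⟨fun j => ∑ T ∈ evenPts, MvPolynomial.C (c j T) * evPoly ℓ T ^ 2, fun j => ?_,
    fun T hT j x => ?_, fun j hj => ?_, ?_⟩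
  · exact MvPolynomial.IsHomogeneous.sum _ _ _ fun T _ =>
      ((isHomogeneous_evPoly ℓ T).pow 2).C_mul _
  · simp only [map_sum, map_mul, map_pow, MvPolynomial.eval_C, eval_evPoly, Finset.mul_sum]
    refine Finset.sum_congr rfl fun A hA => ?_
    rw [hs.evVal_torsMat_mulVec (Finset.mem_insert_of_mem hA) hT, mul_pow, mul_pow, sq (weil A T),
      weil_mul_self]
    ring
  · have h := hlead j
    rw [if_neg hj, map_zero, mul_zero, add_zero] at h
    convert h using 3
    rw [map_ofNat]
    ring
  · have h := hlead 7
    rw [if_pos rfl, map_one] at h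
    convert h using 2
    ring

/-! ### The forms `y_T` as determinants -/

/-- The alternating matrix of `ξ`. -/
def altMat (t : Fin 8 → ℂ) : Matrix (Fin 4) (Fin 4) ℂ :=
  !![0, t 6, t 5, t 3; -t 6, 0, t 4, t 2; -t 5, -t 4, 0, t 1; -t 3, -t 2, -t 1, 0]

lemma altMat_mulVec (t : Fin 8 → ℂ) (e : Fin 4 → ℂ) : (altMat t).mulVec e = altMul t e := by
  ext i
  fin_cases i <;> simp [altMat, altMul, Matrix.mulVec, dotProduct, Fin.sum_univ_four] <;> ring

/-- Transposition changes the sign of `d`, so only even degrees in `d` occur; degree two gives the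
form in the minors of `q` and degree four the squared Pfaffian. -/
lemma det_add_altMat {q : Matrix (Fin 4) (Fin 4) ℂ} (hq : q.IsSymm) (d : Fin 8 → ℂ) :
    (q + altMat d).det = q.det + d ⬝ᵥ ![0, -starMid q 0 1 d, starMid q 0 2 d, -starMid q 1 2 d,
      -starMid q 0 3 d, starMid q 1 3 d, -starMid q 2 3 d, 0] + pf d ^ 2 := by
  have h10 := hq.apply 0 1
  have h20 := hq.apply 0 2
  have h30 := hq.apply 0 3
  have h21 := hq.apply 1 2
  have h31 := hq.apply 1 3
  have h32 := hq.apply 2 3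
  simp only [det_fin_four, dotProduct, Fin.sum_univ_eight]
  simp [altMat, starMid, minor2, pf, h10, h20, h30, h21, h31, h32]
  ring

lemma pf_sub {x t : Fin 8 → ℂ} (hx0 : x 0 = 1) (hx7 : x 7 = pf x) (ht0 : t 0 = 1)
    (ht7 : t 7 = pf t) : pf (x - t) = matS.mulVec t ⬝ᵥ x := by
  rw [matS_mulVec]
  simp only [dotProduct, Fin.sum_univ_eight]
  simp [hx0, hx7, ht0, ht7, pf]
  ring

/-- The three summands of `y_T` are the three terms of `det_add_altMat`: the resultant, the form of
`coreMat`, and the square of `⟨τ, x⟩_S`, which on the quadric is the Pfaffian of `x - τ`. -/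
lemma evVal_eq_det {ℓ : Fin 8 → ℂ[X]} {T : Finset (Fin 8)} (hT : T ∈ evenPts)
    {x : Fin 8 → ℂ} (hx0 : x 0 = 1) (hx7 : x 7 = pf x) :
    evVal ℓ T x = (bez (factorCoeff ℓ T) (factorCoeff ℓ Tᶜ) + altMat (x - tau ℓ T)).det := by
  have ht7 : tau ℓ T 7 = pf (tau ℓ T) := tauForm_pf _ _
  rw [det_add_altMat (bez_isSymm _ _), pf_sub hx0 hx7 (tau_zero ℓ T) ht7, ← resT_eq,
    ← coreMat_mulVec, evVal, evForm_of_mem hT, yMat, yMatForm_mulVec, ← tau.eq_def, hx0, one_smul,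
    sub_dotProduct, dotProduct_add, dotProduct_add, dotProduct_sub, dotProduct_smul,
    dotProduct_single, dotProduct_single, hx0, smul_eq_mul, dotProduct_comm x (matS.mulVec _)]
  ring

lemma altMat_neg (t : Fin 8 → ℂ) : altMat (-t) = -altMat t := by
  ext i j
  fin_cases i <;> fin_cases j <;> simp [altMat]

lemma det_add_altMat_neg {q : Matrix (Fin 4) (Fin 4) ℂ} (hq : q.IsSymm) (d : Fin 8 → ℂ) :
    (q + altMat (-d)).det = (q + altMat d).det := by
  rw [← Matrix.det_transpose (q + altMat d), Matrix.transpose_add, hq.eq, altMat_neg]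
  congr 2
  ext i j
  fin_cases i <;> fin_cases j <;> simp [altMat]

/-- The first half of the Clifford product of `ξ` and the vector of a root. -/
def rootVec (ℓ : Fin 8 → ℂ[X]) (x : Fin 8 → ℂ) (i : Fin 8) : Fin 4 → ℂ :=
  rtW ℓ i + altMul x (rtE ℓ i)

lemma altMul_sub (t u : Fin 8 → ℂ) (e : Fin 4 → ℂ) :
    altMul (t - u) e = altMul t e - altMul u e := by
  ext i
  fin_cases i <;> simp [altMul] <;> ring

/-- At a root of `G` the matrix `bez + altMat (τ - x)` sends the cubic monomial vector to minus
`rootVec`. This makes `y_T` a determinant of vectors that each depend on a single root and not on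
`T`. -/
lemma Split.evVal_mul_det {ℓ : Fin 8 → ℂ[X]} (hs : Split ℓ) {T : Finset (Fin 8)} (hT : T ∈ evenPts)
    {s : Fin 4 → Fin 8} (hsT : ∀ i, s i ∈ T) {x : Fin 8 → ℂ} (hx0 : x 0 = 1) (hx7 : x 7 = pf x) :
    evVal ℓ T x * (Matrix.of fun i => rtE ℓ (s i)).det =
      (Matrix.of fun i => rootVec ℓ x (s i)).det := by
  rw [evVal_eq_det hT hx0 hx7, ← det_add_altMat_neg (bez_isSymm _ _), neg_sub, mul_comm,
    ← Matrix.det_transpose (_ + _), ← Matrix.det_mul]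
  have h : (Matrix.of fun i => rtE ℓ (s i)) * (bez (factorCoeff ℓ T) (factorCoeff ℓ Tᶜ) +
      altMat (tau ℓ T - x)).transpose = -(Matrix.of fun i => rootVec ℓ x (s i)) := by
    ext i j
    have h1 : ((bez (factorCoeff ℓ T) (factorCoeff ℓ Tᶜ) + altMat (tau ℓ T - x)).mulVec
        (rtE ℓ (s i))) = -rootVec ℓ x (s i) := by
      rw [Matrix.add_mulVec, altMat_mulVec, rootVec, hs.rtW_eq (card_of_mem_evenPts hT), sig,
        if_pos (hsT i), altMul_sub, neg_one_smul]
      abel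
    rw [Matrix.neg_apply, Matrix.of_apply, ← Pi.neg_apply, ← h1, Matrix.mul_apply]
    simp only [Matrix.mulVec, dotProduct, Matrix.transpose_apply, Matrix.of_apply]
    exact Finset.sum_congr rfl fun k _ => mul_comm _ _
  rw [h, Matrix.det_neg, Fintype.card_fin]
  norm_num

/-! ### The coordinates of a point given by quartic forms -/

/-- The coefficients of a quartic form. -/
def qc (A : ℂ[X]) : Fin 5 → ℂ := fun i => A.coeff i

lemma kappa_zero (A B C : ℂ[X]) : kappa A B C 0 = 1 := rfl

lemma kappa_pf (A B C : ℂ[X]) : kappa A B C 7 = pf (kappa A B C) := by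
  simp [kappa, pf]
  ring

lemma altMul_kappa (A B C : ℂ[X]) (e : Fin 4 → ℂ) :
    altMul (kappa A B C) e = altMul (tauForm (qc B) (qc B)) e - altMul (tauForm (qc A) (qc C)) e := by
  ext i
  fin_cases i <;> simp [altMul, kappa, eta, tauForm, qc] <;> ring

lemma etaStd_sub (f g : ℕ → ℂ) (x z : ℂ) : etaStd (f - g) x z = etaStd f x z - etaStd g x z := by
  ext i
  fin_cases i <;> simp [etaStd] <;> ring

lemma mulLin_altMul_kappa {f A B C : ℂ[X]} (hA : A.natDegree ≤ 4) (hB : B.natDegree ≤ 4)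
    (hC : C.natDegree ≤ 4) (hf : B ^ 2 - A * C = f) (x z : ℂ) :
    mulLin x z (altMul (kappa A B C) (mon3 x z)) = (2 * hev 4 B x z) • qc B - hev 4 A x z • qc C -
      hev 4 C x z • qc A - etaStd f.coeff x z := by
  have h1 := mulLin_altMul_tauForm (isProd_coeff hB hB rfl) x z
  have h2 := mulLin_altMul_tauForm (isProd_coeff hA hC rfl) x z
  have h3 : f.coeff = (B * B).coeff - (A * C).coeff := by
    rw [← hf, sq]
    ext n
    simp
  rw [altMul_kappa, mulLin_sub]
  unfold qc
  rw [h1, h2, h3, etaStd_sub]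
  simp only [ev4_coeff]
  module

/-- The two occurrences of `etaStd` cancel, leaving the contraction of `2 B ⊗ B - A ⊗ C - C ⊗ A`
with the root. -/
lemma Split.mulLin_rootVec {ℓ : Fin 8 → ℂ[X]} (hs : Split ℓ) {A B C : ℂ[X]}
    (hA : A.natDegree ≤ 4) (hB : B.natDegree ≤ 4) (hC : C.natDegree ≤ 4)
    (hf : B ^ 2 - A * C = ∏ i, ℓ i) (i : Fin 8) :
    mulLin (rtX ℓ i) (rtZ ℓ i) (rootVec ℓ (kappa A B C) i) =
      (2 * hev 4 B (rtX ℓ i) (rtZ ℓ i)) • qc B - hev 4 A (rtX ℓ i) (rtZ ℓ i) • qc C -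
      hev 4 C (rtX ℓ i) (rtZ ℓ i) • qc A := by
  rw [rootVec, mulLin_add, hs.mulLin_rtW, rtE, mulLin_altMul_kappa hA hB hC hf]
  abel

/-! ### Pfaffians and Plücker relations -/

/-- This is `Pf (E X Eᵀ) = det E · Pf X`, with the Pfaffian on the left written out. -/
lemma pf_mul_det (d : Fin 8 → ℂ) (e : Fin 4 → Fin 4 → ℂ) :
    pf d * (Matrix.of e).det = (altMul d (e 0) ⬝ᵥ e 1) * (altMul d (e 2) ⬝ᵥ e 3) -
      (altMul d (e 0) ⬝ᵥ e 2) * (altMul d (e 1) ⬝ᵥ e 3) +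
      (altMul d (e 0) ⬝ᵥ e 3) * (altMul d (e 1) ⬝ᵥ e 2) := by
  rw [det_fin_four]
  simp only [dotProduct, Fin.sum_univ_four]
  simp [altMul, pf, minor2]
  ring

/-- The rows on the left are the tensors `(α_i, β_i) ⊗ (z_i, x_i)`, and their determinant is
bilinear in products of brackets of the two families. The hypothesis expresses the alternating form
through the same brackets. -/
lemma det_tensor_sq {x z α β : Fin 4 → ℂ} {d : Fin 8 → ℂ}
    (h : ∀ i j, (x i * z j - x j * z i) * (altMul d (mon3 (x i) (z i)) ⬝ᵥ mon3 (x j) (z j)) =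
      -(α i * β j - α j * β i) ^ 2) :
    (Matrix.of fun i => ![α i * z i, α i * x i, β i * z i, β i * x i]).det ^ 2 =
      pf d * (Matrix.of fun i => mon3 (x i) (z i)).det ^ 2 := by
  have hP := pf_mul_det d fun i => mon3 (x i) (z i)
  have hD := det_mon3 x z
  have ht : (Matrix.of fun i => ![α i * z i, α i * x i, β i * z i, β i * x i]).det =
      (x 0 * z 1 - x 1 * z 0) * (x 2 * z 3 - x 3 * z 2) *
        ((α 0 * β 2 - α 2 * β 0) * (α 1 * β 3 - α 3 * β 1)) -
      (x 0 * z 2 - x 2 * z 0) * (x 1 * z 3 - x 3 * z 1) *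
        ((α 0 * β 1 - α 1 * β 0) * (α 2 * β 3 - α 3 * β 2)) := by
    rw [det_fin_four]
    simp [minor2]
    ring
  have h01 := h 0 1
  have h02 := h 0 2
  have h03 := h 0 3
  have h12 := h 1 2
  have h13 := h 1 3
  have h23 := h 2 3
  generalize altMul d (mon3 (x 0) (z 0)) ⬝ᵥ mon3 (x 1) (z 1) = e01 at *
  generalize altMul d (mon3 (x 0) (z 0)) ⬝ᵥ mon3 (x 2) (z 2) = e02 at *
  generalize altMul d (mon3 (x 0) (z 0)) ⬝ᵥ mon3 (x 3) (z 3) = e03 at *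
  generalize altMul d (mon3 (x 1) (z 1)) ⬝ᵥ mon3 (x 2) (z 2) = e12 at *
  generalize altMul d (mon3 (x 1) (z 1)) ⬝ᵥ mon3 (x 3) (z 3) = e13 at *
  generalize altMul d (mon3 (x 2) (z 2)) ⬝ᵥ mon3 (x 3) (z 3) = e23 at *
  set D := (Matrix.of fun i => mon3 (x i) (z i)).det
  -- The Plücker relations of both families give `c = a + b` and `w = u + v` below, and both sides
  -- become `(a v - b u)²`.
  have hk : (x 0 * z 2 - x 2 * z 0) * (x 1 * z 3 - x 3 * z 1) =
      (x 0 * z 1 - x 1 * z 0) * (x 2 * z 3 - x 3 * z 2) +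
      (x 0 * z 3 - x 3 * z 0) * (x 1 * z 2 - x 2 * z 1) := by ring
  have hk' : (α 0 * β 2 - α 2 * β 0) * (α 1 * β 3 - α 3 * β 1) =
      (α 0 * β 1 - α 1 * β 0) * (α 2 * β 3 - α 3 * β 2) +
      (α 0 * β 3 - α 3 * β 0) * (α 1 * β 2 - α 2 * β 1) := by ring
  have hD' : D = ((x 0 * z 1 - x 1 * z 0) * (x 2 * z 3 - x 3 * z 2)) *
      ((x 0 * z 3 - x 3 * z 0) * (x 1 * z 2 - x 2 * z 1)) *
      ((x 0 * z 2 - x 2 * z 0) * (x 1 * z 3 - x 3 * z 1)) := by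
    rw [hD]
    ring
  have ha : ((x 0 * z 1 - x 1 * z 0) * (x 2 * z 3 - x 3 * z 2)) * (e01 * e23) =
      ((α 0 * β 1 - α 1 * β 0) * (α 2 * β 3 - α 3 * β 2)) ^ 2 := by
    calc _ = ((x 0 * z 1 - x 1 * z 0) * e01) * ((x 2 * z 3 - x 3 * z 2) * e23) := by ring
      _ = _ := by rw [h01, h23]; ring
  have hb : ((x 0 * z 3 - x 3 * z 0) * (x 1 * z 2 - x 2 * z 1)) * (e03 * e12) =
      ((α 0 * β 3 - α 3 * β 0) * (α 1 * β 2 - α 2 * β 1)) ^ 2 := by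
    calc _ = ((x 0 * z 3 - x 3 * z 0) * e03) * ((x 1 * z 2 - x 2 * z 1) * e12) := by ring
      _ = _ := by rw [h03, h12]; ring
  have hc : ((x 0 * z 2 - x 2 * z 0) * (x 1 * z 3 - x 3 * z 1)) * (e02 * e13) =
      ((α 0 * β 2 - α 2 * β 0) * (α 1 * β 3 - α 3 * β 1)) ^ 2 := by
    calc _ = ((x 0 * z 2 - x 2 * z 0) * e02) * ((x 1 * z 3 - x 3 * z 1) * e13) := by ring
      _ = _ := by rw [h02, h13]; ring
  have hP' : pf d * D = e01 * e23 - e02 * e13 + e03 * e12 := hP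
  rw [ht, sq D, ← mul_assoc (pf d), hP', hD']
  clear_value D
  generalize (x 0 * z 1 - x 1 * z 0) * (x 2 * z 3 - x 3 * z 2) = a at *
  generalize (x 0 * z 3 - x 3 * z 0) * (x 1 * z 2 - x 2 * z 1) = b at *
  generalize (x 0 * z 2 - x 2 * z 0) * (x 1 * z 3 - x 3 * z 1) = c at *
  generalize (α 0 * β 1 - α 1 * β 0) * (α 2 * β 3 - α 3 * β 2) = u at *
  generalize (α 0 * β 3 - α 3 * β 0) * (α 1 * β 2 - α 2 * β 1) = v at *
  generalize (α 0 * β 2 - α 2 * β 0) * (α 1 * β 3 - α 3 * β 1) = w at *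
  subst hk hk'
  linear_combination (-b * (a + b)) * ha + a * b * hc - a * (a + b) * hb

/-! ### Doubling -/

lemma exists_sq_roots {a b c : ℂ} (h : b ^ 2 = a * c) :
    ∃ α β : ℂ, α ^ 2 = a ∧ α * β = b ∧ β ^ 2 = c := by
  obtain ⟨α, hα⟩ := IsAlgClosed.exists_pow_nat_eq a (n := 2) (by norm_num)
  by_cases ha : a = 0
  · obtain ⟨β, hβ⟩ := IsAlgClosed.exists_pow_nat_eq c (n := 2) (by norm_num)
    refine ⟨α, β, hα, ?_, hβ⟩
    rw [ha] at hα h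
    rw [pow_eq_zero_iff two_ne_zero] at hα
    rw [zero_mul, pow_eq_zero_iff two_ne_zero] at h
    rw [hα, h, zero_mul]
  · have hα0 : α ≠ 0 := by
      rintro rfl
      exact ha (by rw [← hα]; norm_num)
    refine ⟨α, b / α, hα, by field_simp, ?_⟩
    rw [div_pow, h, hα]
    field_simp

lemma exists_sign_of_mul_eq {n w : Fin 3 → ℂ} (h : ∀ i j, n i * n j = w i * w j) :
    ∃ σ : ℂ, σ ^ 2 = 1 ∧ w = σ • n := by
  by_cases hn : n = 0
  · refine ⟨1, one_pow 2, ?_⟩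
    ext i
    have := h i i
    simp only [hn, Pi.zero_apply, mul_zero] at this
    simpa [hn] using this.symm
  · obtain ⟨i, hi⟩ := Function.ne_iff.1 hn
    have hi' : n i ≠ 0 := hi
    refine ⟨w i / n i, ?_, ?_⟩
    · rw [div_pow, sq, ← h i i, ← sq, div_self (pow_ne_zero 2 hi')]
    · ext j
      have hw : w i ≠ 0 := by
        intro h0
        have := h i i
        rw [h0, mul_zero] at this
        exact hi' (mul_self_eq_zero.1 this)
      have h1 := h i j
      have h2 := h i i
      rw [Pi.smul_apply, smul_eq_mul]
      apply mul_left_cancel₀ hw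
      calc w i * w j = n i * n i / n i * n j := by rw [← h1]; field_simp
        _ = w i * (w i / n i * n j) := by rw [h2]; ring

/-- The contraction of two triples of coefficients. -/
def pairing (p q r : ℂ[X]) (A B C : ℂ[X]) (k : ℕ) : Fin 5 → ℂ :=
  (2 * q.coeff k) • qc B - p.coeff k • qc C - r.coeff k • qc A

/-- The first vector of cubic forms obtained by dividing a contraction by the diagonal. -/
def quotHigh (φ : ℕ → Fin 5 → ℂ) : Fin 4 → ℂ := fun m => φ 2 m.castSucc

/-- The second vector of cubic forms obtained by dividing a contraction by the diagonal. -/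
def quotLow (φ : ℕ → Fin 5 → ℂ) : Fin 4 → ℂ := fun m => -φ 0 m.succ

/-- The seven hypotheses say that the biform of degree `(2, 4)` vanishes on the diagonal; the
quotient by the equation of the diagonal can then be read off from its extreme coefficients. -/
lemma mulLin_quot {φ : ℕ → Fin 5 → ℂ} (h0 : φ 0 0 = 0) (h1 : φ 0 1 + φ 1 0 = 0)
    (h2 : φ 0 2 + φ 1 1 + φ 2 0 = 0) (h3 : φ 0 3 + φ 1 2 + φ 2 1 = 0)
    (h4 : φ 0 4 + φ 1 3 + φ 2 2 = 0) (h5 : φ 1 4 + φ 2 3 = 0) (h6 : φ 2 4 = 0) (x z : ℂ) :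
    mulLin x z (z • quotLow φ + x • quotHigh φ) =
      z ^ 2 • φ 0 + (x * z) • φ 1 + x ^ 2 • φ 2 := by
  ext i
  fin_cases i <;> simp [mulLin, quotLow, quotHigh]
  · linear_combination (-z ^ 2) * h0 - x * z * h1
  · linear_combination (-x * z) * h2
  · linear_combination (-x * z) * h3
  · linear_combination (-x * z) * h4
  · linear_combination (-x * z) * h5 - x ^ 2 * h6

/-- The syzygy is precisely the vanishing on the diagonal of the biform `2 q ⊗ B - p ⊗ C - r ⊗ A`.
-/
lemma mulLin_quot_pairing {p q r A B C : ℂ[X]} (hp : p.natDegree ≤ 2) (hq : q.natDegree ≤ 2)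
    (hr : r.natDegree ≤ 2) (hA : A.natDegree ≤ 4) (hB : B.natDegree ≤ 4) (hC : C.natDegree ≤ 4)
    (h : 2 * q * B - p * C - r * A = 0) (x z : ℂ) :
    mulLin x z (z • quotLow (pairing p q r A B C) + x • quotHigh (pairing p q r A B C)) =
      (2 * hev 2 q x z) • qc B - hev 2 p x z • qc C - hev 2 r x z • qc A := by
  have h2 {s : ℂ[X]} (hs : s.natDegree ≤ 2) (n : ℕ) (hn : 2 < n) : s.coeff n = 0 :=
    coeff_eq_zero_of_natDegree_lt (by omega)
  have h4 {s : ℂ[X]} (hs : s.natDegree ≤ 4) (n : ℕ) (hn : 4 < n) : s.coeff n = 0 :=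
    coeff_eq_zero_of_natDegree_lt (by omega)
  have hc (n : ℕ) : 2 * (q * B).coeff n - (p * C).coeff n - (r * A).coeff n = 0 := by
    have := congrArg (fun s : ℂ[X] => s.coeff n) h
    simpa [mul_assoc, coeff_ofNat_mul] using this
  rw [mulLin_quot]
  · simp only [hev, Finset.sum_range_succ, Finset.sum_range_zero, pairing]
    ext i
    simp
    ring
  all_goals
    simp only [pairing, qc, Pi.sub_apply, Pi.smul_apply, smul_eq_mul]
    norm_num
  · have := hc 0
    simp [mul_coeff_zero] at this
    linear_combination this
  · have := hc 1
    simp [coeff_mul, Finset.Nat.antidiagonal_succ] at this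
    linear_combination this
  · have := hc 2
    simp [coeff_mul, Finset.Nat.antidiagonal_succ] at this
    linear_combination this
  · have := hc 3
    simp [coeff_mul, Finset.Nat.antidiagonal_succ, h2 hp, h2 hq, h2 hr] at this
    linear_combination this
  · have := hc 4
    simp [coeff_mul, Finset.Nat.antidiagonal_succ, h2 hp, h2 hq, h2 hr] at this
    linear_combination this
  · have := hc 5
    simp [coeff_mul, Finset.Nat.antidiagonal_succ, h2 hp, h2 hq, h2 hr, h4 hA, h4 hB, h4 hC] at this
    linear_combination this
  · have := hc 6
    simp [coeff_mul, Finset.Nat.antidiagonal_succ, h2 hp, h2 hq, h2 hr, h4 hA, h4 hB, h4 hC] at this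
    linear_combination this

lemma hev_sub (n : ℕ) (p q : ℂ[X]) (x z : ℂ) : hev n (p - q) x z = hev n p x z - hev n q x z := by
  simp [hev, sub_mul, Finset.sum_sub_distrib]

lemma hev_two_mul (n : ℕ) (p : ℂ[X]) (x z : ℂ) : hev n (2 * p) x z = 2 * hev n p x z := by
  simp [hev, Finset.mul_sum, coeff_ofNat_mul, mul_assoc]

lemma hev_two_two {p q : ℂ[X]} (hp : p.natDegree ≤ 2) (hq : q.natDegree ≤ 2) (x z : ℂ) :
    hev 4 (p * q) x z = hev 2 p x z * hev 2 q x z := hev_mul hp hq x z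

/-- The alternating bilinear form of `ξ(A, B, C) - τ(T)` at two points. -/
lemma brk_mul_altMul {ℓ : Fin 8 → ℂ[X]} (hs : Split ℓ) {A B C : ℂ[X]}
    (hA : A.natDegree ≤ 4) (hB : B.natDegree ≤ 4) (hC : C.natDegree ≤ 4)
    (hf : B ^ 2 - A * C = ∏ i, ℓ i) {T : Finset (Fin 8)} (hT : T.card = 4) {i j : Fin 8}
    (hi : i ∈ T) (hj : j ∈ T) :
    brk ℓ i j * (altMul (kappa A B C - tau ℓ T) (rtE ℓ i) ⬝ᵥ rtE ℓ j) =
      2 * hev 4 B (rtX ℓ i) (rtZ ℓ i) * hev 4 B (rtX ℓ j) (rtZ ℓ j) -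
      hev 4 A (rtX ℓ i) (rtZ ℓ i) * hev 4 C (rtX ℓ j) (rtZ ℓ j) -
      hev 4 C (rtX ℓ i) (rtZ ℓ i) * hev 4 A (rtX ℓ j) (rtZ ℓ j) := by
  have h1 : mulLin (rtX ℓ i) (rtZ ℓ i) (altMul (kappa A B C - tau ℓ T) (rtE ℓ i)) =
      (2 * hev 4 B (rtX ℓ i) (rtZ ℓ i)) • qc B - hev 4 A (rtX ℓ i) (rtZ ℓ i) • qc C -
      hev 4 C (rtX ℓ i) (rtZ ℓ i) • qc A -
      ev4 (factorCoeff ℓ Tᶜ) (rtX ℓ i) (rtZ ℓ i) • factorCoeff ℓ T := by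
    rw [altMul_sub, mulLin_sub, rtE, mulLin_altMul_kappa hA hB hC hf, tau,
      mulLin_altMul_tauForm (isProd_factorCoeff hs.deg hT), ev4_factorCoeff_of_mem hs.deg hT hi]
    module
  rw [brk, rtE, rtE, ← ev4_mulLin, ← rtE, h1]
  have h2 (D : ℂ[X]) (x z : ℂ) : hev 4 D x z = ev4 (qc D) x z := (ev4_coeff D x z).symm
  have h3 := ev4_factorCoeff_of_mem hs.deg hT hj
  simp only [h2]
  simp only [ev4, Pi.sub_apply, Pi.smul_apply, smul_eq_mul] at h3 ⊢
  linear_combination (-(factorCoeff ℓ Tᶜ 0 * rtZ ℓ i ^ 4 + factorCoeff ℓ Tᶜ 1 * (rtX ℓ i * rtZ ℓ i ^ 3)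
    + factorCoeff ℓ Tᶜ 2 * (rtX ℓ i ^ 2 * rtZ ℓ i ^ 2) + factorCoeff ℓ Tᶜ 3 * (rtX ℓ i ^ 3 * rtZ ℓ i)
    + factorCoeff ℓ Tᶜ 4 * rtX ℓ i ^ 4)) * h3

/-- If `(A, B, C)` is the cross product of two triples of quadratic forms, then the squares of the
forms `y_T` at the corresponding point are the values of the forms dual to `τ(T)` at the point given
by the Gram matrix of the two triples. -/
theorem Split.exists_evVal_sq_eq {ℓ : Fin 8 → ℂ[X]} (hs : Split ℓ) {p q r p' q' r' A B C : ℂ[X]}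
    (hp : p.natDegree ≤ 2) (hq : q.natDegree ≤ 2) (hr : r.natDegree ≤ 2)
    (hp' : p'.natDegree ≤ 2) (hq' : q'.natDegree ≤ 2) (hr' : r'.natDegree ≤ 2)
    (hA : A = 2 * (p * q' - q * p')) (hB : B = p * r' - r * p') (hC : C = 2 * (q * r' - r * q'))
    (hf : B ^ 2 - A * C = ∏ i, ℓ i) :
    ∃ c : ℂ, ∃ A' B' C' : ℂ[X], A'.natDegree ≤ 4 ∧ B'.natDegree ≤ 4 ∧ C'.natDegree ≤ 4 ∧
      B' ^ 2 - A' * C' = ∏ i, ℓ i ∧ ∀ T ∈ evenPts, evVal ℓ T (kappa A B C) ^ 2 =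
        c * (matS.mulVec (tau ℓ T) ⬝ᵥ kappa A' B' C') := by
  have hd {s t : ℂ[X]} (hs : s.natDegree ≤ 2) (ht : t.natDegree ≤ 2) : (s * t).natDegree ≤ 4 :=
    natDegree_mul_le_of_le hs ht
  have hsub {s t : ℂ[X]} (hs : s.natDegree ≤ 4) (ht : t.natDegree ≤ 4) : (s - t).natDegree ≤ 4 :=
    natDegree_sub_le_of_le hs ht |>.trans (by simp)
  have htwo {s : ℂ[X]} (hs : s.natDegree ≤ 4) : (2 * s).natDegree ≤ 4 := by
    refine (natDegree_mul_le_of_le (natDegree_ofNat 2).le hs).trans ?_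
    simp
  have hA4 : A.natDegree ≤ 4 := hA ▸ htwo (hsub (hd hp hq') (hd hq hp'))
  have hB4 : B.natDegree ≤ 4 := hB ▸ hsub (hd hp hr') (hd hr hp')
  have hC4 : C.natDegree ≤ 4 := hC ▸ htwo (hsub (hd hq hr') (hd hr hq'))
  -- The Gram matrix of the two triples for the quadratic form `2 (q² - p r)`, whose determinant is
  -- matched below with that of the cross product.
  obtain ⟨A', hA'⟩ : ∃ A', A' = 2 * (q * q - p * r) := ⟨_, rfl⟩
  obtain ⟨B', hB'⟩ : ∃ B', B' = 2 * (q * q') - p * r' - r * p' := ⟨_, rfl⟩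
  obtain ⟨C', hC'⟩ : ∃ C', C' = 2 * (q' * q' - p' * r') := ⟨_, rfl⟩
  have hA4' : A'.natDegree ≤ 4 := hA' ▸ htwo (hsub (hd hq hq) (hd hp hr))
  have hB4' : B'.natDegree ≤ 4 := hB' ▸ hsub (hsub (htwo (hd hq hq')) (hd hp hr')) (hd hr hp')
  have hC4' : C'.natDegree ≤ 4 := hC' ▸ htwo (hsub (hd hq' hq') (hd hp' hr'))
  have hf' : B' ^ 2 - A' * C' = ∏ i, ℓ i := by
    rw [← hf, hA, hB, hC, hA', hB', hC']
    ring
  have hev8 (i : Fin 8) : hev 8 (∏ i, ℓ i) (rtX ℓ i) (rtZ ℓ i) = 0 := by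
    have := hev_factor hs.deg Finset.univ (rtX ℓ i) (rtZ ℓ i)
    rw [Finset.card_univ, Fintype.card_fin, factor] at this
    rw [this, Finset.prod_eq_zero (Finset.mem_univ i)]
    ring
  -- At a root of `f` the Gram matrix is degenerate, hence of the form `(α², αβ, β²)`.
  have hroot (i : Fin 8) : hev 4 B' (rtX ℓ i) (rtZ ℓ i) ^ 2 =
      hev 4 A' (rtX ℓ i) (rtZ ℓ i) * hev 4 C' (rtX ℓ i) (rtZ ℓ i) := by
    have h := hev8 i
    rw [← hf', hev_sub, sq, hev_mul (m := 4) (n := 4) hB4' hB4', hev_mul (m := 4) (n := 4) hA4' hC4'] at h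
    linear_combination h
  choose α β hα hαβ hβ using fun i => exists_sq_roots (hroot i)
  obtain ⟨w, hw⟩ := IsAlgClosed.exists_pow_nat_eq (2 : ℂ) (n := 2) (by norm_num)
  have hsyz : 2 * q * B - p * C - r * A = 0 := by rw [hA, hB, hC]; ring
  have hsyz' : 2 * q' * B - p' * C - r' * A = 0 := by rw [hA, hB, hC]; ring
  set φ := pairing p q r A B C with hφ
  set φ' := pairing p' q' r' A B C with hφ'
  set Z : Matrix (Fin 4) (Fin 4) ℂ := Matrix.of
    ![-(w • quotLow φ'), -(w • quotHigh φ'), w • quotLow φ, w • quotHigh φ] with hZ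
  -- At a root, `√2 (β (p, q, r) - α (p', q', r'))` and `(A, B, C)` have the same products of
  -- entries, so they agree up to a sign `σ`. Substituting this in the contraction and dividing by
  -- the diagonal presents `rootVec` as a pure tensor times the fixed matrix `Z`.
  have key (i : Fin 8) : ∃ σ : ℂ, σ ^ 2 = 1 ∧ rootVec ℓ (kappa A B C) i = σ •
      Matrix.vecMul ![α i * rtZ ℓ i, α i * rtX ℓ i, β i * rtZ ℓ i, β i * rtX ℓ i] Z := by
    have e1 := mulLin_quot_pairing hp hq hr hA4 hB4 hC4 hsyz (rtX ℓ i) (rtZ ℓ i)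
    have e2 := mulLin_quot_pairing hp' hq' hr' hA4 hB4 hC4 hsyz' (rtX ℓ i) (rtZ ℓ i)
    have e3 := hs.mulLin_rootVec hA4 hB4 hC4 hf i
    have eA := congrArg (fun s => hev 4 s (rtX ℓ i) (rtZ ℓ i)) hA
    have eB := congrArg (fun s => hev 4 s (rtX ℓ i) (rtZ ℓ i)) hB
    have eC := congrArg (fun s => hev 4 s (rtX ℓ i) (rtZ ℓ i)) hC
    beta_reduce at eA eB eC
    rw [hev_two_mul, hev_sub, hev_two_two hp hq', hev_two_two hq hp'] at eA
    rw [hev_sub, hev_two_two hp hr', hev_two_two hr hp'] at eB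
    rw [hev_two_mul, hev_sub, hev_two_two hq hr', hev_two_two hr hq'] at eC
    have eA' := hα i
    rw [hA', hev_two_mul, hev_sub, hev_two_two hq hq, hev_two_two hp hr] at eA'
    have eB' := hαβ i
    rw [hB', hev_sub, hev_sub, hev_two_mul, hev_two_two hq hq', hev_two_two hp hr',
      hev_two_two hr hp'] at eB'
    have eC' := hβ i
    rw [hC', hev_two_mul, hev_sub, hev_two_two hq' hq', hev_two_two hp' hr'] at eC'
    obtain ⟨σ, hσ, hn⟩ := exists_sign_of_mul_eq
      (n := w • ![β i * hev 2 p (rtX ℓ i) (rtZ ℓ i) - α i * hev 2 p' (rtX ℓ i) (rtZ ℓ i),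
        β i * hev 2 q (rtX ℓ i) (rtZ ℓ i) - α i * hev 2 q' (rtX ℓ i) (rtZ ℓ i),
        β i * hev 2 r (rtX ℓ i) (rtZ ℓ i) - α i * hev 2 r' (rtX ℓ i) (rtZ ℓ i)])
      (w := ![hev 4 A (rtX ℓ i) (rtZ ℓ i), hev 4 B (rtX ℓ i) (rtZ ℓ i),
        hev 4 C (rtX ℓ i) (rtZ ℓ i)]) (by
      have hpol (a a' b b' : ℂ) : w * (β i * a - α i * a') * (w * (β i * b - α i * b')) =
          2 * (β i ^ 2 * (a * b) - α i * β i * (a' * b + a * b') + α i ^ 2 * (a' * b')) := by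
        rw [← hw]
        ring
      have hrel : hev 4 B (rtX ℓ i) (rtZ ℓ i) ^ 2 =
          hev 4 A (rtX ℓ i) (rtZ ℓ i) * hev 4 C (rtX ℓ i) (rtZ ℓ i) := by
        have h := hev8 i
        rw [← hf, hev_sub, sq, hev_mul (m := 4) (n := 4) hB4 hB4,
          hev_mul (m := 4) (n := 4) hA4 hC4] at h
        linear_combination h
      rw [eA, eB, eC] at hrel
      rw [eA, eB, eC]
      intro a b
      fin_cases a <;> fin_cases b <;> simp [hpol, eA', eB', eC'] <;>
      first
        | ring1
        | linear_combination -hrel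
        | linear_combination 2 * hrel)
    refine ⟨σ, hσ, mulLin_injective (hs.rt_ne_zero i) ?_⟩
    have e4 : Matrix.vecMul ![α i * rtZ ℓ i, α i * rtX ℓ i, β i * rtZ ℓ i, β i * rtX ℓ i] Z =
        w • (β i • (rtZ ℓ i • quotLow φ + rtX ℓ i • quotHigh φ) -
          α i • (rtZ ℓ i • quotLow φ' + rtX ℓ i • quotHigh φ')) := by
      rw [hZ]
      ext k
      simp [Matrix.vecMul, dotProduct, Fin.sum_univ_four]
      ring
    have hn0 := congrFun hn 0
    have hn1 := congrFun hn 1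
    have hn2 := congrFun hn 2
    simp at hn0 hn1 hn2
    rw [e3, e4, mulLin_smul, mulLin_smul, mulLin_sub, mulLin_smul, mulLin_smul, e1, e2, hn0, hn1,
      hn2]
    module
  choose σ hσ hR using key
  -- The factor is independent of `T`, and squaring removes the signs `σ`.
  refine ⟨Z.det ^ 2, A', B', C', hA4', hB4', hC4', hf', fun T hT => ?_⟩
  have hT4 := card_of_mem_evenPts hT
  set s : Fin 4 → Fin 8 := fun i => T.orderEmbOfFin hT4 i with hs'
  have hsT (i : Fin 4) : s i ∈ T := T.orderEmbOfFin_mem hT4 i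
  have hV := hs.det_mon3_ne_zero (s := s) (T.orderEmbOfFin hT4).injective
  have h1 := hs.evVal_mul_det hT hsT (kappa_zero A B C) (kappa_pf A B C)
  have h2 : (Matrix.of fun i => rootVec ℓ (kappa A B C) (s i)).det ^ 2 = Z.det ^ 2 *
      (Matrix.of fun i => ![α (s i) * rtZ ℓ (s i), α (s i) * rtX ℓ (s i), β (s i) * rtZ ℓ (s i),
        β (s i) * rtX ℓ (s i)]).det ^ 2 := by
    set M : Matrix (Fin 4) (Fin 4) ℂ := Matrix.of fun i => ![α (s i) * rtZ ℓ (s i),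
      α (s i) * rtX ℓ (s i), β (s i) * rtZ ℓ (s i), β (s i) * rtX ℓ (s i)] with hM
    have h3 : (Matrix.of fun i => rootVec ℓ (kappa A B C) (s i)) =
        Matrix.of fun i j => σ (s i) * (M * Z) i j := by
      ext i j
      rw [Matrix.of_apply, hR]
      rfl
    rw [h3, Matrix.det_mul_column, Matrix.det_mul, mul_pow, ← Finset.prod_pow,
      Finset.prod_congr rfl fun i _ => hσ (s i), Finset.prod_const_one]
    ring
  have h3 := det_tensor_sq (x := fun i => rtX ℓ (s i)) (z := fun i => rtZ ℓ (s i))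
    (α := fun i => α (s i)) (β := fun i => β (s i)) (d := kappa A' B' C' - tau ℓ T) (fun i j => by
      have := brk_mul_altMul hs hA4' hB4' hC4' hf' hT4 (hsT i) (hsT j)
      rw [← hα, ← hαβ, ← hβ, ← hα, ← hαβ, ← hβ] at this
      refine this.trans ?_
      ring)
  rw [pf_sub (kappa_zero _ _ _) (kappa_pf _ _ _) (tau_zero ℓ T) (tauForm_pf _ _)] at h3
  apply mul_right_cancel₀ (pow_ne_zero 2 hV)
  rw [← mul_pow, h1, h2, h3]
  simp only [rtE]
  ring

/-! ### Functions on the fourth power of the curve -/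

/-- The quadruples of points on the curve `y² = f(x)`. -/
def onCurve (f : ℂ[X]) : Set (Fin 4 → ℂ × ℂ) := {P | ∀ i, (P i).2 ^ 2 = f.eval (P i).1}

/-- The product of the differences of the first coordinates. -/
def discFn (P : Fin 4 → ℂ × ℂ) : ℂ :=
  ∏ ij ∈ (Finset.univ : Finset (Fin 4)).offDiag, ((P ij.1).1 - (P ij.2).1)

/-- The polynomial functions of four points. -/
def polyFns : Subalgebra ℂ ((Fin 4 → ℂ × ℂ) → ℂ) :=
  Algebra.adjoin ℂ (Set.range (fun i P => (P i).1) ∪ Set.range (fun i P => (P i).2))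

/-- The functions of four points that are polynomials in the coordinates and the inverses of the
differences of the first coordinates. -/
def regFns : Subalgebra ℂ ((Fin 4 → ℂ × ℂ) → ℂ) :=
  Algebra.adjoin ℂ ((Set.range (fun i P => (P i).1) ∪ Set.range (fun i P => (P i).2)) ∪
    {u | ∃ i j, i ≠ j ∧ u = fun P => ((P i).1 - (P j).1)⁻¹})

lemma fst_mem_polyFns (i : Fin 4) : (fun P : Fin 4 → ℂ × ℂ => (P i).1) ∈ polyFns :=
  Algebra.subset_adjoin (Or.inl ⟨i, rfl⟩)

lemma fst_mem_regFns (i : Fin 4) : (fun P : Fin 4 → ℂ × ℂ => (P i).1) ∈ regFns :=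
  Algebra.subset_adjoin (Or.inl (Or.inl ⟨i, rfl⟩))

lemma snd_mem_regFns (i : Fin 4) : (fun P : Fin 4 → ℂ × ℂ => (P i).2) ∈ regFns :=
  Algebra.subset_adjoin (Or.inl (Or.inr ⟨i, rfl⟩))

lemma inv_mem_regFns {i j : Fin 4} (h : i ≠ j) :
    (fun P : Fin 4 → ℂ × ℂ => ((P i).1 - (P j).1)⁻¹) ∈ regFns :=
  Algebra.subset_adjoin (Or.inr ⟨i, j, h, rfl⟩)

lemma discFn_mem_polyFns : discFn ∈ polyFns := by
  have : discFn = ∏ ij ∈ (Finset.univ : Finset (Fin 4)).offDiag,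
      fun P : Fin 4 → ℂ × ℂ => (P ij.1).1 - (P ij.2).1 := by
    ext P
    rw [Finset.prod_apply, discFn]
  rw [this]
  exact Subalgebra.prod_mem _ fun ij _ => sub_mem (fst_mem_polyFns _) (fst_mem_polyFns _)

lemma discFn_ne_zero_iff {P : Fin 4 → ℂ × ℂ} :
    discFn P ≠ 0 ↔ ∀ i j, i ≠ j → (P i).1 ≠ (P j).1 := by
  rw [discFn, Finset.prod_ne_zero_iff]
  simp only [Finset.mem_offDiag, sub_ne_zero]
  exact ⟨fun h i j hij => h (i, j) (by simpa using hij), fun h ij hij => h _ _ hij.2.2⟩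

/-- Every regular function becomes polynomial after multiplication by a power of the
discriminant. -/
lemma exists_discFn_pow_mul {u : (Fin 4 → ℂ × ℂ) → ℂ} (hu : u ∈ regFns) :
    ∃ N : ℕ, ∃ p ∈ polyFns, ∀ P, discFn P ≠ 0 → discFn P ^ N * u P = p P := by
  induction hu using Algebra.adjoin_induction with
  | mem u hu =>
    rcases hu with hu | ⟨i, j, hij, rfl⟩
    · exact ⟨0, u, Algebra.subset_adjoin hu, by simp⟩
    · refine ⟨1, ∏ ij ∈ (Finset.univ : Finset (Fin 4)).offDiag.erase (i, j),
        fun P : Fin 4 → ℂ × ℂ => (P ij.1).1 - (P ij.2).1,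
        Subalgebra.prod_mem _ fun ij _ => sub_mem (fst_mem_polyFns _) (fst_mem_polyFns _),
        fun P hP => ?_⟩
      have h1 : (P i).1 - (P j).1 ≠ 0 := sub_ne_zero.2 (discFn_ne_zero_iff.1 hP i j hij)
      rw [pow_one, discFn, ← Finset.mul_prod_erase _ _ (a := (i, j)) (by simpa using hij),
        Finset.prod_apply]
      field_simp
  | algebraMap r => exact ⟨0, _, algebraMap_mem _ r, by simp⟩
  | add u w _ _ hu hw =>
    obtain ⟨M, p, hp, h⟩ := hu
    obtain ⟨N, q, hq, h'⟩ := hw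
    refine ⟨M + N, discFn ^ N * p + discFn ^ M * q, add_mem
      (mul_mem (pow_mem discFn_mem_polyFns _) hp) (mul_mem (pow_mem discFn_mem_polyFns _) hq),
      fun P hP => ?_⟩
    simp only [Pi.add_apply, Pi.mul_apply, Pi.pow_apply, ← h P hP, ← h' P hP]
    ring
  | mul u w _ _ hu hw =>
    obtain ⟨M, p, hp, h⟩ := hu
    obtain ⟨N, q, hq, h'⟩ := hw
    refine ⟨M + N, p * q, mul_mem hp hq, fun P hP => ?_⟩
    simp only [Pi.mul_apply, ← h P hP, ← h' P hP]
    ring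

/-- As a function of one of the points, a polynomial function is of the form `a(x) + b(x) y`. -/
lemma exists_eval_add_eval_mul (f : ℂ[X]) {u : (Fin 4 → ℂ × ℂ) → ℂ} (hu : u ∈ polyFns)
    (P : Fin 4 → ℂ × ℂ) (i : Fin 4) : ∃ a b : ℂ[X], ∀ x y, y ^ 2 = f.eval x →
      u (Function.update P i (x, y)) = a.eval x + b.eval x * y := by
  induction hu using Algebra.adjoin_induction with
  | mem u hu =>
    rcases hu with ⟨j, rfl⟩ | ⟨j, rfl⟩
    · by_cases h : j = i
      · subst h
        exact ⟨X, 0, fun x y _ => by simp⟩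
      · exact ⟨C (P j).1, 0, fun x y _ => by simp [h]⟩
    · by_cases h : j = i
      · subst h
        exact ⟨0, 1, fun x y _ => by simp⟩
      · exact ⟨C (P j).2, 0, fun x y _ => by simp [h]⟩
  | algebraMap r => exact ⟨C r, 0, fun x y _ => by simp⟩
  | add u w _ _ hu hw =>
    obtain ⟨a, b, h⟩ := hu
    obtain ⟨a', b', h'⟩ := hw
    refine ⟨a + a', b + b', fun x y hxy => ?_⟩
    rw [Pi.add_apply, h x y hxy, h' x y hxy, eval_add, eval_add]
    ring
  | mul u w _ _ hu hw =>
    obtain ⟨a, b, h⟩ := hu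
    obtain ⟨a', b', h'⟩ := hw
    refine ⟨a * a' + b * b' * f, a * b' + a' * b, fun x y hxy => ?_⟩
    rw [Pi.mul_apply, h x y hxy, h' x y hxy]
    simp only [eval_add, eval_mul, ← hxy]
    ring

lemma exists_rootMultiplicity_eq_one {f : ℂ[X]} (hf : Squarefree f) (hdeg : f.natDegree ≠ 0) :
    ∃ x, f.rootMultiplicity x = 1 := by
  obtain ⟨x, hx⟩ := IsAlgClosed.exists_root f (fun h => hdeg (natDegree_eq_of_degree_eq_some h))
  refine ⟨x, le_antisymm ?_ ((rootMultiplicity_pos hf.ne_zero).2 hx)⟩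
  exact rootMultiplicity_le_one_of_separable (PerfectField.separable_iff_squarefree.2 hf) x

/-- If `a² = b² f`, the multiplicity at a simple root of `f` is even on the left and odd on the
right. -/
lemma sq_sub_ne_zero {f : ℂ[X]} (hf : Squarefree f) (hdeg : f.natDegree ≠ 0) {a b : ℂ[X]}
    (hab : a ≠ 0 ∨ b ≠ 0) : a ^ 2 - b ^ 2 * f ≠ 0 := by
  intro h
  rw [sub_eq_zero] at h
  have hb : b ≠ 0 := by
    rintro rfl
    rcases hab with h' | h'
    · exact h' (by simpa using h)
    · exact h' rfl
  have ha : a ≠ 0 := by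
    rintro rfl
    have h0 : b ^ 2 * f ≠ 0 := mul_ne_zero (pow_ne_zero 2 hb) hf.ne_zero
    exact h0 (by rw [← h]; simp)
  obtain ⟨x, hx⟩ := exists_rootMultiplicity_eq_one hf hdeg
  have h1 := congrArg (rootMultiplicity x) h
  rw [rootMultiplicity_mul (mul_ne_zero (pow_ne_zero 2 hb) hf.ne_zero), sq, sq,
    rootMultiplicity_mul (mul_ne_zero ha ha), rootMultiplicity_mul (mul_ne_zero hb hb), hx] at h1
  omega

/-- As a function of one point `u` is `a(x) + b(x) y`, and `N` is its norm `a² - b² f`: where the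
norm is nonzero, so is `u`, for either choice of `y`. -/
lemma exists_ne_zero_of_apply_ne_zero {f : ℂ[X]} (hf : Squarefree f) (hdeg : f.natDegree ≠ 0)
    {u : (Fin 4 → ℂ × ℂ) → ℂ} (hu : u ∈ polyFns) {P : Fin 4 → ℂ × ℂ} (hP : P ∈ onCurve f)
    (huP : u P ≠ 0) (i : Fin 4) : ∃ N : ℂ[X], N ≠ 0 ∧ ∀ x y, y ^ 2 = f.eval x → N.eval x ≠ 0 →
      u (Function.update P i (x, y)) ≠ 0 := by
  obtain ⟨a, b, h⟩ := exists_eval_add_eval_mul f hu P i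
  refine ⟨a ^ 2 - b ^ 2 * f, sq_sub_ne_zero hf hdeg ?_, fun x y hxy hN h0 => hN ?_⟩
  · by_contra! h0
    apply huP
    have := h (P i).1 (P i).2 (hP i)
    simpa [h0] using this
  · rw [h x y hxy] at h0
    simp only [eval_sub, eval_mul, eval_pow, ← hxy]
    linear_combination (a.eval x - b.eval x * y) * h0

lemma update_mem_onCurve {f : ℂ[X]} {P : Fin 4 → ℂ × ℂ} (hP : P ∈ onCurve f) {x y : ℂ}
    (h : y ^ 2 = f.eval x) (i : Fin 4) : Function.update P i (x, y) ∈ onCurve f := by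
  intro j
  by_cases hj : j = i
  · subst hj
    simpa using h
  · simpa [hj] using hP j

/-- The polynomial functions on the fourth power of the curve form a domain. -/
lemma exists_common_ne_zero {f : ℂ[X]} (hf : Squarefree f) (hdeg : f.natDegree ≠ 0)
    {u w : (Fin 4 → ℂ × ℂ) → ℂ} (hu : u ∈ polyFns) (hw : w ∈ polyFns)
    (hu0 : ∃ P ∈ onCurve f, u P ≠ 0) (hw0 : ∃ P ∈ onCurve f, w P ≠ 0) :
    ∃ P ∈ onCurve f, u P ≠ 0 ∧ w P ≠ 0 := by
  -- The points of `P` and `Q` are replaced one index at a time by a common point of the curve that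
  -- avoids the zeros of both norms.
  have key (n : ℕ) (hn : n ≤ 4) : ∃ P ∈ onCurve f, ∃ Q ∈ onCurve f, u P ≠ 0 ∧ w Q ≠ 0 ∧
      ∀ i : Fin 4, i.val < n → P i = Q i := by
    induction n with
    | zero =>
      obtain ⟨P, hP, h⟩ := hu0
      obtain ⟨Q, hQ, h'⟩ := hw0
      exact ⟨P, hP, Q, hQ, h, h', by simp⟩
    | succ n ih =>
      obtain ⟨P, hP, Q, hQ, h, h', h''⟩ := ih (by omega)
      obtain ⟨M, hM, hM'⟩ := exists_ne_zero_of_apply_ne_zero hf hdeg hu hP h ⟨n, by omega⟩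
      obtain ⟨N, hN, hN'⟩ := exists_ne_zero_of_apply_ne_zero hf hdeg hw hQ h' ⟨n, by omega⟩
      obtain ⟨x, hx⟩ := Infinite.exists_notMem_finset (M * N).roots.toFinset
      rw [Multiset.mem_toFinset, mem_roots (mul_ne_zero hM hN), IsRoot.def, eval_mul,
        mul_eq_zero, not_or] at hx
      obtain ⟨y, hy⟩ := IsAlgClosed.exists_pow_nat_eq (f.eval x) (n := 2) (by norm_num)
      refine ⟨_, update_mem_onCurve hP hy ⟨n, by omega⟩, _, update_mem_onCurve hQ hy ⟨n, by omega⟩,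
        hM' x y hy hx.1, hN' x y hy hx.2, fun i hi => ?_⟩
      by_cases hin : i = ⟨n, by omega⟩
      · rw [hin, Function.update_self, Function.update_self]
      · rw [Function.update_of_ne hin, Function.update_of_ne hin]
        refine h'' i ?_
        have : i.val ≠ n := fun h => hin (Fin.ext h)
        omega
  obtain ⟨P, hP, Q, hQ, h, h', h''⟩ := key 4 le_rfl
  have : P = Q := funext fun i => h'' i i.2
  subst this
  exact ⟨P, hP, h, h'⟩

/-- A regular function that vanishes wherever another one does not vanish is zero, unless the second
one is zero. -/
lemma regFns_eq_zero {f : ℂ[X]} (hf : Squarefree f) (hdeg : f.natDegree ≠ 0)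
    {u g : (Fin 4 → ℂ × ℂ) → ℂ} (hu : u ∈ regFns) (hg : g ∈ regFns)
    (hg0 : ∃ P ∈ onCurve f, discFn P ≠ 0 ∧ g P ≠ 0)
    (h : ∀ P ∈ onCurve f, discFn P ≠ 0 → g P ≠ 0 → u P = 0) :
    ∀ P ∈ onCurve f, discFn P ≠ 0 → u P = 0 := by
  intro P hP hD
  by_contra hu0
  obtain ⟨M, p, hp, hup⟩ := exists_discFn_pow_mul hu
  obtain ⟨N, q, hq, hgq⟩ := exists_discFn_pow_mul hg
  obtain ⟨Q, hQ, hQD, hQg⟩ := hg0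
  -- The extra factor `discFn` forces the common point to have distinct abscissae, so that
  -- denominators can be restored there.
  have h1 : (discFn * p) P ≠ 0 := by
    rw [Pi.mul_apply, ← hup P hD]
    exact mul_ne_zero hD (mul_ne_zero (pow_ne_zero _ hD) hu0)
  have h2 : (discFn * q) Q ≠ 0 := by
    rw [Pi.mul_apply, ← hgq Q hQD]
    exact mul_ne_zero hQD (mul_ne_zero (pow_ne_zero _ hQD) hQg)
  obtain ⟨R, hR, h3, h4⟩ := exists_common_ne_zero hf hdeg (mul_mem discFn_mem_polyFns hp)
    (mul_mem discFn_mem_polyFns hq) ⟨P, hP, h1⟩ ⟨Q, hQ, h2⟩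
  rw [Pi.mul_apply] at h3 h4
  have hRD := left_ne_zero_of_mul h3
  rw [← hup R hRD] at h3
  rw [← hgq R hRD] at h4
  exact right_ne_zero_of_mul (right_ne_zero_of_mul h3)
    (h R hR hRD (right_ne_zero_of_mul (right_ne_zero_of_mul h4)))

/-! ### The triple of forms belonging to four points -/

/-- The quotient of a polynomial of degree at most eight by a monic polynomial of degree four, if
the remainder is zero. -/
def quartQuot (A U : ℂ[X]) : ℂ[X] :=
  let q4 := U.coeff 8
  let q3 := U.coeff 7 - A.coeff 3 * q4
  let q2 := U.coeff 6 - A.coeff 2 * q4 - A.coeff 3 * q3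
  let q1 := U.coeff 5 - A.coeff 1 * q4 - A.coeff 2 * q3 - A.coeff 3 * q2
  let q0 := U.coeff 4 - A.coeff 0 * q4 - A.coeff 1 * q3 - A.coeff 2 * q2 - A.coeff 3 * q1
  C q0 + C q1 * X + C q2 * X ^ 2 + C q3 * X ^ 3 + C q4 * X ^ 4

lemma quartQuot_natDegree_le (A U : ℂ[X]) : (quartQuot A U).natDegree ≤ 4 := by
  have h (a b c d e : ℂ) :
      (C a + C b * X + C c * X ^ 2 + C d * X ^ 3 + C e * X ^ 4).natDegree ≤ 4 := by compute_degree
  exact h _ _ _ _ _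

/-- Comparing coefficients in degrees 8 down to 4 determines the quotient. The closed formula shows
that its coefficients are polynomials in those of `A` and `U`, which later gives regularity. -/
lemma eq_mul_quartQuot {A U : ℂ[X]} (hA : A.Monic) (hA4 : A.natDegree = 4) (hU : U.natDegree ≤ 8)
    (h : A ∣ U) : U = A * quartQuot A U := by
  obtain ⟨Q, rfl⟩ := h
  have hQ : Q.natDegree ≤ 4 := by
    by_cases hQ0 : Q = 0
    · simp [hQ0]
    rw [hA.natDegree_mul' hQ0, hA4] at hU
    omega
  have h4 : A.coeff 4 = 1 := by rw [← hA4]; exact hA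
  obtain ⟨-, -, -, -, e4, e5, e6, e7, e8⟩ := isProd_coeff hA4.le hQ rfl
  have c4 : Q.coeff 4 = (A * Q).coeff 8 := by
    rw [e8]; simp [h4]
  have c3 : Q.coeff 3 = (A * Q).coeff 7 - A.coeff 3 * Q.coeff 4 := by
    rw [e7]; simp [h4]
  have c2 : Q.coeff 2 = (A * Q).coeff 6 - A.coeff 2 * Q.coeff 4 - A.coeff 3 * Q.coeff 3 := by
    rw [e6]; simp [h4]; ring
  have c1 : Q.coeff 1 = (A * Q).coeff 5 - A.coeff 1 * Q.coeff 4 - A.coeff 2 * Q.coeff 3 -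
      A.coeff 3 * Q.coeff 2 := by
    rw [e5]; simp [h4]; ring
  have c0 : Q.coeff 0 = (A * Q).coeff 4 - A.coeff 0 * Q.coeff 4 - A.coeff 1 * Q.coeff 3 -
      A.coeff 2 * Q.coeff 2 - A.coeff 3 * Q.coeff 1 := by
    rw [e4]; simp [h4]; ring
  congr 1
  conv_lhs => rw [as_sum_range_C_mul_X_pow' Q (n := 5) (by omega)]
  simp only [quartQuot, Finset.sum_range_succ, Finset.sum_range_zero, ← c4, ← c3, ← c2, ← c1, ← c0]
  simp

/-- The polynomial with the given roots. -/
def omA (P : Fin 4 → ℂ × ℂ) : ℂ[X] := ∏ i, (X - C (P i).1)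

/-- The interpolation polynomial. -/
def omB (P : Fin 4 → ℂ × ℂ) : ℂ[X] :=
  ∑ i, C ((P i).2 * ∏ j ∈ Finset.univ.erase i, ((P i).1 - (P j).1)⁻¹) *
    ∏ j ∈ Finset.univ.erase i, (X - C (P j).1)

/-- The third form belonging to four points. -/
def omC (f : ℂ[X]) (P : Fin 4 → ℂ × ℂ) : ℂ[X] := quartQuot (omA P) (omB P ^ 2 - f)

lemma omA_monic (P : Fin 4 → ℂ × ℂ) : (omA P).Monic := monic_prod_X_sub_C _ _

lemma omA_natDegree (P : Fin 4 → ℂ × ℂ) : (omA P).natDegree = 4 := by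
  rw [omA, natDegree_finsetProd_X_sub_C_eq_card]
  rfl

lemma omA_eval (P : Fin 4 → ℂ × ℂ) (i : Fin 4) : (omA P).eval (P i).1 = 0 := by
  rw [omA, eval_prod]
  exact Finset.prod_eq_zero (Finset.mem_univ i) (by simp)

lemma omB_natDegree_le (P : Fin 4 → ℂ × ℂ) : (omB P).natDegree ≤ 3 := by
  refine natDegree_sum_le_of_forall_le _ _ fun i _ => (natDegree_C_mul_le _ _).trans ?_
  rw [natDegree_finsetProd_X_sub_C_eq_card, Finset.card_erase_of_mem (Finset.mem_univ i)]
  simp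

lemma omB_eval {P : Fin 4 → ℂ × ℂ} (hP : discFn P ≠ 0) (i : Fin 4) :
    (omB P).eval (P i).1 = (P i).2 := by
  rw [omB, eval_finsetSum, Finset.sum_eq_single i]
  · simp only [eval_mul, eval_C, eval_prod, eval_sub, eval_X]
    rw [mul_assoc, ← Finset.prod_mul_distrib, Finset.prod_eq_one, mul_one]
    intro j hj
    exact inv_mul_cancel₀ (sub_ne_zero.2 (discFn_ne_zero_iff.1 hP i j (Finset.ne_of_mem_erase hj).symm))
  · intro j _ hj
    rw [eval_mul, eval_prod]
    exact mul_eq_zero_of_right _ (Finset.prod_eq_zero (i := i) (by simpa using hj.symm) (by simp))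
  · simp

lemma omB_sq_sub {f : ℂ[X]} (hf : f.natDegree ≤ 8) {P : Fin 4 → ℂ × ℂ} (hP : P ∈ onCurve f)
    (hD : discFn P ≠ 0) : omB P ^ 2 - f = omA P * omC f P := by
  refine eq_mul_quartQuot (omA_monic P) (omA_natDegree P) ?_ ?_
  · refine (natDegree_sub_le _ _).trans (max_le ?_ hf)
    exact (natDegree_pow_le_of_le 2 (omB_natDegree_le P)).trans (by norm_num)
  · refine Finset.prod_dvd_of_coprime (fun i _ j _ hij => ?_) fun i _ => ?_
    · exact isCoprime_X_sub_C_of_isUnit_sub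
        (sub_ne_zero.2 (discFn_ne_zero_iff.1 hD i j hij)).isUnit
    · rw [dvd_iff_isRoot, IsRoot.def, eval_sub, eval_pow, omB_eval hD, hP i, sub_self]

/-! ### Regularity of the coefficients -/

/-- A family of polynomials with regular coefficients. -/
def RegPoly (U : (Fin 4 → ℂ × ℂ) → ℂ[X]) : Prop := ∀ n, (fun P => (U P).coeff n) ∈ regFns

lemma regPoly_const (f : ℂ[X]) : RegPoly fun _ => f := fun n => algebraMap_mem regFns (f.coeff n)

lemma RegPoly.add {U V : (Fin 4 → ℂ × ℂ) → ℂ[X]} (hU : RegPoly U) (hV : RegPoly V) :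
    RegPoly fun P => U P + V P := fun n => by
  simp only [coeff_add]
  exact add_mem (hU n) (hV n)

lemma RegPoly.sub {U V : (Fin 4 → ℂ × ℂ) → ℂ[X]} (hU : RegPoly U) (hV : RegPoly V) :
    RegPoly fun P => U P - V P := fun n => by
  simp only [coeff_sub]
  exact sub_mem (hU n) (hV n)

lemma RegPoly.mul {U V : (Fin 4 → ℂ × ℂ) → ℂ[X]} (hU : RegPoly U) (hV : RegPoly V) :
    RegPoly fun P => U P * V P := fun n => by
  have : (fun P => (U P * V P).coeff n) = ∑ x ∈ Finset.HasAntidiagonal.antidiagonal n,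
      (fun P => (U P).coeff x.1) * fun P => (V P).coeff x.2 := by
    ext P
    simp [coeff_mul]
  rw [this]
  exact Subalgebra.sum_mem _ fun x _ => mul_mem (hU _) (hV _)

lemma regPoly_C {u : (Fin 4 → ℂ × ℂ) → ℂ} (hu : u ∈ regFns) : RegPoly fun P => C (u P) := fun n => by
  simp only [coeff_C]
  split_ifs
  · exact hu
  · exact zero_mem _

lemma RegPoly.sum {ι : Type*} {s : Finset ι} {U : ι → (Fin 4 → ℂ × ℂ) → ℂ[X]}
    (h : ∀ i ∈ s, RegPoly (U i)) : RegPoly fun P => ∑ i ∈ s, U i P := fun n => by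
  have : (fun P => (∑ i ∈ s, U i P).coeff n) = ∑ i ∈ s, fun P => (U i P).coeff n := by
    ext P
    simp
  rw [this]
  exact Subalgebra.sum_mem _ fun i hi => h i hi n

lemma RegPoly.prod {ι : Type*} {s : Finset ι} {U : ι → (Fin 4 → ℂ × ℂ) → ℂ[X]}
    (h : ∀ i ∈ s, RegPoly (U i)) : RegPoly fun P => ∏ i ∈ s, U i P := by
  classical
  induction s using Finset.induction_on with
  | empty => simpa using regPoly_const 1
  | insert a s ha ih =>
    simp only [Finset.prod_insert ha]
    exact (h a (Finset.mem_insert_self a s)).mul (ih fun i hi => h i (Finset.mem_insert_of_mem hi))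

lemma regPoly_X_sub (i : Fin 4) : RegPoly fun P => X - C (P i).1 :=
  (regPoly_const X).sub (regPoly_C (fst_mem_regFns i))

lemma regPoly_omA : RegPoly omA := RegPoly.prod fun i _ => regPoly_X_sub i

lemma regPoly_omB : RegPoly omB := by
  refine RegPoly.sum fun i _ => (regPoly_C ?_).mul (RegPoly.prod fun j _ => regPoly_X_sub j)
  refine mul_mem (snd_mem_regFns i) ?_
  have : (fun P : Fin 4 → ℂ × ℂ => ∏ j ∈ Finset.univ.erase i, ((P i).1 - (P j).1)⁻¹) =
      ∏ j ∈ Finset.univ.erase i, fun P : Fin 4 → ℂ × ℂ => ((P i).1 - (P j).1)⁻¹ := by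
    ext P
    simp
  exact this ▸ Subalgebra.prod_mem _ fun j hj => inv_mem_regFns (Finset.ne_of_mem_erase hj).symm

lemma RegPoly.quartQuot {A U : (Fin 4 → ℂ × ℂ) → ℂ[X]} (hA : RegPoly A) (hU : RegPoly U) :
    RegPoly fun P => quartQuot (A P) (U P) := by
  have q4 := hU 8
  have q3 := sub_mem (hU 7) (mul_mem (hA 3) q4)
  have q2 := sub_mem (sub_mem (hU 6) (mul_mem (hA 2) q4)) (mul_mem (hA 3) q3)
  have q1 := sub_mem (sub_mem (sub_mem (hU 5) (mul_mem (hA 1) q4)) (mul_mem (hA 2) q3))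
    (mul_mem (hA 3) q2)
  have q0 := sub_mem (sub_mem (sub_mem (sub_mem (hU 4) (mul_mem (hA 0) q4)) (mul_mem (hA 1) q3))
    (mul_mem (hA 2) q2)) (mul_mem (hA 3) q1)
  exact ((((regPoly_C q0).add ((regPoly_C q1).mul (regPoly_const X))).add
    ((regPoly_C q2).mul (regPoly_const (X ^ 2)))).add ((regPoly_C q3).mul (regPoly_const (X ^ 3)))).add
    ((regPoly_C q4).mul (regPoly_const (X ^ 4)))

lemma regPoly_omC (f : ℂ[X]) : RegPoly (omC f) := by
  have h : RegPoly fun P => omB P * omB P - f := (regPoly_omB.mul regPoly_omB).sub (regPoly_const f)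
  simp only [← sq] at h
  exact regPoly_omA.quartQuot h

lemma kappa_mem_regFns {A B C : (Fin 4 → ℂ × ℂ) → ℂ[X]} (hA : RegPoly A) (hB : RegPoly B)
    (hC : RegPoly C) (j : Fin 8) : (fun P => kappa (A P) (B P) (C P) j) ∈ regFns := by
  have he (i j : ℕ) : (fun P => eta (A P) (B P) (C P) i j) ∈ regFns :=
    sub_mem (sub_mem (mul_mem (mul_mem (algebraMap_mem regFns (2 : ℂ)) (hB i)) (hB j))
      (mul_mem (hA i) (hC j))) (mul_mem (hA j) (hC i))
  fin_cases j
  · exact one_mem regFns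
  · exact he 2 4
  · exact he 1 4
  · exact he 0 4
  · exact add_mem (he 0 4) (he 1 3)
  · exact he 0 3
  · exact he 0 2
  · exact add_mem (add_mem (sub_mem (mul_mem (he 0 2) (he 2 4)) (mul_mem (he 0 3) (he 1 4)))
      (pow_mem (he 0 4) 2)) (mul_mem (he 0 4) (he 1 3))

lemma eval_mem_regFns {k : (Fin 4 → ℂ × ℂ) → Fin 8 → ℂ} (hk : ∀ j, (fun P => k P j) ∈ regFns)
    (q : MvPolynomial (Fin 8) ℂ) : (fun P => MvPolynomial.eval (k P) q) ∈ regFns := by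
  induction q using MvPolynomial.induction_on with
  | C a =>
    simp only [MvPolynomial.eval_C]
    exact algebraMap_mem regFns a
  | add p q hp hq =>
    simp only [map_add]
    exact add_mem hp hq
  | mul_X p i hp =>
    simp only [map_mul, MvPolynomial.eval_X]
    exact mul_mem hp (hk i)

/-! ### Linear syzygies -/

/-- The matrix of the map that sends a triple of linear forms to its contraction with
`(A, B, C)`. -/
def syzMat (A B C : ℂ[X]) : Matrix (Fin 6) (Fin 6) ℂ :=
  Matrix.of fun n k => (![-C, -(X * C), 2 * B, 2 * (X * B), -A, -(X * A)] k).coeff n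

lemma RegPoly.det_syzMat {A B C : (Fin 4 → ℂ × ℂ) → ℂ[X]} (hA : RegPoly A) (hB : RegPoly B)
    (hC : RegPoly C) : (fun P => (syzMat (A P) (B P) (C P)).det) ∈ regFns := by
  have hneg {U : (Fin 4 → ℂ × ℂ) → ℂ[X]} (hU : RegPoly U) : RegPoly fun P => -U P := by
    simpa using (regPoly_const 0).sub hU
  have h (n k : Fin 6) : (fun P => syzMat (A P) (B P) (C P) n k) ∈ regFns := by
    fin_cases k
    · exact hneg hC n
    · exact hneg ((regPoly_const X).mul hC) n
    · exact (regPoly_const 2).mul hB n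
    · exact (regPoly_const 2).mul ((regPoly_const X).mul hB) n
    · exact hneg hA n
    · exact hneg ((regPoly_const X).mul hA) n
  have : (fun P => (syzMat (A P) (B P) (C P)).det) = ∑ σ : Equiv.Perm (Fin 6),
      Equiv.Perm.sign σ • ∏ i, fun P => syzMat (A P) (B P) (C P) (σ i) i := by
    ext P
    rw [Matrix.det_apply, Finset.sum_apply]
    simp [Finset.prod_apply]
  rw [this]
  exact Subalgebra.sum_mem _ fun σ _ => by
    rw [Units.smul_def]
    exact zsmul_mem (Subalgebra.prod_mem _ fun i _ => h _ _) _

lemma syzMat_mulVec (A B C : ℂ[X]) (t : Fin 6 → ℂ) (n : Fin 6) : (syzMat A B C).mulVec t n =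
    (2 * (Polynomial.C (t 2) + Polynomial.C (t 3) * X) * B -
      (Polynomial.C (t 0) + Polynomial.C (t 1) * X) * C -
      (Polynomial.C (t 4) + Polynomial.C (t 5) * X) * A).coeff n := by
  have : 2 * (Polynomial.C (t 2) + Polynomial.C (t 3) * X) * B -
      (Polynomial.C (t 0) + Polynomial.C (t 1) * X) * C -
      (Polynomial.C (t 4) + Polynomial.C (t 5) * X) * A =
      Polynomial.C (t 0) * (-C) + Polynomial.C (t 1) * (-(X * C)) + Polynomial.C (t 2) * (2 * B) +
      Polynomial.C (t 3) * (2 * (X * B)) + Polynomial.C (t 4) * (-A) +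
      Polynomial.C (t 5) * (-(X * A)) := by ring
  rw [this]
  simp only [coeff_add, coeff_C_mul]
  simp only [syzMat, Matrix.mulVec, dotProduct, Fin.sum_univ_six, Matrix.of_apply]
  simp [mul_comm]

lemma natDegree_C_add_C_mul_X_le (a b : ℂ) : (C a + C b * X).natDegree ≤ 1 := by compute_degree

/-- Triples of linear polynomials and polynomials of degree at most 5 both form spaces of dimension
6, so without linear syzygies the contraction is surjective. -/
lemma exists_contraction_eq {A B C : ℂ[X]} (h : (syzMat A B C).det ≠ 0) (hA : A.natDegree ≤ 4)
    (hB : B.natDegree ≤ 4) (hC : C.natDegree ≤ 4) {g : ℂ[X]} (hg : g.natDegree ≤ 5) :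
    ∃ p q r : ℂ[X], p.natDegree ≤ 1 ∧ q.natDegree ≤ 1 ∧ r.natDegree ≤ 1 ∧
      2 * q * B - p * C - r * A = g := by
  obtain ⟨t, ht⟩ := (Matrix.mulVec_surjective_iff_isUnit.2
    ((Matrix.isUnit_iff_isUnit_det _).2 h.isUnit)) fun n => g.coeff n
  refine ⟨_, _, _, natDegree_C_add_C_mul_X_le (t 0) (t 1), natDegree_C_add_C_mul_X_le (t 2) (t 3),
    natDegree_C_add_C_mul_X_le (t 4) (t 5), ?_⟩
  ext n
  by_cases hn : n < 6
  · have := congrFun ht ⟨n, hn⟩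
    rwa [syzMat_mulVec] at this
  · rw [coeff_eq_zero_of_natDegree_lt (by omega : g.natDegree < n)]
    refine coeff_eq_zero_of_natDegree_lt (lt_of_le_of_lt ?_ (by omega : 5 < n))
    have hm {u v : ℂ[X]} (hu : u.natDegree ≤ 1) (hv : v.natDegree ≤ 4) : (u * v).natDegree ≤ 5 :=
      natDegree_mul_le_of_le hu hv
    refine (natDegree_sub_le _ _).trans (max_le ((natDegree_sub_le _ _).trans (max_le ?_ ?_)) ?_)
    · rw [mul_assoc]
      refine natDegree_mul_le_of_le (natDegree_ofNat 2).le (hm (natDegree_C_add_C_mul_X_le _ _) hB)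
    · exact hm (natDegree_C_add_C_mul_X_le _ _) hC
    · exact hm (natDegree_C_add_C_mul_X_le _ _) hA

/-! ### Every point outside the theta divisor is given by four points on the curve -/

lemma kappa_eq_of_eta {A B D A' B' D' : ℂ[X]} (h : ∀ i j, eta A B D i j = eta A' B' D' i j) :
    kappa A B D = kappa A' B' D' := by
  simp only [kappa, h]

/-- The coefficients `η_ij` polarise `B² - A C`, so `κ` is unchanged by isometries of this ternary
form; this and the two following lemmas treat the isometries needed. -/
lemma kappa_translate (A B D : ℂ[X]) (t : ℂ) :
    kappa (A + C (2 * t) * B + C (t ^ 2) * D) (B + C t * D) D = kappa A B D := by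
  refine kappa_eq_of_eta fun i j => ?_
  simp only [eta, coeff_add, coeff_C_mul]
  ring

lemma kappa_translate' (A B D : ℂ[X]) (s : ℂ) :
    kappa A (B + C s * A) (D + C (2 * s) * B + C (s ^ 2) * A) = kappa A B D := by
  refine kappa_eq_of_eta fun i j => ?_
  simp only [eta, coeff_add, coeff_C_mul]
  ring

lemma kappa_scale (A B D : ℂ[X]) {c : ℂ} (hc : c ≠ 0) :
    kappa (C c⁻¹ * A) B (C c * D) = kappa A B D := by
  refine kappa_eq_of_eta fun i j => ?_
  simp only [eta, coeff_C_mul]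
  field_simp

/-- The resultant of two quadratic polynomials in `t`. -/
lemma resultant_eq_zero_of_common_root {a b c a' b' c' t : ℂ} (h : a + 2 * t * b + t ^ 2 * c = 0)
    (h' : a' + 2 * t * b' + t ^ 2 * c' = 0) :
    (a * c' - a' * c) ^ 2 - 4 * (a * b' - a' * b) * (b * c' - b' * c) = 0 := by
  have h1 : a * c' - a' * c = -(2 * (b * c' - b' * c) * t) := by
    linear_combination c' * h - c * h'
  have h2 : a * b' - a' * b = (b * c' - b' * c) * t ^ 2 := by
    linear_combination b' * h - b * h'
  rw [h1, h2]
  ring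

lemma eval_ne_zero_of_squarefree {f A B D : ℂ[X]} (hf : Squarefree f) (h : B ^ 2 - A * D = f)
    (x : ℂ) : ¬(A.eval x = 0 ∧ B.eval x = 0 ∧ D.eval x = 0) := by
  rintro ⟨hA, hB, hD⟩
  obtain ⟨a, rfl⟩ := dvd_iff_isRoot.2 hA
  obtain ⟨b, rfl⟩ := dvd_iff_isRoot.2 hB
  obtain ⟨d, rfl⟩ := dvd_iff_isRoot.2 hD
  refine not_isUnit_X_sub_C x (hf (X - C x) ⟨b ^ 2 - a * d, ?_⟩)
  rw [← h]
  ring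

lemma quadratic_ne_zero {a b c : ℂ} (h : ¬(a = 0 ∧ b = 0 ∧ c = 0)) :
    C a + C (2 * b) * X + C c * X ^ 2 ≠ 0 := by
  intro h0
  have h1 (n : ℕ) := congrArg (fun p : ℂ[X] => p.coeff n) h0
  refine h ⟨?_, ?_, ?_⟩
  · simpa [coeff_X, coeff_C, -map_mul] using h1 0
  · have := h1 1
    simp only [coeff_add, coeff_C_mul, coeff_X_pow, coeff_X, coeff_C, coeff_zero] at this
    simpa using this
  · have := h1 2
    simp only [coeff_add, coeff_C_mul, coeff_X_pow, coeff_X, coeff_C, coeff_zero] at this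
    simpa using this

/-- Only finitely many `t` are bad. The leading coefficient is a nonzero polynomial in `t` because
`deg f ≥ 7`. A multiple root `x` makes the translate and its derivative have a common zero in `t`,
so it is a root of their resultant `ρ`, and each such `x` excludes at most two values of `t`. -/
lemma exists_translate {f A B D : ℂ[X]} (hf : Squarefree f) (hdeg : 7 ≤ f.natDegree)
    (hA : A.natDegree ≤ 4) (hB : B.natDegree ≤ 4) (hD : D.natDegree ≤ 4)
    (h : B ^ 2 - A * D = f) : ∃ t : ℂ, (A + C (2 * t) * B + C (t ^ 2) * D).coeff 4 ≠ 0 ∧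
      ∀ x, ¬((A + C (2 * t) * B + C (t ^ 2) * D).eval x = 0 ∧
        (derivative (A + C (2 * t) * B + C (t ^ 2) * D)).eval x = 0) := by
  set A' := derivative A
  set B' := derivative B
  set D' := derivative D
  set ρ := (A * D' - A' * D) ^ 2 - 4 * (A * B' - A' * B) * (B * D' - B' * D) with hρ
  have hρ0 : ρ ≠ 0 := by
    intro h0
    -- The identity `f'² = ρ + 4 f (B'² - A' D')` shows that `ρ = 0` would make `f` divide `f'²`,
    -- against separability.
    have h1 : derivative f ^ 2 = f * (4 * (B' ^ 2 - A' * D')) := by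
      have h2 : derivative f = 2 * B * B' - A' * D - A * D' := by
        rw [← h]
        rw [sq]
        simp only [derivative_sub, derivative_mul, A', B', D']
        ring
      have h3 : derivative f ^ 2 = ρ + f * (4 * (B' ^ 2 - A' * D')) := by
        rw [h2, hρ, ← h]
        ring
      rw [h3, h0, zero_add]
    have h4 : IsCoprime f (derivative f ^ 2) :=
      (PerfectField.separable_iff_squarefree.2 hf : f.Separable).pow_right
    have h5 : IsUnit f := h4.isUnit_of_dvd' dvd_rfl ⟨_, h1⟩
    have := natDegree_eq_zero_of_isUnit h5
    omega
  have hlead : ¬(A.coeff 4 = 0 ∧ B.coeff 4 = 0 ∧ D.coeff 4 = 0) := by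
    rintro ⟨hA4, hB4, hD4⟩
    have h3 {p : ℂ[X]} (hp : p.natDegree ≤ 4) (h4 : p.coeff 4 = 0) : p.natDegree ≤ 3 := by
      by_contra hlt
      have h5 : p.natDegree = 4 := by omega
      rw [← h5, coeff_natDegree, leadingCoeff_eq_zero] at h4
      rw [h4] at h5
      simp at h5
    have h6 : f.natDegree ≤ 6 := by
      rw [← h]
      exact (natDegree_sub_le _ _).trans (max_le (natDegree_pow_le_of_le 2 (h3 hB hB4))
        (natDegree_mul_le_of_le (h3 hA hA4) (h3 hD hD4)))
    omega
  set bad : ℂ[X] := (C (A.coeff 4) + C (2 * B.coeff 4) * X + C (D.coeff 4) * X ^ 2) *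
    ∏ x ∈ ρ.roots.toFinset, (C (A.eval x) + C (2 * B.eval x) * X + C (D.eval x) * X ^ 2) with hbad
  have hbad0 : bad ≠ 0 := mul_ne_zero (quadratic_ne_zero hlead)
    (Finset.prod_ne_zero_iff.2 fun x _ => quadratic_ne_zero (eval_ne_zero_of_squarefree hf h x))
  obtain ⟨t, ht⟩ := Infinite.exists_notMem_finset bad.roots.toFinset
  rw [Multiset.mem_toFinset, mem_roots hbad0, IsRoot.def, hbad, eval_mul, mul_eq_zero, not_or,
    eval_prod, Finset.prod_eq_zero_iff] at ht
  refine ⟨t, ?_, fun x hx => ht.2 ⟨x, ?_, ?_⟩⟩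
  · intro h0
    apply ht.1
    simp only [coeff_add, coeff_C_mul] at h0
    simp only [eval_add, eval_mul, eval_C, eval_X, eval_pow]
    linear_combination h0
  · rw [Multiset.mem_toFinset, mem_roots hρ0, IsRoot.def, hρ]
    simp only [eval_sub, eval_mul, eval_pow, eval_ofNat]
    have h1 := hx.1
    have h2 := hx.2
    simp only [derivative_add, derivative_C_mul, eval_add, eval_mul, eval_C] at h1 h2
    exact resultant_eq_zero_of_common_root (t := t) (by linear_combination h1)
      (by linear_combination h2)
  · have h1 := hx.1
    simp only [eval_add, eval_mul, eval_C, eval_X, eval_pow] at h1 ⊢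
    linear_combination h1

lemma exists_eq_prod_X_sub_C {A : ℂ[X]} (hA : A.Monic) (hA4 : A.natDegree = 4)
    (h : ∀ x, ¬(A.eval x = 0 ∧ (derivative A).eval x = 0)) :
    ∃ x : Fin 4 → ℂ, Function.Injective x ∧ A = ∏ i, (X - C (x i)) := by
  have hnd : A.roots.Nodup := by
    rw [Multiset.nodup_iff_count_le_one]
    intro x
    rw [count_roots]
    by_contra! hlt
    exact h x ((one_lt_rootMultiplicity_iff_isRoot hA.ne_zero).1 hlt)
  have hcard : A.roots.toFinset.card = 4 := by
    rw [Multiset.toFinset_card_of_nodup hnd, ← hA4]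
    exact (IsAlgClosed.splits A).natDegree_eq_card_roots.symm
  set e := A.roots.toFinset.equivFinOfCardEq hcard
  refine ⟨fun i => (e.symm i : ℂ), fun i j hij => e.symm.injective (Subtype.ext hij), ?_⟩
  have h1 : A = (A.roots.map fun a => X - C a).prod := by
    have := (IsAlgClosed.splits A).eq_prod_roots
    rwa [hA.leadingCoeff, map_one, one_mul] at this
  rw [Equiv.prod_comp e.symm (fun a : A.roots.toFinset => X - C (a : ℂ)),
    Finset.prod_coe_sort A.roots.toFinset fun a => X - C a]
  conv_lhs => rw [h1]
  rw [Finset.prod_multiset_map_count]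
  refine Finset.prod_congr rfl fun a ha => ?_
  rw [Multiset.count_eq_one_of_mem hnd (Multiset.mem_toFinset.1 ha), pow_one]

/-- Isometries of `B² - A C` make `A` monic of degree 4 with simple roots and reduce `B` to degree
at most 3. Then `B` is the polynomial interpolating its values at the roots of `A`, and the third
form is determined by division. -/
lemma exists_kappa_eq {f A B D : ℂ[X]} (hf : Squarefree f) (hdeg : 7 ≤ f.natDegree)
    (hdeg' : f.natDegree ≤ 8) (hA : A.natDegree ≤ 4) (hB : B.natDegree ≤ 4) (hD : D.natDegree ≤ 4)
    (h : B ^ 2 - A * D = f) : ∃ P ∈ onCurve f, discFn P ≠ 0 ∧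
      kappa A B D = kappa (omA P) (omB P) (omC f P) := by
  obtain ⟨t, ht4, htx⟩ := exists_translate hf hdeg hA hB hD h
  rw [← kappa_translate A B D t]
  set A₁ := A + C (2 * t) * B + C (t ^ 2) * D with hA₁
  set B₁ := B + C t * D with hB₁
  have hd {p q : ℂ[X]} {c : ℂ} (hp : p.natDegree ≤ 4) (hq : q.natDegree ≤ 4) :
      (p + C c * q).natDegree ≤ 4 :=
    (natDegree_add_le _ _).trans (max_le hp ((natDegree_C_mul_le _ _).trans hq))
  have hA₁4 : A₁.natDegree = 4 := le_antisymm (hd (hd hA hB) hD) (le_natDegree_of_ne_zero ht4)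
  have hB₁4 : B₁.natDegree ≤ 4 := hd hB hD
  have h₁ : B₁ ^ 2 - A₁ * D = f := by
    rw [← h, hA₁, hB₁]
    simp only [map_mul, map_pow, map_ofNat]
    ring
  rw [← kappa_scale A₁ B₁ D ht4]
  set c := A₁.coeff 4 with hc
  have hlc : A₁.leadingCoeff = c := by rw [hc, ← hA₁4]; rfl
  set A₂ := C c⁻¹ * A₁ with hA₂
  have hA₂m : A₂.Monic := by
    rw [Monic, hA₂, leadingCoeff_C_mul_of_isUnit (inv_ne_zero ht4).isUnit, hlc, inv_mul_cancel₀ ht4]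
  have hA₂4 : A₂.natDegree = 4 := by
    rw [hA₂, natDegree_C_mul (inv_ne_zero ht4), hA₁4]
  have h₂ : B₁ ^ 2 - A₂ * (C c * D) = f := by
    rw [← h₁, hA₂]
    have : C c⁻¹ * C c = (1 : ℂ[X]) := by rw [← C_mul, inv_mul_cancel₀ ht4, C_1]
    linear_combination (-A₁ * D) * this
  obtain ⟨x, hx, hAx⟩ := exists_eq_prod_X_sub_C hA₂m hA₂4 (fun x hx => htx x (by
    rw [hA₂, derivative_C_mul, eval_mul, eval_mul, eval_C] at hx
    simpa [ht4] using hx))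
  rw [← kappa_translate' A₂ B₁ _ (-B₁.coeff 4)]
  set s := -B₁.coeff 4 with hs
  set B₂ := B₁ + C s * A₂ with hB₂
  set D₂ := C c * D + C (2 * s) * B₁ + C (s ^ 2) * A₂ with hD₂
  have h₃ : B₂ ^ 2 - A₂ * D₂ = f := by
    rw [← h₂, hB₂, hD₂]
    simp only [map_mul, map_pow, map_ofNat]
    ring
  set P : Fin 4 → ℂ × ℂ := fun i => (x i, B₁.eval (x i)) with hP
  have hroot (i : Fin 4) : A₂.eval (x i) = 0 := by
    rw [hAx, eval_prod]
    exact Finset.prod_eq_zero (Finset.mem_univ i) (by simp)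
  have hPc : P ∈ onCurve f := by
    intro i
    rw [← h₂]
    simp [hP, hroot]
  have hPD : discFn P ≠ 0 := discFn_ne_zero_iff.2 fun i j hij => hx.ne hij
  have hPA : omA P = A₂ := hAx.symm
  have hB₂3 : B₂.natDegree < 4 := by
    have h4 : B₂.coeff 4 = 0 := by
      have : A₂.coeff 4 = 1 := by rw [← hA₂4]; exact hA₂m
      rw [hB₂, coeff_add, coeff_C_mul, this, hs]
      ring
    have h5 : B₂.natDegree ≤ 4 := hd hB₁4 hA₂4.le
    by_contra hlt
    have h6 : B₂.natDegree = 4 := by omega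
    rw [← h6, coeff_natDegree, leadingCoeff_eq_zero] at h4
    rw [h4] at h6
    simp at h6
  have hPB : omB P = B₂ := by
    refine eq_of_natDegree_lt_card_of_eval_eq _ _ hx (fun i => ?_) ?_
    · have h5 := omB_eval hPD i
      simp only [hP] at h5
      have h6 : B₂.eval (x i) = B₁.eval (x i) + s * A₂.eval (x i) := by simp [B₂]
      rw [h5, h6, hroot, mul_zero, add_zero]
    · rw [Fintype.card_fin]
      exact max_lt ((omB_natDegree_le P).trans_lt (by norm_num)) hB₂3
  have hPD₂ : omC f P = D₂ := by
    have h5 := omB_sq_sub hdeg' hPc hPD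
    rw [hPA, hPB] at h5
    apply mul_left_cancel₀ hA₂m.ne_zero
    rw [← h5, ← h₃]
    ring
  exact ⟨P, hPc, hPD, by rw [hPA, hPB, hPD₂]⟩

/-! ### Triples of forms without linear syzygies -/

lemma eq_zero_of_two_roots {p : ℂ[X]} (hp : p.natDegree ≤ 1) {x x' : ℂ} (hne : x ≠ x')
    (hx : p.eval x = 0) (hx' : p.eval x' = 0) : p = 0 := by
  refine eq_zero_of_natDegree_lt_card_of_eval_eq_zero' p {x, x'} (fun i hi => ?_) ?_
  · rcases Finset.mem_insert.1 hi with rfl | hi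
    · exact hx
    · rw [Finset.mem_singleton.1 hi]; exact hx'
  · rw [Finset.card_pair hne]
    omega

lemma dvd_of_eval_eq_zero {p : ℂ[X]} {x : ℂ} (h : p.eval x = 0) : (X - C x) ∣ p :=
  dvd_iff_isRoot.2 h

/-- There are four points on the curve such that the corresponding triple of forms has no linear
syzygy. -/
lemma exists_det_syzMat_ne_zero {f : ℂ[X]} (hf : Squarefree f) (hdeg : 7 ≤ f.natDegree)
    (hdeg' : f.natDegree ≤ 8) : ∃ P ∈ onCurve f, discFn P ≠ 0 ∧
      (syzMat (omA P) (omB P) (omC f P)).det ≠ 0 := by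
  have hsep : f.Separable := PerfectField.separable_iff_squarefree.2 hf
  have hcard : 7 ≤ f.roots.toFinset.card := by
    rw [Multiset.toFinset_card_of_nodup (nodup_roots hsep),
      ← (IsAlgClosed.splits f).natDegree_eq_card_roots]
    exact hdeg
  -- Two of the four points are ramification points and two are not; each pair kills one linear
  -- component of a syzygy.
  obtain ⟨x₀, hx₀, x₁, hx₁, h01⟩ := Finset.one_lt_card.1 (by omega : 1 < f.roots.toFinset.card)
  obtain ⟨x₂, hx₂⟩ := Infinite.exists_notMem_finset f.roots.toFinset
  obtain ⟨x₃, hx₃⟩ := Infinite.exists_notMem_finset (insert x₂ f.roots.toFinset)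
  rw [Finset.mem_insert, not_or] at hx₃
  obtain ⟨y₂, hy₂⟩ := IsAlgClosed.exists_pow_nat_eq (f.eval x₂) (n := 2) (by norm_num)
  obtain ⟨y₃, hy₃⟩ := IsAlgClosed.exists_pow_nat_eq (f.eval x₃) (n := 2) (by norm_num)
  have hroot (x : ℂ) : x ∈ f.roots.toFinset ↔ f.eval x = 0 := by
    rw [Multiset.mem_toFinset, mem_roots hf.ne_zero, IsRoot.def]
  set P : Fin 4 → ℂ × ℂ := ![(x₀, 0), (x₁, 0), (x₂, y₂), (x₃, y₃)] with hP
  have hPc : P ∈ onCurve f := by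
    intro i
    fin_cases i
    · simp [hP, (hroot x₀).1 hx₀]
    · simp [hP, (hroot x₁).1 hx₁]
    · simpa [hP] using hy₂
    · simpa [hP] using hy₃
  have hne {a b : ℂ} (ha : a ∈ f.roots.toFinset) (hb : b ∉ f.roots.toFinset) : a ≠ b :=
    fun h => hb (h ▸ ha)
  have hPD : discFn P ≠ 0 := by
    have h02 := hne hx₀ hx₂
    have h03 := hne hx₀ hx₃.2
    have h12 := hne hx₁ hx₂
    have h13 := hne hx₁ hx₃.2
    have h23 : x₂ ≠ x₃ := fun h => hx₃.1 h.symm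
    refine discFn_ne_zero_iff.2 fun i j hij => ?_
    fin_cases i <;> fin_cases j <;> first | exact absurd rfl hij | skip
    · exact h01
    · exact h02
    · exact h03
    · exact h01.symm
    · exact h12
    · exact h13
    · exact h02.symm
    · exact h12.symm
    · exact h23
    · exact h03.symm
    · exact h13.symm
    · exact h23.symm
  refine ⟨P, hPc, hPD, fun hdet => ?_⟩
  obtain ⟨t, ht0, ht⟩ := Matrix.exists_mulVec_eq_zero_iff.2 hdet
  have hAB := omB_sq_sub hdeg' hPc hPD
  have hAev := omA_eval P
  have hBev := omB_eval hPD
  have hAm := omA_monic P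
  have hA4 := omA_natDegree P
  have hB3 := omB_natDegree_le P
  have hC4 : (omC f P).natDegree ≤ 4 := quartQuot_natDegree_le _ _
  have hlin (n : ℕ) := syzMat_mulVec (omA P) (omB P) (omC f P) t
  set A := omA P
  set B := omB P
  set D := omC f P
  set u := C (t 0) + C (t 1) * X with hu
  set v := C (t 2) + C (t 3) * X with hv
  set w := C (t 4) + C (t 5) * X with hw
  have hu1 : u.natDegree ≤ 1 := natDegree_C_add_C_mul_X_le _ _
  have hv1 : v.natDegree ≤ 1 := natDegree_C_add_C_mul_X_le _ _
  have hw1 : w.natDegree ≤ 1 := natDegree_C_add_C_mul_X_le _ _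
  have hrel : 2 * v * B - u * D - w * A = 0 := by
    ext n
    by_cases hn : n < 6
    · have h1 := syzMat_mulVec A B D t ⟨n, hn⟩
      rw [ht] at h1
      rw [coeff_zero]
      exact h1.symm
    · rw [coeff_zero]
      refine coeff_eq_zero_of_natDegree_lt (lt_of_le_of_lt ?_ (by omega : 5 < n))
      refine (natDegree_sub_le _ _).trans (max_le ((natDegree_sub_le _ _).trans (max_le ?_ ?_)) ?_)
      · rw [mul_assoc]
        exact natDegree_mul_le_of_le (natDegree_ofNat 2).le
          (natDegree_mul_le_of_le hv1 (hB3.trans (by norm_num : 3 ≤ 4)))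
      · exact natDegree_mul_le_of_le hu1 hC4
      · exact natDegree_mul_le_of_le hw1 hA4.le
  have hrel2 : u * f = u * B ^ 2 - 2 * v * A * B + w * A ^ 2 := by
    linear_combination A * hrel - u * hAB
  -- At a ramification point `A` and `B` both vanish, so the right side of `hrel2` vanishes doubly
  -- while `f` has a simple zero.
  have huroot (i : Fin 4) (hi : (P i).2 = 0) : u.eval (P i).1 = 0 := by
    obtain ⟨a, ha⟩ := dvd_of_eval_eq_zero (hAev i)
    obtain ⟨b, hb⟩ := dvd_of_eval_eq_zero ((hBev i).trans hi)
    have hfi : f.eval (P i).1 = 0 := by rw [← hPc i, hi]; ring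
    obtain ⟨g, hg⟩ := dvd_of_eval_eq_zero hfi
    have h1 : u * g = (X - C (P i).1) * (u * b ^ 2 - 2 * v * a * b + w * a ^ 2) := by
      apply mul_left_cancel₀ (X_sub_C_ne_zero (P i).1)
      rw [hg, ha, hb] at hrel2
      linear_combination hrel2
    have h2 : u.eval (P i).1 * g.eval (P i).1 = 0 := by
      rw [← eval_mul, h1]
      simp
    refine (mul_eq_zero.1 h2).resolve_right fun hg0 => ?_
    obtain ⟨g', hg'⟩ := dvd_of_eval_eq_zero hg0
    exact not_isUnit_X_sub_C (P i).1 (hf _ ⟨g', by rw [hg, hg']; ring⟩)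
  have hu0 : u = 0 := eq_zero_of_two_roots hu1 h01 (huroot 0 rfl) (huroot 1 rfl)
  have hrel3 : 2 * v * B = w * A := by
    rw [hu0] at hrel
    linear_combination hrel
  have hvroot (i : Fin 4) (hi : (P i).2 ≠ 0) : v.eval (P i).1 = 0 := by
    have h1 := congrArg (eval (P i).1) hrel3
    rw [eval_mul, eval_mul, eval_mul, hAev i, hBev i, mul_zero] at h1
    simpa [hi] using h1
  have hy (x y : ℂ) (hx : x ∉ f.roots.toFinset) (h : y ^ 2 = f.eval x) : y ≠ 0 := by
    rintro rfl
    exact hx ((hroot x).2 (by rw [← h]; ring))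
  have hv0 : v = 0 := eq_zero_of_two_roots hv1 (Ne.symm hx₃.1) (hvroot 2 (hy _ _ hx₂ hy₂))
    (hvroot 3 (hy _ _ hx₃.2 hy₃))
  have hw0 : w = 0 := by
    rw [hv0, mul_zero, zero_mul] at hrel3
    exact (mul_eq_zero.1 hrel3.symm).resolve_right hAm.ne_zero
  apply ht0
  have hcoef {a b : ℂ} (h : C a + C b * X = 0) : a = 0 ∧ b = 0 := by
    have h0 := congrArg (fun p : ℂ[X] => p.coeff 0) h
    have h1 := congrArg (fun p : ℂ[X] => p.coeff 1) h
    simp at h0 h1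
    exact ⟨h0, h1⟩
  ext i
  fin_cases i
  · exact (hcoef hu0).1
  · exact (hcoef hu0).2
  · exact (hcoef hv0).1
  · exact (hcoef hv0).2
  · exact (hcoef hw0).1
  · exact (hcoef hw0).2

/-- A triple of forms without linear syzygies is the cross product of two triples of quadratic
forms. -/
lemma exists_cross_eq {f : ℂ[X]} (hf : Squarefree f) (hdeg' : f.natDegree ≤ 8)
    {P : Fin 4 → ℂ × ℂ} (hP : P ∈ onCurve f) (hD : discFn P ≠ 0)
    (hdet : (syzMat (omA P) (omB P) (omC f P)).det ≠ 0) :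
    ∃ p q r p' q' r' : ℂ[X], p.natDegree ≤ 2 ∧ q.natDegree ≤ 2 ∧ r.natDegree ≤ 2 ∧
      p'.natDegree ≤ 2 ∧ q'.natDegree ≤ 2 ∧ r'.natDegree ≤ 2 ∧
      omA P = 2 * (p * q' - q * p') ∧ omB P = p * r' - r * p' ∧
      omC f P = 2 * (q * r' - r * q') := by
  have hAB := omB_sq_sub hdeg' hP hD
  have hAev := omA_eval P
  have hA4 := omA_natDegree P
  have hAm := omA_monic P
  have hB3 := omB_natDegree_le P
  have hC4 : (omC f P).natDegree ≤ 4 := quartQuot_natDegree_le _ _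
  set A := omA P
  set B := omB P
  set D := omC f P
  have hA1 : A.coeff 4 = 1 := by rw [← hA4]; exact hAm
  have hB0 : B.coeff 4 = 0 := coeff_eq_zero_of_natDegree_lt (by omega)
  set c := D.coeff 4 with hc
  have hlt {g : ℂ[X]} {n : ℕ} (hg : g.natDegree ≤ n + 1) (h : g.coeff (n + 1) = 0) :
      g.natDegree ≤ n := by
    by_contra h1
    have h2 : g.natDegree = n + 1 := by omega
    rw [← h2, coeff_natDegree, leadingCoeff_eq_zero] at h
    rw [h] at h2
    simp at h2
  -- Quadratic syzygies are sought with leading parts `(X², 0, -c X²)` and `(0, X² / 2, 0)`.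
  -- Contracting these parts with `(A, B, D)` leaves a defect of degree at most 5, which linear
  -- corrections absorb.
  have hg1 : (X ^ 2 * D - C c * X ^ 2 * A).natDegree ≤ 5 := by
    refine hlt ((natDegree_sub_le _ _).trans (max_le ?_ ?_)) ?_
    · exact (natDegree_mul_le_of_le (natDegree_X_pow_le 2) hC4).trans (by norm_num)
    · exact (natDegree_mul_le_of_le (natDegree_C_mul_X_pow_le c 2) hA4.le).trans (by norm_num)
    · rw [coeff_sub, mul_assoc, coeff_C_mul, coeff_X_pow_mul' , coeff_X_pow_mul']
      simp [hA1, ← hc]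
  have hg2 : (-(X ^ 2 * B)).natDegree ≤ 5 := by
    rw [natDegree_neg]
    exact natDegree_mul_le_of_le (natDegree_X_pow_le 2) hB3
  obtain ⟨p₁, q₁, r₁, hp₁, hq₁, hr₁, h₁⟩ :=
    exists_contraction_eq hdet hA4.le (hB3.trans (by norm_num)) hC4 hg1
  obtain ⟨p₂, q₂, r₂, hp₂, hq₂, hr₂, h₂⟩ :=
    exists_contraction_eq hdet hA4.le (hB3.trans (by norm_num)) hC4 hg2
  set p := X ^ 2 + p₁ with hp
  set r := -(C c * X ^ 2) + r₁ with hr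
  set q' := C (1 / 2) * X ^ 2 + q₂ with hq'
  have hs₁ : 2 * q₁ * B - p * D - r * A = 0 := by
    rw [hp, hr]
    linear_combination h₁
  have hhalf : (2 : ℂ[X]) * C (1 / 2) = 1 := by
    rw [← C_ofNat, ← C_mul]
    norm_num
  have hs₂ : 2 * q' * B - p₂ * D - r₂ * A = 0 := by
    rw [hq']
    linear_combination h₂ + X ^ 2 * B * hhalf
  have h12 {s : ℂ[X]} (hs : s.natDegree ≤ 1) : s.natDegree ≤ 2 := hs.trans (by norm_num)
  have hp2 : p.natDegree ≤ 2 := (natDegree_add_le _ _).trans (max_le (natDegree_X_pow_le 2) (h12 hp₁))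
  have hr2 : r.natDegree ≤ 2 := (natDegree_add_le _ _).trans (max_le
    ((natDegree_neg _).le.trans (natDegree_C_mul_X_pow_le c 2)) (h12 hr₁))
  have hq2 : q'.natDegree ≤ 2 := (natDegree_add_le _ _).trans (max_le
    (natDegree_C_mul_X_pow_le _ 2) (h12 hq₂))
  refine ⟨p, q₁, r, p₂, q', r₂, hp2, h12 hq₁, hr2, h12 hp₂, hq2, h12 hr₂, ?_⟩
  set a := A - 2 * (p * q' - q₁ * p₂) with ha
  set b := B - (p * r₂ - r * p₂) with hb
  set d := D - 2 * (q₁ * r₂ - r * q') with hd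
  -- Both `(A, B, D)` and the cross product are orthogonal to the two syzygies, so their difference
  -- `(a, b, d)` is proportional to `(A, B, D)`. The leading parts make `deg a ≤ 3`, and `a`
  -- vanishes at the four roots of `A`, where `B` and `D` cannot both vanish.
  have hab : a * B = b * A := by
    rw [ha, hb]
    linear_combination p₂ * hs₁ - p * hs₂
  have had : a * D = d * A := by
    rw [ha, hd]
    linear_combination 2 * q' * hs₁ - 2 * q₁ * hs₂
  have ha3 : a.natDegree ≤ 3 := by
    refine hlt ((natDegree_sub_le _ _).trans (max_le hA4.le ?_)) ?_
    · refine natDegree_mul_le_of_le (natDegree_ofNat 2).le ((natDegree_sub_le _ _).trans (max_le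
        (natDegree_mul_le_of_le hp2 hq2) (natDegree_mul_le_of_le (h12 hq₁) (h12 hp₂)))) |>.trans ?_
      norm_num
    · have e1 : (p * q').coeff 4 = 1 / 2 := by
        rw [coeff_mul_add_eq_of_natDegree_le (df := 2) (dg := 2) hp2 hq2, hp, hq', coeff_add, coeff_add,
          coeff_eq_zero_of_natDegree_lt (by omega : p₁.natDegree < 2),
          coeff_eq_zero_of_natDegree_lt (by omega : q₂.natDegree < 2)]
        simp
      have e2 : (q₁ * p₂).coeff 4 = 0 :=
        coeff_eq_zero_of_natDegree_lt ((natDegree_mul_le_of_le hq₁ hp₂).trans_lt (by norm_num))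
      rw [ha, coeff_sub, coeff_ofNat_mul, coeff_sub, e1, e2, hA1]
      norm_num
  have hinj : Function.Injective fun i => (P i).1 := by
    intro i j hij
    by_contra hne
    exact discFn_ne_zero_iff.1 hD i j hne hij
  have ha0 : a = 0 := by
    refine eq_zero_of_natDegree_lt_card_of_eval_eq_zero a hinj (fun i => ?_)
      (by rw [Fintype.card_fin]; omega)
    by_contra hai
    have e1 := congrArg (eval (P i).1) hab
    have e2 := congrArg (eval (P i).1) had
    rw [eval_mul, eval_mul, hAev i, mul_zero] at e1 e2
    exact eval_ne_zero_of_squarefree hf (by linear_combination hAB : B ^ 2 - A * D = f) (P i).1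
      ⟨hAev i, (mul_eq_zero.1 e1).resolve_left hai, (mul_eq_zero.1 e2).resolve_left hai⟩
  rw [ha0, zero_mul] at hab had
  have hb0 := (mul_eq_zero.1 hab.symm).resolve_right hAm.ne_zero
  have hd0 := (mul_eq_zero.1 had.symm).resolve_right hAm.ne_zero
  exact ⟨sub_eq_zero.1 ha0, sub_eq_zero.1 hb0, sub_eq_zero.1 hd0⟩

/-! ### The duplication map on the Kummer variety -/

lemma evVal_empty_kappa (ℓ : Fin 8 → ℂ[X]) (A B D : ℂ[X]) : evVal ℓ ∅ (kappa A B D) = 0 := by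
  have h := kappa_pf A B D
  rw [pf] at h
  rw [evVal, evForm_empty, matS_mulVec]
  simp only [dotProduct, Fin.sum_univ_eight]
  simp [kappa_zero, h]
  ring

/-- A homogeneous polynomial that vanishes at the points whose triples of forms have no linear
syzygy vanishes on the Kummer variety. -/
lemma eval_eq_zero_of_generic {f : ℂ[X]} (hf : Squarefree f) (hdeg : 7 ≤ f.natDegree)
    (hdeg' : f.natDegree ≤ 8) {n : ℕ} {g : MvPolynomial (Fin 8) ℂ} (hg : g.IsHomogeneous n)
    (h : ∀ P ∈ onCurve f, discFn P ≠ 0 → (syzMat (omA P) (omB P) (omC f P)).det ≠ 0 →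
      MvPolynomial.eval (kappa (omA P) (omB P) (omC f P)) g = 0) {ξ : Fin 8 → ℂ}
    (hξ : ξ ∈ kummerCone f) : MvPolynomial.eval ξ g = 0 := by
  refine hξ n g hg fun A B D hA hB hD hABD => ?_
  obtain ⟨P, hP, hPD, hk⟩ := exists_kappa_eq hf hdeg hdeg' hA hB hD hABD
  rw [hk]
  exact regFns_eq_zero hf (by omega)
    (eval_mem_regFns (kappa_mem_regFns regPoly_omA regPoly_omB (regPoly_omC f)) g)
    (RegPoly.det_syzMat regPoly_omA regPoly_omB (regPoly_omC f))
    (exists_det_syzMat_ne_zero hf hdeg hdeg') h P hP hPD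

lemma kappa_mem_kummerCone {f A B D : ℂ[X]} (hA : A.natDegree ≤ 4) (hB : B.natDegree ≤ 4)
    (hD : D.natDegree ≤ 4) (h : B ^ 2 - A * D = f) : kappa A B D ∈ kummerCone f :=
  fun _ _ _ hq => hq A B D hA hB hD h

section Duplication

/-- On 𝒦 the form `y_∅` vanishes, so `δ_j = ∑ c_T y_T² = c ∑ c_T ⟨τ(T), ξ⟩_S`, and the same
coefficients `c_T` recover the coordinate `ξ_j`. -/
lemma IsDuplication.exists_dupMap_kappa {ℓ : Fin 8 → ℂ[X]} {δ : Fin 8 → MvPolynomial (Fin 8) ℂ}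
    (hδ : IsDuplication ℓ δ) (hs : Split ℓ) (hf : Squarefree (∏ i, ℓ i))
    (hdeg' : (∏ i, ℓ i).natDegree ≤ 8) {P : Fin 4 → ℂ × ℂ} (hP : P ∈ onCurve (∏ i, ℓ i))
    (hD : discFn P ≠ 0) (hdet : (syzMat (omA P) (omB P) (omC (∏ i, ℓ i) P)).det ≠ 0) :
    ∃ (c : ℂ) (ξ : Fin 8 → ℂ), ξ ∈ kummerCone (∏ i, ℓ i) ∧
      dupMap δ (kappa (omA P) (omB P) (omC (∏ i, ℓ i) P)) = c • ξ ∧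
      ∀ T ∈ evenPts, evVal ℓ T (kappa (omA P) (omB P) (omC (∏ i, ℓ i) P)) ^ 2 =
        c * (matS.mulVec (tau ℓ T) ⬝ᵥ ξ) := by
  obtain ⟨p, q, r, p', q', r', hp, hq, hr, hp', hq', hr', hA, hB, hC⟩ :=
    exists_cross_eq hf hdeg' hP hD hdet
  have hAB := omB_sq_sub hdeg' hP hD
  obtain ⟨c, A', B', C', hA', hB', hC', hf', hT⟩ :=
    hs.exists_evVal_sq_eq hp hq hr hp' hq' hr' hA hB hC (by linear_combination hAB)
  refine ⟨c, _, kappa_mem_kummerCone hA' hB' hC' hf', ?_, hT⟩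
  ext j
  obtain ⟨e, he, he'⟩ := hδ.exists_eq_sum hs j
  rw [he, allPts, Finset.sum_insert empty_notMem_evenPts, evVal_empty_kappa, Pi.smul_apply,
    smul_eq_mul, ← he' (kappa A' B' C'), Finset.mul_sum]
  rw [zero_pow two_ne_zero, mul_zero, zero_add]
  refine Finset.sum_congr rfl fun T hT' => ?_
  rw [hT T hT']
  ring

variable {ℓ : Fin 8 → ℂ[X]} {δ : Fin 8 → MvPolynomial (Fin 8) ℂ}

/-- The squares of the forms `y_T` are linear forms in the duplication forms on the Kummer
variety. -/
theorem IsDuplication.evVal_sq_eq (hδ : IsDuplication ℓ δ) (hs : Split ℓ)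
    (hf : Squarefree (∏ i, ℓ i)) (hdeg : 7 ≤ (∏ i, ℓ i).natDegree)
    (hdeg' : (∏ i, ℓ i).natDegree ≤ 8) {ξ : Fin 8 → ℂ} (hξ : ξ ∈ kummerCone (∏ i, ℓ i))
    {T : Finset (Fin 8)} (hT : T ∈ evenPts) :
    evVal ℓ T ξ ^ 2 = matS.mulVec (tau ℓ T) ⬝ᵥ dupMap δ ξ := by
  set v := matS.mulVec (tau ℓ T) with hv
  set g : MvPolynomial (Fin 8) ℂ := evPoly ℓ T ^ 2 - ∑ i, MvPolynomial.C (v i) * δ i with hg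
  have hev (x : Fin 8 → ℂ) : MvPolynomial.eval x g = evVal ℓ T x ^ 2 - v ⬝ᵥ dupMap δ x := by
    rw [hg, map_sub, map_pow, eval_evPoly, map_sum]
    simp [dotProduct, dupMap]
  have hgh : g.IsHomogeneous 4 := MvPolynomial.IsHomogeneous.sub ((isHomogeneous_evPoly ℓ T).pow 2)
    (MvPolynomial.IsHomogeneous.sum _ _ _ fun i _ => (hδ.homogeneous i).C_mul _)
  have h := eval_eq_zero_of_generic hf hdeg hdeg' hgh (fun P hP hD hdet => by
    obtain ⟨c, ξ', -, h1, h2⟩ := hδ.exists_dupMap_kappa hs hf hdeg' hP hD hdet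
    rw [hev, h1, h2 T hT, dotProduct_smul, smul_eq_mul, sub_self]) hξ
  rw [hev] at h
  exact sub_eq_zero.1 h

lemma eval_smul_of_isHomogeneous {n : ℕ} {q : MvPolynomial (Fin 8) ℂ} (hq : q.IsHomogeneous n)
    (c : ℂ) (x : Fin 8 → ℂ) : MvPolynomial.eval (c • x) q = c ^ n * MvPolynomial.eval x q := by
  rw [MvPolynomial.eval_eq', MvPolynomial.eval_eq', Finset.mul_sum]
  refine Finset.sum_congr rfl fun d hd => ?_
  have h1 : ∑ i, d i = n := by
    rw [← Finsupp.degree_eq_sum, Finsupp.degree_eq_weight_one]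
    exact hq (MvPolynomial.mem_support_iff.1 hd)
  simp only [Pi.smul_apply, smul_eq_mul, mul_pow, Finset.prod_mul_distrib,
    Finset.prod_pow_eq_pow_sum, h1]
  ring

/-- The duplication map preserves the Kummer variety. -/
theorem IsDuplication.dupMap_mem (hδ : IsDuplication ℓ δ) (hs : Split ℓ)
    (hf : Squarefree (∏ i, ℓ i)) (hdeg : 7 ≤ (∏ i, ℓ i).natDegree)
    (hdeg' : (∏ i, ℓ i).natDegree ≤ 8) {ξ : Fin 8 → ℂ} (hξ : ξ ∈ kummerCone (∏ i, ℓ i)) :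
    dupMap δ ξ ∈ kummerCone (∏ i, ℓ i) := by
  intro n q hq hvan
  have hev (q : MvPolynomial (Fin 8) ℂ) (x : Fin 8 → ℂ) :
      MvPolynomial.eval x (MvPolynomial.aeval δ q) = MvPolynomial.eval (dupMap δ x) q := by
    induction q using MvPolynomial.induction_on with
    | C a => simp
    | add p q hp hq => rw [map_add, map_add, map_add, hp, hq]
    | mul_X p i hp =>
      rw [map_mul, map_mul, map_mul, hp, MvPolynomial.aeval_X, MvPolynomial.eval_X]
      rfl
  rw [← hev]
  refine eval_eq_zero_of_generic hf hdeg hdeg' (hq.aeval δ hδ.homogeneous)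
    (fun P hP hD hdet => ?_) hξ
  obtain ⟨c, ξ', h0, h1, -⟩ := hδ.exists_dupMap_kappa hs hf hdeg' hP hD hdet
  rw [hev, h1, eval_smul_of_isHomogeneous hq, h0 n q hq hvan, mul_zero]

/-- The duplication map does not vanish on the Kummer variety. -/
theorem IsDuplication.dupMap_ne_zero (hδ : IsDuplication ℓ δ) (hs : Split ℓ)
    (hf : Squarefree (∏ i, ℓ i)) (hdeg : 7 ≤ (∏ i, ℓ i).natDegree)
    (hdeg' : (∏ i, ℓ i).natDegree ≤ 8) {ξ : Fin 8 → ℂ} (hξ : ξ ∈ kummerCone (∏ i, ℓ i))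
    (hξ0 : ξ ≠ 0) : dupMap δ ξ ≠ 0 := by
  intro h
  apply hξ0
  ext j
  have h1 : ξ j ^ 2 = 0 := by
    rw [hs.sq_eq_sum]
    refine Finset.sum_eq_zero fun T hT => ?_
    have h2 := hδ.evVal_sq_eq hs hf hdeg hdeg' hξ hT
    rw [h, dotProduct_zero] at h2
    rw [pow_eq_zero_iff two_ne_zero] at h2
    rw [h2, mul_zero]
  exact (pow_eq_zero_iff two_ne_zero).1 h1

end Duplication

/-! ### Splittings of squarefree polynomials -/

/-- A factorisation of a squarefree polynomial of degree at least 7 into eight linear forms has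
pairwise non-proportional factors. -/
theorem Split.of_squarefree {ℓ : Fin 8 → ℂ[X]} (hℓ : ∀ i, (ℓ i).natDegree ≤ 1)
    (hf : Squarefree (∏ i, ℓ i)) (hdeg : 7 ≤ (∏ i, ℓ i).natDegree) : Split ℓ := by
  refine ⟨hℓ, fun i j hij hb => ?_⟩
  have hne : ∏ i, ℓ i ≠ 0 := fun h => by simp [h] at hdeg
  have hlin (i : Fin 8) : ℓ i = C (rtZ ℓ i) * X - C (rtX ℓ i) := by
    rw [rtZ, rtX, map_neg, sub_neg_eq_add]
    exact eq_X_add_C_of_natDegree_le_one (hℓ i)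
  have hprod : ∏ i, ℓ i = ℓ i * ℓ j * ∏ m ∈ (Finset.univ.erase i).erase j, ℓ m := by
    rw [mul_assoc, Finset.mul_prod_erase _ _ (Finset.mem_erase.2 ⟨hij.symm, Finset.mem_univ j⟩),
      Finset.mul_prod_erase _ _ (Finset.mem_univ i)]
  have hij0 (m : Fin 8) : ℓ m ≠ 0 := fun h => hne (Finset.prod_eq_zero (Finset.mem_univ m) h)
  rw [brk] at hb
  -- Two constant factors would leave total degree at most 6; two proportional nonconstant ones
  -- would give a square divisor.
  have hrest : (∏ m ∈ (Finset.univ.erase i).erase j, ℓ m).natDegree ≤ 6 := by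
    refine (natDegree_prod_le _ _).trans ((Finset.sum_le_card_nsmul _ _ 1 fun m _ => hℓ m).trans ?_)
    rw [Finset.card_erase_of_mem (Finset.mem_erase.2 ⟨hij.symm, Finset.mem_univ j⟩),
      Finset.card_erase_of_mem (Finset.mem_univ i)]
    simp
  by_cases hi : rtZ ℓ i = 0
  · have hXi : rtX ℓ i ≠ 0 := fun h => hij0 i (by rw [hlin, hi, h]; simp)
    have hj : rtZ ℓ j = 0 := by
      rw [hi, mul_zero, sub_zero] at hb
      exact (mul_eq_zero.1 hb).resolve_left hXi
    have h1 : (ℓ i * ℓ j).natDegree ≤ 0 := by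
      rw [hlin i, hlin j, hi, hj]
      simp only [C_0, zero_mul, zero_sub, neg_mul_neg, ← C_mul, natDegree_C, le_refl]
    have := natDegree_mul_le (p := ℓ i * ℓ j) (q := ∏ m ∈ (Finset.univ.erase i).erase j, ℓ m)
    rw [← hprod] at this
    omega
  · have hdvd : ℓ i ∣ ℓ j := by
      refine ⟨C (rtZ ℓ j / rtZ ℓ i), ?_⟩
      have h2 : rtX ℓ j = rtX ℓ i * (rtZ ℓ j / rtZ ℓ i) := by
        field_simp
        linear_combination -hb
      have h3 : rtZ ℓ j = rtZ ℓ i * (rtZ ℓ j / rtZ ℓ i) := by field_simp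
      conv_lhs => rw [hlin j, h2]
      conv_rhs => rw [hlin i]
      conv_lhs => enter [1, 1]; rw [h3]
      rw [C_mul, C_mul]
      ring
    have hu : IsUnit (ℓ i) := by
      apply hf
      rw [hprod]
      exact (mul_dvd_mul_left _ hdvd).trans (dvd_mul_right _ _)
    have h4 := natDegree_eq_zero_of_isUnit hu
    apply hi
    rw [rtZ]
    exact coeff_eq_zero_of_natDegree_lt (by omega)

lemma squarefree_map {k : Type*} [Field k] [CharZero k] {f : k[X]} (hf : Squarefree f)
    (σ : k →+* ℂ) : Squarefree (f.map σ) :=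
  (Separable.map (PerfectField.separable_iff_squarefree.2 hf)).squarefree

/-! ### Contraction and convergence of the iteration -/

section Iteration

variable {ℓ : Fin 8 → ℂ[X]}

lemma archFun_nonneg (d : Fin 8 → ℝ) (j : Fin 8) : 0 ≤ archFun ℓ d j := Real.sqrt_nonneg _

lemma Split.exists_upsilon_ne_zero (hs : Split ℓ) (j : Fin 8) :
    ∃ T ∈ evenPts, upsilon ℓ T j ≠ 0 := by
  by_contra! h
  have h1 := hs.sq_eq_sum (Pi.single j 1) j
  rw [Finset.sum_eq_zero fun T hT => by rw [h T hT, zero_mul], Pi.single_eq_same] at h1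
  norm_num at h1

lemma Split.archFun_pos (hs : Split ℓ) {d : Fin 8 → ℝ} (hd : ∀ i, 0 < d i) (j : Fin 8) :
    0 < archFun ℓ d j := by
  refine Real.sqrt_pos.2 ?_
  obtain ⟨T, hT, h0⟩ := hs.exists_upsilon_ne_zero j
  refine Finset.sum_pos' (fun T _ => by positivity) ⟨T, hT, mul_pos (norm_pos_iff.2 h0) ?_⟩
  refine Real.sqrt_pos.2 (Finset.sum_pos' (fun i _ => by positivity) ⟨0, Finset.mem_univ _, ?_⟩)
  rw [tau_zero, norm_one, one_mul]
  exact abs_pos.2 (hd _).ne'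

lemma sqrt_exp_mul (a x : ℝ) : √(Real.exp a * x) = Real.exp (a / 2) * √x := by
  rw [Real.sqrt_mul (Real.exp_pos a).le, Real.exp_half]

lemma archFun_exp_smul (d : Fin 8 → ℝ) (a : ℝ) :
    archFun ℓ (fun i => Real.exp a * d i) = fun j => Real.exp (a / 4) * archFun ℓ d j := by
  ext j
  have h (T : Finset (Fin 8)) : ∑ i, ‖tau ℓ T i‖ * |Real.exp a * d i.rev| =
      Real.exp a * ∑ i, ‖tau ℓ T i‖ * |d i.rev| := by
    rw [Finset.mul_sum]
    refine Finset.sum_congr rfl fun i _ => ?_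
    rw [abs_mul, abs_of_pos (Real.exp_pos a)]
    ring
  simp only [archFun, h, sqrt_exp_mul]
  rw [show a / 4 = a / 2 / 2 by ring, ← sqrt_exp_mul, Finset.mul_sum]
  congr 1
  exact Finset.sum_congr rfl fun T _ => by ring

lemma archFun_mono {d e : Fin 8 → ℝ} (hd : ∀ i, 0 ≤ d i) (h : ∀ i, d i ≤ e i) (j : Fin 8) :
    archFun ℓ d j ≤ archFun ℓ e j := by
  refine Real.sqrt_le_sqrt (Finset.sum_le_sum fun T _ =>
    mul_le_mul_of_nonneg_left (Real.sqrt_le_sqrt (Finset.sum_le_sum fun i _ =>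
      mul_le_mul_of_nonneg_left ?_ (norm_nonneg _))) (norm_nonneg _))
  rw [abs_of_nonneg (hd _), abs_of_nonneg ((hd _).trans (h _))]
  exact h _

lemma archSeq_succ (n : ℕ) : archSeq ℓ (n + 1) = archFun ℓ (archSeq ℓ n) :=
  Function.iterate_succ_apply' _ _ _

lemma Split.archSeq_pos (hs : Split ℓ) (n : ℕ) (j : Fin 8) : 0 < archSeq ℓ n j := by
  induction n generalizing j with
  | zero => exact zero_lt_one
  | succ n ih => rw [archSeq_succ]; exact hs.archFun_pos ih j

/-- A monotone map that is homogeneous of degree 1/4, the effect of two nested square roots,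
contracts the supremum distance of logarithms by 1/4. -/
lemma Split.abs_log_archFun_sub_le (hs : Split ℓ) {d e : Fin 8 → ℝ} (hd : ∀ i, 0 < d i)
    (he : ∀ i, 0 < e i) {a : ℝ} (h : ∀ i, |Real.log (d i) - Real.log (e i)| ≤ a) (j : Fin 8) :
    |Real.log (archFun ℓ d j) - Real.log (archFun ℓ e j)| ≤ a / 4 := by
  have key {d e : Fin 8 → ℝ} (hd : ∀ i, 0 < d i) (he : ∀ i, 0 < e i)
      (h : ∀ i, Real.log (d i) - Real.log (e i) ≤ a) :
      Real.log (archFun ℓ d j) - Real.log (archFun ℓ e j) ≤ a / 4 := by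
    have h1 (i : Fin 8) : d i ≤ Real.exp a * e i := by
      rw [← Real.log_le_log_iff (hd i) (mul_pos (Real.exp_pos a) (he i)),
        Real.log_mul (Real.exp_pos a).ne' (he i).ne', Real.log_exp]
      linarith [h i]
    have h2 := archFun_mono (ℓ := ℓ) (fun i => (hd i).le) h1 j
    rw [archFun_exp_smul] at h2
    have h3 := Real.log_le_log (hs.archFun_pos hd j) h2
    rw [Real.log_mul (Real.exp_pos _).ne' (hs.archFun_pos he j).ne', Real.log_exp] at h3
    linarith
  refine abs_le.2 ⟨?_, key hd he fun i => (abs_le.1 (h i)).2⟩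
  have := key he hd fun i => by linarith [(abs_le.1 (h i)).1]
  linarith

/-- The iteration converges to a vector with positive entries. -/
theorem Split.exists_tendsto_archSeq (hs : Split ℓ) :
    ∃ b : Fin 8 → ℝ, (∀ j, 0 < b j) ∧ Tendsto (archSeq ℓ) atTop (𝓝 b) := by
  obtain ⟨K, hK⟩ : ∃ K, ∀ j, |Real.log (archSeq ℓ 0 j) - Real.log (archSeq ℓ 1 j)| ≤ K :=
    ⟨∑ j, |Real.log (archSeq ℓ 0 j) - Real.log (archSeq ℓ 1 j)|, fun j =>
      Finset.single_le_sum (f := fun j => |Real.log (archSeq ℓ 0 j) - Real.log (archSeq ℓ 1 j)|)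
        (fun i _ => abs_nonneg _) (Finset.mem_univ j)⟩
  have h1 (n : ℕ) (j : Fin 8) :
      |Real.log (archSeq ℓ n j) - Real.log (archSeq ℓ (n + 1) j)| ≤ K * (1 / 4) ^ n := by
    induction n generalizing j with
    | zero => simpa using hK j
    | succ n ih =>
      have := hs.abs_log_archFun_sub_le (hs.archSeq_pos n) (hs.archSeq_pos (n + 1)) ih j
      rw [archSeq_succ n, archSeq_succ (n + 1)]
      refine this.trans (le_of_eq ?_)
      ring
  have h2 (j : Fin 8) : ∃ c, Tendsto (fun n => Real.log (archSeq ℓ n j)) atTop (𝓝 c) :=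
    cauchySeq_tendsto_of_complete
      (cauchySeq_of_le_geometric (1 / 4) K (by norm_num) fun n => h1 n j)
  choose c hc using h2
  refine ⟨fun j => Real.exp (c j), fun j => Real.exp_pos _, tendsto_pi_nhds.2 fun j => ?_⟩
  refine ((Real.continuous_exp.tendsto _).comp (hc j)).congr fun n => ?_
  exact Real.exp_log (hs.archSeq_pos n j)

lemma norm_archSeq_one_sq_le : ‖archSeq ℓ 1‖ ^ 2 ≤ ‖archVec ℓ‖ := by
  have h : ‖archSeq ℓ 1‖ ≤ √‖archVec ℓ‖ := by
    refine (pi_norm_le_iff_of_nonneg (Real.sqrt_nonneg _)).2 fun j => ?_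
    have h1 : archSeq ℓ 1 j = √(archVec ℓ j) := by
      simp [archSeq, archFun, archVec]
    rw [h1, Real.norm_of_nonneg (Real.sqrt_nonneg _)]
    exact Real.sqrt_le_sqrt ((le_abs_self _).trans (norm_le_pi_norm (archVec ℓ) j))
  exact (Real.le_sqrt (norm_nonneg _) (norm_nonneg _)).1 h

end Iteration

/-! ### Bounds for a point in terms of its multiples -/

section Bounds

variable {ℓ : Fin 8 → ℂ[X]} {δ : Fin 8 → MvPolynomial (Fin 8) ℂ}

lemma norm_matS_mulVec_dotProduct_le (t y : Fin 8 → ℂ) :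
    ‖matS.mulVec t ⬝ᵥ y‖ ≤ ∑ i, ‖t i‖ * ‖y i.rev‖ := by
  rw [matS_mulVec, dotProduct, ← Equiv.sum_comp Fin.revPerm]
  refine (norm_sum_le _ _).trans (Finset.sum_le_sum fun i _ => le_of_eq ?_)
  rw [norm_mul]
  congr 1
  fin_cases i <;> simp [Fin.revPerm, Fin.rev]

/-- Bounds for `δ` bound `y_T² = ⟨τ(T), δ⟩_S`, hence `|y_T|`, hence `ξ_j² = ∑ υ_j(T) y_T`. The scale
`s` enters `δ`, `y_T` and `ξ` with exponents 4, 2 and 1. -/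
lemma IsDuplication.norm_apply_le (hδ : IsDuplication ℓ δ) (hs : Split ℓ)
    (hf : Squarefree (∏ i, ℓ i)) (hdeg : 7 ≤ (∏ i, ℓ i).natDegree)
    (hdeg' : (∏ i, ℓ i).natDegree ≤ 8) {ξ : Fin 8 → ℂ} (hξ : ξ ∈ kummerCone (∏ i, ℓ i))
    {d : Fin 8 → ℝ} {s : ℝ} (hs0 : 0 ≤ s) (hd : ∀ i, ‖dupMap δ ξ i‖ ≤ s ^ 4 * d i) (j : Fin 8) :
    ‖ξ j‖ ≤ s * archFun ℓ d j := by
  have h1 (T) (hT : T ∈ evenPts) :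
      ‖evVal ℓ T ξ‖ ≤ s ^ 2 * √(∑ i, ‖tau ℓ T i‖ * |d i.rev|) := by
    refine le_of_sq_le_sq ?_ (by positivity)
    rw [mul_pow, Real.sq_sqrt (Finset.sum_nonneg fun i _ => by positivity), ← norm_pow,
      hδ.evVal_sq_eq hs hf hdeg hdeg' hξ hT, Finset.mul_sum]
    refine (norm_matS_mulVec_dotProduct_le _ _).trans (Finset.sum_le_sum fun i _ => ?_)
    calc ‖tau ℓ T i‖ * ‖dupMap δ ξ i.rev‖ ≤ ‖tau ℓ T i‖ * (s ^ 4 * |d i.rev|) := by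
          gcongr
          exact (hd _).trans (mul_le_mul_of_nonneg_left (le_abs_self _) (by positivity))
      _ = _ := by ring
  refine le_of_sq_le_sq ?_ (mul_nonneg hs0 (archFun_nonneg _ _))
  rw [mul_pow, archFun, Real.sq_sqrt (Finset.sum_nonneg fun T _ => by positivity), ← norm_pow,
    hs.sq_eq_sum, Finset.mul_sum]
  refine (norm_sum_le _ _).trans (Finset.sum_le_sum fun T hT => ?_)
  rw [norm_mul]
  calc _ ≤ ‖upsilon ℓ T j‖ * (s ^ 2 * √(∑ i, ‖tau ℓ T i‖ * |d i.rev|)) := by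
        gcongr
        exact h1 T hT
    _ = _ := by ring

lemma IsDuplication.iterate_mem (hδ : IsDuplication ℓ δ) (hs : Split ℓ)
    (hf : Squarefree (∏ i, ℓ i)) (hdeg : 7 ≤ (∏ i, ℓ i).natDegree)
    (hdeg' : (∏ i, ℓ i).natDegree ≤ 8) {ξ : Fin 8 → ℂ} (hξ : ξ ∈ kummerCone (∏ i, ℓ i))
    (hξ0 : ξ ≠ 0) (n : ℕ) :
    (dupMap δ)^[n] ξ ∈ kummerCone (∏ i, ℓ i) ∧ (dupMap δ)^[n] ξ ≠ 0 := by
  induction n with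
  | zero => exact ⟨hξ, hξ0⟩
  | succ n ih =>
    rw [Function.iterate_succ_apply']
    exact ⟨hδ.dupMap_mem hs hf hdeg hdeg' ih.1, hδ.dupMap_ne_zero hs hf hdeg hdeg' ih.1 ih.2⟩

/-- The induction passes to `δ(ξ)` with scale `s⁴` and pulls the resulting bound back through one
application of `f_v`. -/
lemma IsDuplication.norm_apply_le_mul_archSeq (hδ : IsDuplication ℓ δ) (hs : Split ℓ)
    (hf : Squarefree (∏ i, ℓ i)) (hdeg : 7 ≤ (∏ i, ℓ i).natDegree)
    (hdeg' : (∏ i, ℓ i).natDegree ≤ 8) (n : ℕ) {ξ : Fin 8 → ℂ}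
    (hξ : ξ ∈ kummerCone (∏ i, ℓ i)) {s : ℝ} (hs0 : 0 ≤ s)
    (h : ‖(dupMap δ)^[n] ξ‖ ≤ s ^ 4 ^ n) (j : Fin 8) :
    ‖ξ j‖ ≤ s * archSeq ℓ n j := by
  induction n generalizing ξ s j with
  | zero =>
    rw [pow_zero, pow_one] at h
    simpa [archSeq] using (norm_le_pi_norm ξ j).trans h
  | succ n ih =>
    rw [archSeq_succ]
    refine hδ.norm_apply_le hs hf hdeg hdeg' hξ hs0 (fun i => ?_) j
    refine ih (hδ.dupMap_mem hs hf hdeg hdeg' hξ) (by positivity) ?_ i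
    rw [← pow_mul, ← pow_succ']
    exact h

theorem IsDuplication.log_norm_le (hδ : IsDuplication ℓ δ) (hs : Split ℓ)
    (hf : Squarefree (∏ i, ℓ i)) (hdeg : 7 ≤ (∏ i, ℓ i).natDegree)
    (hdeg' : (∏ i, ℓ i).natDegree ≤ 8) (n : ℕ) {ξ : Fin 8 → ℂ}
    (hξ : ξ ∈ kummerCone (∏ i, ℓ i)) (hξ0 : ξ ≠ 0) :
    Real.log ‖ξ‖ ≤ Real.log ‖(dupMap δ)^[n] ξ‖ / 4 ^ n + Real.log ‖archSeq ℓ n‖ := by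
  have h0 := norm_pos_iff.2 (hδ.iterate_mem hs hf hdeg hdeg' hξ hξ0 n).2
  set x := Real.log ‖(dupMap δ)^[n] ξ‖ / 4 ^ n with hx
  have h1 : ‖(dupMap δ)^[n] ξ‖ ≤ Real.exp x ^ 4 ^ n := by
    rw [← Real.exp_nat_mul, hx]
    push_cast
    rw [mul_div_cancel₀ _ (by positivity), Real.exp_log h0]
  have h2 : ‖ξ‖ ≤ Real.exp x * ‖archSeq ℓ n‖ := by
    refine (pi_norm_le_iff_of_nonneg (by positivity)).2 fun j => ?_
    refine (hδ.norm_apply_le_mul_archSeq hs hf hdeg hdeg' n hξ (Real.exp_pos x).le h1 j).trans ?_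
    gcongr
    exact (le_abs_self _).trans (norm_le_pi_norm (archSeq ℓ n) j)
  have h3 : archSeq ℓ n ≠ 0 := fun h => by simpa [h] using hs.archSeq_pos n 0
  have h4 := Real.log_le_log (norm_pos_iff.2 hξ0) h2
  rwa [Real.log_mul (Real.exp_pos x).ne' (norm_pos_iff.2 h3).ne', Real.log_exp] at h4

/-- The case `n = 1` of `log_norm_le` gives `-ε ≤ 4 log ‖b₁‖`, and the entries of `b₁` are the
square roots of those of `archVec`. -/
theorem IsDuplication.neg_localEps_le (hδ : IsDuplication ℓ δ) (hs : Split ℓ)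
    (hf : Squarefree (∏ i, ℓ i)) (hdeg : 7 ≤ (∏ i, ℓ i).natDegree)
    (hdeg' : (∏ i, ℓ i).natDegree ≤ 8) {ξ : Fin 8 → ℂ}
    (hξ : ξ ∈ kummerCone (∏ i, ℓ i)) (hξ0 : ξ ≠ 0) :
    -localEps δ ξ ≤ Real.log (‖archVec ℓ‖ ^ 2) := by
  have h1 := hδ.log_norm_le hs hf hdeg hdeg' 1 hξ hξ0
  have h3 : archSeq ℓ 1 ≠ 0 := fun h => by simpa [h] using hs.archSeq_pos 1 0
  have h2 := Real.log_le_log (pow_pos (norm_pos_iff.2 h3) 2) (norm_archSeq_one_sq_le (ℓ := ℓ))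
  rw [Real.log_pow] at h2 ⊢
  rw [Function.iterate_one] at h1
  rw [localEps]
  push_cast at *
  linarith

end Bounds

/-! ### The series for the local height correction -/

lemma norm_eval_le_of_isHomogeneous {n : ℕ} {q : MvPolynomial (Fin 8) ℂ} (hq : q.IsHomogeneous n)
    (x : Fin 8 → ℂ) :
    ‖MvPolynomial.eval x q‖ ≤ (∑ d ∈ q.support, ‖q.coeff d‖) * ‖x‖ ^ n := by
  rw [MvPolynomial.eval_eq', Finset.sum_mul]
  refine (norm_sum_le _ _).trans (Finset.sum_le_sum fun d hd => ?_)
  have h1 : ∑ i, d i = n := by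
    rw [← Finsupp.degree_eq_sum, Finsupp.degree_eq_weight_one]
    exact hq (MvPolynomial.mem_support_iff.1 hd)
  rw [norm_mul, norm_prod, ← h1, ← Finset.prod_pow_eq_pow_sum]
  gcongr with i
  rw [norm_pow]
  gcongr
  exact norm_le_pi_norm x i

section LocalHeight

variable {ℓ : Fin 8 → ℂ[X]} {δ : Fin 8 → MvPolynomial (Fin 8) ℂ}

/-- A crude upper bound by the coefficients of `δ` suffices: it only serves to make the series
summable. -/
lemma IsDuplication.exists_localEps_le (hδ : IsDuplication ℓ δ) :
    ∃ K, ∀ ξ : Fin 8 → ℂ, ξ ≠ 0 → dupMap δ ξ ≠ 0 → localEps δ ξ ≤ K := by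
  set c : ℝ := 1 + ∑ j, ∑ d ∈ (δ j).support, ‖(δ j).coeff d‖ with hc
  have hs0 : 0 ≤ ∑ j, ∑ d ∈ (δ j).support, ‖(δ j).coeff d‖ :=
    Finset.sum_nonneg fun j _ => Finset.sum_nonneg fun d _ => norm_nonneg _
  have hc0 : 0 < c := by positivity
  refine ⟨Real.log c, fun ξ h0 h1 => ?_⟩
  have h2 : ‖dupMap δ ξ‖ ≤ c * ‖ξ‖ ^ 4 := by
    refine (pi_norm_le_iff_of_nonneg (by positivity)).2 fun j => ?_
    refine (norm_eval_le_of_isHomogeneous (hδ.homogeneous j) ξ).trans ?_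
    gcongr
    have := Finset.single_le_sum (f := fun j => ∑ d ∈ (δ j).support, ‖(δ j).coeff d‖)
      (fun i _ => Finset.sum_nonneg fun d _ => norm_nonneg _) (Finset.mem_univ j)
    linarith
  have h3 := Real.log_le_log (norm_pos_iff.2 h1) h2
  rw [Real.log_mul hc0.ne' (by have := norm_pos_iff.2 h0; positivity), Real.log_pow] at h3
  rw [localEps]
  push_cast at h3
  linarith

lemma muTerm_add (ξ : Fin 8 → ℂ) (n N : ℕ) :
    muTerm δ ξ (n + N) = muTerm δ ((dupMap δ)^[N] ξ) n / 4 ^ N := by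
  rw [muTerm, muTerm, Function.iterate_add_apply, div_div, ← pow_add]
  ring_nf

lemma sum_range_muTerm (ξ : Fin 8 → ℂ) (n : ℕ) :
    ∑ m ∈ Finset.range n, muTerm δ ξ m =
      Real.log ‖(dupMap δ)^[n] ξ‖ / 4 ^ n - Real.log ‖ξ‖ := by
  induction n with
  | zero => simp
  | succ n ih =>
    rw [Finset.sum_range_succ, ih, muTerm, localEps, Function.iterate_succ_apply', pow_succ]
    field_simp
    ring

/-- The terms of the series for `μ` are bounded geometrically, uniformly on the Kummer variety. -/
theorem IsDuplication.exists_abs_muTerm_le (hδ : IsDuplication ℓ δ) (hs : Split ℓ)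
    (hf : Squarefree (∏ i, ℓ i)) (hdeg : 7 ≤ (∏ i, ℓ i).natDegree)
    (hdeg' : (∏ i, ℓ i).natDegree ≤ 8) :
    ∃ K, ∀ ξ ∈ kummerCone (∏ i, ℓ i), ξ ≠ 0 → ∀ n, ‖muTerm δ ξ n‖ ≤ K * (1 / 4) ^ n := by
  obtain ⟨K, hK⟩ := hδ.exists_localEps_le
  refine ⟨max K (Real.log (‖archVec ℓ‖ ^ 2)) / 4, fun ξ hξ h0 n => ?_⟩
  have h1 := hδ.iterate_mem hs hf hdeg hdeg' hξ h0 n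
  have h2 := hδ.neg_localEps_le hs hf hdeg hdeg' h1.1 h1.2
  have h3 := hK _ h1.2 (hδ.dupMap_ne_zero hs hf hdeg hdeg' h1.1 h1.2)
  have h4 : |localEps δ ((dupMap δ)^[n] ξ)| ≤ max K (Real.log (‖archVec ℓ‖ ^ 2)) :=
    abs_le'.2 ⟨h3.trans (le_max_left _ _), h2.trans (le_max_right _ _)⟩
  rw [muTerm, norm_div, Real.norm_eq_abs, Real.norm_of_nonneg (by positivity : (0:ℝ) ≤ 4 ^ (n + 1)),
    div_mul_eq_mul_div, one_div, inv_pow, ← div_eq_mul_inv, div_div, ← pow_succ]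
  gcongr

theorem IsDuplication.summable_muTerm (hδ : IsDuplication ℓ δ) (hs : Split ℓ)
    (hf : Squarefree (∏ i, ℓ i)) (hdeg : 7 ≤ (∏ i, ℓ i).natDegree)
    (hdeg' : (∏ i, ℓ i).natDegree ≤ 8) {ξ : Fin 8 → ℂ}
    (hξ : ξ ∈ kummerCone (∏ i, ℓ i)) (hξ0 : ξ ≠ 0) : Summable (muTerm δ ξ) := by
  obtain ⟨K, hK⟩ := hδ.exists_abs_muTerm_le hs hf hdeg hdeg'
  exact Summable.of_norm_bounded
    ((summable_geometric_of_lt_one (by norm_num) (by norm_num)).mul_left K) (hK ξ hξ hξ0)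

theorem IsDuplication.tendsto_localMu (hδ : IsDuplication ℓ δ) (hs : Split ℓ)
    (hf : Squarefree (∏ i, ℓ i)) (hdeg : 7 ≤ (∏ i, ℓ i).natDegree)
    (hdeg' : (∏ i, ℓ i).natDegree ≤ 8) {ξ : Fin 8 → ℂ}
    (hξ : ξ ∈ kummerCone (∏ i, ℓ i)) (hξ0 : ξ ≠ 0) :
    Tendsto (fun n : ℕ => Real.log ‖(dupMap δ)^[n] ξ‖ / 4 ^ n - Real.log ‖ξ‖) atTop
      (𝓝 (localMu δ ξ)) :=
  (hδ.summable_muTerm hs hf hdeg hdeg' hξ hξ0).hasSum.tendsto_sum_nat.congr (sum_range_muTerm ξ)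

/-- Splitting off `N` terms gives `-μ(P) ≤ log ‖b_N‖ + 4^{-N} (-μ(2^N P))`. With `σ` the supremum of
`-μ` over 𝒦, which is finite by the uniform geometric bound, this reads `σ ≤ log ‖b_N‖ + 4^{-N} σ`,
to be solved for `σ`. -/
theorem IsDuplication.neg_localMu_le (hδ : IsDuplication ℓ δ) (hs : Split ℓ)
    (hf : Squarefree (∏ i, ℓ i)) (hdeg : 7 ≤ (∏ i, ℓ i).natDegree)
    (hdeg' : (∏ i, ℓ i).natDegree ≤ 8) {ξ : Fin 8 → ℂ}
    (hξ : ξ ∈ kummerCone (∏ i, ℓ i)) (hξ0 : ξ ≠ 0) {N : ℕ} (hN : 1 ≤ N) :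
    -localMu δ ξ ≤ (4 : ℝ) ^ N / ((4 : ℝ) ^ N - 1) * Real.log ‖archSeq ℓ N‖ := by
  set S : Set ℝ := {x | ∃ ζ ∈ kummerCone (∏ i, ℓ i), ζ ≠ 0 ∧ x = -localMu δ ζ} with hS
  have hbdd : BddAbove S := by
    obtain ⟨K, hK⟩ := hδ.exists_abs_muTerm_le hs hf hdeg hdeg'
    refine ⟨K * (1 - 1 / 4)⁻¹, ?_⟩
    rintro _ ⟨ζ, hζ, h0, rfl⟩
    refine (neg_le_abs _).trans (tsum_of_norm_bounded
      ((hasSum_geometric_of_lt_one (by norm_num) (by norm_num)).mul_left K) (hK ζ hζ h0))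
  have hstep {ζ : Fin 8 → ℂ} (hζ : ζ ∈ kummerCone (∏ i, ℓ i)) (h0 : ζ ≠ 0) :
      -localMu δ ζ ≤ Real.log ‖archSeq ℓ N‖ + sSup S / 4 ^ N := by
    have h1 := (hδ.summable_muTerm hs hf hdeg hdeg' hζ h0).sum_add_tsum_nat_add N
    simp only [muTerm_add, tsum_div_const] at h1
    rw [sum_range_muTerm] at h1
    have h2 := hδ.log_norm_le hs hf hdeg hdeg' N hζ h0
    have h3 := hδ.iterate_mem hs hf hdeg hdeg' hζ h0 N
    have h4 : -localMu δ ((dupMap δ)^[N] ζ) ≤ sSup S := le_csSup hbdd ⟨_, h3.1, h3.2, rfl⟩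
    have h5 : -localMu δ ((dupMap δ)^[N] ζ) / 4 ^ N ≤ sSup S / 4 ^ N := by gcongr
    rw [neg_div] at h5
    simp only [localMu] at h1 h5 ⊢
    linarith
  have hsup : sSup S ≤ Real.log ‖archSeq ℓ N‖ + sSup S / 4 ^ N := by
    refine csSup_le ⟨_, ξ, hξ, hξ0, rfl⟩ ?_
    rintro _ ⟨ζ, hζ, h0, rfl⟩
    exact hstep hζ h0
  have h4 : (1 : ℝ) < 4 ^ N := one_lt_pow₀ (by norm_num) (by omega)
  refine (le_csSup hbdd ⟨ξ, hξ, hξ0, rfl⟩).trans ?_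
  rw [div_mul_eq_mul_div, le_div_iff₀ (by linarith)]
  have h6 : sSup S / 4 ^ N * 4 ^ N = sSup S := div_mul_cancel₀ _ (by positivity)
  nlinarith [mul_le_mul_of_nonneg_right hsup (by positivity : (0:ℝ) ≤ 4 ^ N)]

theorem IsDuplication.neg_localMu_le_log_limit (hδ : IsDuplication ℓ δ) (hs : Split ℓ)
    (hf : Squarefree (∏ i, ℓ i)) (hdeg : 7 ≤ (∏ i, ℓ i).natDegree)
    (hdeg' : (∏ i, ℓ i).natDegree ≤ 8) {ξ : Fin 8 → ℂ}
    (hξ : ξ ∈ kummerCone (∏ i, ℓ i)) (hξ0 : ξ ≠ 0) {b : Fin 8 → ℝ} (hb0 : ∀ j, 0 < b j)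
    (hb : Tendsto (archSeq ℓ) atTop (𝓝 b)) : -localMu δ ξ ≤ Real.log ‖b‖ := by
  have h1 : b ≠ 0 := fun h => by simpa [h] using hb0 0
  -- Positivity of the limit is needed here for continuity of the logarithm.
  have h2 : Tendsto (fun N => Real.log ‖archSeq ℓ N‖) atTop (𝓝 (Real.log ‖b‖)) :=
    hb.norm.log (norm_ne_zero_iff.2 h1)
  have h3 : Tendsto (fun N : ℕ => (1 - (1 / 4 : ℝ) ^ N)⁻¹) atTop (𝓝 (1 - 0)⁻¹) :=
    (tendsto_const_nhds.sub (tendsto_pow_atTop_nhds_zero_of_lt_one (by norm_num)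
      (by norm_num))).inv₀ (by norm_num)
  have h4 := h3.mul h2
  rw [sub_zero, inv_one, one_mul] at h4
  refine ge_of_tendsto h4 ((eventually_ge_atTop 1).mono fun N hN => ?_)
  refine (hδ.neg_localMu_le hs hf hdeg hdeg' hξ hξ0 hN).trans (le_of_eq ?_)
  have h5 : (1 : ℝ) < 4 ^ N := one_lt_pow₀ (by norm_num) (by omega)
  have h6 : (4 : ℝ) ^ N - 1 ≠ 0 := by linarith
  congr 1
  rw [div_pow, one_pow]
  field_simp

end LocalHeight

end

end Kum3

/-! ### Summation over the archimedean places -/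

theorem lemmaL {k : Type*} [Field k] [NumberField k] (f : k[X]) (hf : Squarefree f)
    (hdeg : f.natDegree = 7 ∨ f.natDegree = 8)
    (ℓ : NumberField.InfinitePlace k → Fin 8 → ℂ[X]) (hℓ : ∀ v i, (ℓ v i).natDegree ≤ 1)
    (hfℓ : ∀ v, f.map v.embedding = ∏ i, ℓ v i) :
    -- the forms defining the duplication map exist
    (∀ v, ∃ δ, Kum3.IsDuplication (ℓ v) δ) ∧
    -- for every choice of them
    ∀ δ : NumberField.InfinitePlace k → Fin 8 → MvPolynomial (Fin 8) ℂ,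
      (∀ v, Kum3.IsDuplication (ℓ v) (δ v)) →
      -- `δ` can be iterated on the Kummer variety, and `μ_v` is well-defined
      (∀ v, ∀ P ∈ Kum3.kummerCone (f.map v.embedding), P ≠ 0 →
        (∀ n : ℕ, (Kum3.dupMap (δ v))^[n] P ∈ Kum3.kummerCone (f.map v.embedding) ∧
          (Kum3.dupMap (δ v))^[n] P ≠ 0) ∧
        Summable (Kum3.muTerm (δ v) P) ∧
        Tendsto (fun n : ℕ => Real.log ‖(Kum3.dupMap (δ v))^[n] P‖ / 4 ^ n - Real.log ‖P‖) atTop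
          (𝓝 (Kum3.localMu (δ v) P))) ∧
      -- the bound for `γ_v`
      (∀ v, ∀ P ∈ Kum3.kummerCone (f.map v.embedding), P ≠ 0 →
        -Kum3.localEps (δ v) P ≤ Real.log (‖Kum3.archVec (ℓ v)‖ ^ 2)) ∧
      -- convergence of the iteration and the bounds for `μ_v`
      ∃ b : NumberField.InfinitePlace k → Fin 8 → ℝ,
        (∀ v, Tendsto (Kum3.archSeq (ℓ v)) atTop (𝓝 (b v))) ∧
        (∀ v, ∀ P ∈ Kum3.kummerCone (f.map v.embedding), P ≠ 0 →
          (∀ N : ℕ, 1 ≤ N →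
            -Kum3.localMu (δ v) P ≤
              (4 : ℝ) ^ N / ((4 : ℝ) ^ N - 1) * Real.log ‖Kum3.archSeq (ℓ v) N‖) ∧
          -Kum3.localMu (δ v) P ≤ Real.log ‖b v‖) ∧
        -- the archimedean contribution to the difference of heights at a `k`-rational point
        (∀ P : Fin 8 → k, P ≠ 0 →
          (∀ v : NumberField.InfinitePlace k,
            (fun j => v.embedding (P j)) ∈ Kum3.kummerCone (f.map v.embedding)) →
          (∀ N : ℕ, 1 ≤ N →
            ∑ v : NumberField.InfinitePlace k,
                (v.mult : ℝ) * -Kum3.localMu (δ v) (fun j => v.embedding (P j)) ≤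
              ∑ v : NumberField.InfinitePlace k, (v.mult : ℝ) *
                ((4 : ℝ) ^ N / ((4 : ℝ) ^ N - 1) * Real.log ‖Kum3.archSeq (ℓ v) N‖)) ∧
          ∑ v : NumberField.InfinitePlace k,
              (v.mult : ℝ) * -Kum3.localMu (δ v) (fun j => v.embedding (P j)) ≤
            ∑ v : NumberField.InfinitePlace k, (v.mult : ℝ) * Real.log ‖b v‖) := by
  have hsq (v) : Squarefree (∏ i, ℓ v i) := hfℓ v ▸ Kum3.squarefree_map hf _
  have hnd (v) : (∏ i, ℓ v i).natDegree = f.natDegree := by rw [← hfℓ v, natDegree_map]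
  have h7 (v) : 7 ≤ (∏ i, ℓ v i).natDegree := by rw [hnd]; omega
  have h8 (v) : (∏ i, ℓ v i).natDegree ≤ 8 := by rw [hnd]; omega
  have hs (v) : Kum3.Split (ℓ v) := .of_squarefree (hℓ v) (hsq v) (h7 v)
  simp only [hfℓ]
  refine ⟨fun v => (hs v).exists_isDuplication, fun δ hδ => ?_⟩
  choose b hb0 hb using fun v => (hs v).exists_tendsto_archSeq
  refine ⟨fun v P hP h0 => ⟨(hδ v).iterate_mem (hs v) (hsq v) (h7 v) (h8 v) hP h0,
      (hδ v).summable_muTerm (hs v) (hsq v) (h7 v) (h8 v) hP h0,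
      (hδ v).tendsto_localMu (hs v) (hsq v) (h7 v) (h8 v) hP h0⟩,
    fun v P hP h0 => (hδ v).neg_localEps_le (hs v) (hsq v) (h7 v) (h8 v) hP h0,
    b, hb, fun v P hP h0 =>
      ⟨fun N hN => (hδ v).neg_localMu_le (hs v) (hsq v) (h7 v) (h8 v) hP h0 hN,
        (hδ v).neg_localMu_le_log_limit (hs v) (hsq v) (h7 v) (h8 v) hP h0 (hb0 v) (hb v)⟩,
    fun P h0 hP => ?_⟩
  have hne (v : NumberField.InfinitePlace k) : (fun j => v.embedding (P j)) ≠ 0 := by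
    obtain ⟨j, hj⟩ := Function.ne_iff.1 h0
    exact Function.ne_iff.2 ⟨j, (map_ne_zero v.embedding).2 hj⟩
  refine ⟨fun N hN => Finset.sum_le_sum fun v _ => mul_le_mul_of_nonneg_left
      ((hδ v).neg_localMu_le (hs v) (hsq v) (h7 v) (h8 v) (hP v) (hne v) hN) (Nat.cast_nonneg _),
    Finset.sum_le_sum fun v _ => mul_le_mul_of_nonneg_left
      ((hδ v).neg_localMu_le_log_limit (hs v) (hsq v) (h7 v) (h8 v) (hP v) (hne v) (hb0 v) (hb v))
      (Nat.cast_nonneg _)⟩
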